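/- Let $\varphi\in(0,\tfrac{\pi}{2})$ and $\rho>1$. Let $\mathcal W_\rho$ be the Banach space of loops $h=\sum_{k\in\mathbb Z}h_k\lambda^k$ on the unit circle with $\|h\|_\rho=\sum_k|h_k|\rho^{|k|}<\infty$, and let $\mathcal W^{\ge0}_{\mathbb R,\rho}$ be the real subspace of those $h$ with $h_k=0$ for $k<0$ and all $h_k$ real. For a parameter vector $\mathbf x=(\tilde a,\tilde b,\tilde c,r,\theta)\in(\mathcal W^{\ge0}_{\mathbb R,\rho})^3\times\mathbb R^2$ put $$a=\tfrac12(\lambda^{-1}-\lambda)+\tilde a,\qquad b=-\tfrac12\sin(\varphi)(\lambda^{-1}+\lambda)+\tilde b,\qquad c=-\tfrac12\cos(\varphi)(\lambda^{-1}+\lambda)+\tilde c .$$ The central value of the parameters is $\underline{\mathbf x}=(0,0,0,1,\tfrac{\pi}{2})$. Let $p_1=e^{i\varphi}$, $p_2=-e^{-i\varphi}$, $p_3=-e^{i\varphi}$, $p_4=e^{-i\varphi}$ and $$A_1=\begin{pmatrix} ia& b+ic\\ b-ic&-ia\end{pmatrix},\quad A_2=\begin{pmatrix} -ia& -b+ic\\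 -b-ic&ia\end{pmatrix},\quad A_3=\begin{pmatrix} ia& -b-ic\\ -b+ic&-ia\end{pmatrix},\quad A_4=\begin{pmatrix} -ia& b-ic\\ b+ic&ia\end{pmatrix}.$$ For real $t$ let $\eta=r\,t\sum_{k=1}^4A_k(\lambda)\frac{dz}{z-p_k}$, let $\Phi$ be the solution of $d\Phi=\Phi\eta$, $\Phi(0)=\mathrm{Id}$, along the segments from $z=0$ to $z=1$ and to $z=i$, and put $\mathcal P=\Phi(1)$, $\mathcal Q=\Phi(i)$, $$\mathfrak p=\mathcal P_{11}\mathcal P_{21}-\mathcal P_{12}\mathcal P_{22},\qquad \mathfrak q=i\left(\mathcal Q_{11}\mathcal Q_{21}+\mathcal Q_{12}\mathcal Q_{22}\right).$$ With $\mathbf x$ fixed, let $\widehat{\mathfrak p}(t)=(\mathfrak p(t)-\mathfrak p(0))/t$ for $t\neq0$ and $\widehat{\mathfrak p}(0)=\frac{d\mathfrak p}{dt}(0)$; define $\widehat{\mathfrak q}$ in the same way. Write $f^*(\lambda)=\overline{f(1/\overline\lambda)}$. The pair $(t,\mathbf x)$ solves the Monodromy Problem if, on the unit circle, $\widehat{\mathfrak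 p}=\widehat{\mathfrak p}^*$, $\widehat{\mathfrak q}=\widehat{\mathfrak q}^*$ and $\det(rA_1)=-1$, and if $\theta\in(0,\pi)$ and $\widehat{\mathfrak p}=\widehat{\mathfrak q}=0$ at $\lambda=e^{i\theta}$. Then there is a family $t\mapsto\mathbf x(t)$, continuous at $t=0$ with $\mathbf x(0)=\underline{\mathbf x}$, such that $(t,\mathbf x(t))$ solves the Monodromy Problem for all $t$ close to $0$, and this family is locally unique: every solution $(t,\mathbf y)$ of the Monodromy Problem sufficiently close to $(0,\underline{\mathbf x})$ has $\mathbf y=\mathbf x(t)$. The parameters $a,b,c$ (as $\mathcal W_\rho$-valued functions of $t$), $r$ and $\theta$ of this family are differentiable at $t=0$, and their $t$-derivatives there are $$a'=a'_0+a'_2\lambda^2,\qquad b'=b'_0+b'_2\lambda^2,\qquad c'=c'_0+c'_2\lambda^2$$ with $$\begin{aligned} a'_0&=a'_2=\sin(2\varphi)\log(\tan\varphi),\\ b'_2&=-2\cos(\varphi)\log(\cos\varphi),\qquad c'_2=2\sin(\varphi)\log(\sin\varphi),\\ b'_0&=b'_2\cos(2\varphi)-c'_2\sin(2\varphi),\qquad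 c'_0=-b'_2\sin(2\varphi)-c'_2\cos(2\varphi). \end{aligned}$$ Moreover $r'=0$ and $\theta'=2\sin(2\varphi)\log(\tan\varphi)$. -/

import Mathlib

open Filter Topology

noncomputable section

namespace DPW

/-! ## The Wiener space of loops -/

/-- Families of Fourier coefficients `(h_k)`, `k ∈ ℤ`. (A separate type, so that it does not carry
the product topology.) -/
def Coeffs : Type := ℤ → ℂ

instance : AddCommGroup Coeffs := inferInstanceAs (AddCommGroup (ℤ → ℂ))
instance : Module ℂ Coeffs := inferInstanceAs (Module ℂ (ℤ → ℂ))

/-- Loops `h = ∑ h_k λ^k` on the unit circle with `∑ |h_k| ρ^|k| < ∞`, given by their Fourier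
coefficients. -/
def wienerSubmodule (ρ : ℝ) [Fact (1 < ρ)] : Submodule ℂ Coeffs where
  carrier := {h | Summable fun k : ℤ => ‖h k‖ * ρ ^ k.natAbs}
  zero_mem' := by
    have h : (fun k : ℤ => ‖(0 : Coeffs) k‖ * ρ ^ k.natAbs) = fun _ => 0 := by
      funext k
      change ‖(0 : ℂ)‖ * _ = 0
      simp
    change Summable fun k : ℤ => ‖(0 : Coeffs) k‖ * ρ ^ k.natAbs
    rw [h]
    exact summable_zero
  add_mem' := by
    intro f g hf hg
    have hρ : 0 < ρ := lt_trans one_pos Fact.out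
    refine Summable.of_nonneg_of_le (fun k => by positivity) (fun k => ?_) (hf.add hg)
    change ‖f k + g k‖ * _ ≤ _
    rw [← add_mul]
    exact mul_le_mul_of_nonneg_right (norm_add_le _ _) (by positivity)
  smul_mem' := by
    intro c f hf
    refine (hf.mul_left ‖c‖).congr (fun k => ?_)
    change ‖c‖ * (‖f k‖ * _) = ‖c * f k‖ * _
    rw [norm_mul, mul_assoc]

/-- The space `𝒲_ρ`. -/
def W (ρ : ℝ) [Fact (1 < ρ)] : Type := wienerSubmodule ρ

section Wiener

variable {ρ : ℝ} [Fact (1 < ρ)]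

instance : AddCommGroup (W ρ) := inferInstanceAs (AddCommGroup (wienerSubmodule ρ))
instance : Module ℂ (W ρ) := inferInstanceAs (Module ℂ (wienerSubmodule ρ))

/-- The `k`-th Fourier coefficient of a loop. -/
def W.coeff (h : W ρ) (k : ℤ) : ℂ := h.1 k

/-- The value `h(λ) = ∑ h_k λ^k`. -/
def W.eval (h : W ρ) (l : ℂ) : ℂ := ∑' k : ℤ, h.coeff k * l ^ k

instance : Norm (W ρ) := ⟨fun h => ∑' k : ℤ, ‖h.coeff k‖ * ρ ^ k.natAbs⟩

theorem W.norm_def (h : W ρ) : ‖h‖ = ∑' k : ℤ, ‖h.coeff k‖ * ρ ^ k.natAbs := rfl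

theorem W.summable (h : W ρ) : Summable fun k : ℤ => ‖h.coeff k‖ * ρ ^ k.natAbs := h.2

theorem W.coeff_add (f g : W ρ) (k : ℤ) : (f + g).coeff k = f.coeff k + g.coeff k := rfl

theorem W.coeff_smul (c : ℂ) (f : W ρ) (k : ℤ) : (c • f).coeff k = c * f.coeff k := rfl

theorem W.coeff_zero (k : ℤ) : (0 : W ρ).coeff k = 0 := rfl

theorem W.ext_coeff {f g : W ρ} (h : ∀ k, f.coeff k = g.coeff k) : f = g :=
  Subtype.ext (funext h)

theorem W.term_nonneg (f : W ρ) (k : ℤ) : 0 ≤ ‖f.coeff k‖ * ρ ^ k.natAbs :=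
  mul_nonneg (norm_nonneg _) (pow_nonneg (le_trans zero_le_one (Fact.out : 1 < ρ).le) _)

theorem W.core : NormedSpace.Core ℂ (W ρ) where
  norm_nonneg f := tsum_nonneg f.term_nonneg
  norm_smul c f := by
    rw [W.norm_def, W.norm_def, ← tsum_mul_left]
    refine tsum_congr fun k => ?_
    rw [W.coeff_smul, norm_mul, mul_assoc]
  norm_triangle f g := by
    rw [W.norm_def, W.norm_def, W.norm_def, ← f.summable.tsum_add g.summable]
    refine (f + g).summable.tsum_le_tsum (fun k => ?_) (f.summable.add g.summable)
    rw [W.coeff_add, ← add_mul]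
    exact mul_le_mul_of_nonneg_right (norm_add_le _ _)
      (pow_nonneg (le_trans zero_le_one (Fact.out : 1 < ρ).le) _)
  norm_eq_zero_iff f := by
    have hρ : 0 < ρ := lt_trans one_pos Fact.out
    constructor
    · intro h
      have hs := f.summable.hasSum
      rw [← W.norm_def, h] at hs
      have h0 := (hasSum_zero_iff_of_nonneg f.term_nonneg).1 hs
      refine W.ext_coeff fun k => ?_
      have hk := congrFun h0 k
      simpa [hρ.ne', W.coeff_zero] using hk
    · rintro rfl
      rw [W.norm_def]
      simp [W.coeff_zero]

instance : NormedAddCommGroup (W ρ) := NormedAddCommGroup.ofCore W.core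
instance : NormedSpace ℂ (W ρ) := NormedSpace.ofCore W.core

/-- The monomial loop `c λ^n`. -/
def W.mono (n : ℤ) (c : ℂ) : W ρ :=
  ⟨(Pi.single n c : ℤ → ℂ), by
    refine summable_of_ne_finset_zero (s := {n}) fun k hk => ?_
    have hk' : k ≠ n := by simpa using hk
    change ‖(Pi.single n c : ℤ → ℂ) k‖ * _ = 0
    simp [hk']⟩

variable (ρ) in
/-- `𝒲_{ℝ,ρ}^{≥0}`: loops `h` with `h_k = 0` for `k < 0` and
`conj (h (conj λ)) = h λ`, i.e. with real Fourier coefficients. -/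
def WRplus : Submodule ℝ (W ρ) where
  carrier := {h | (∀ k < 0, h.coeff k = 0) ∧ ∀ k, starRingEnd ℂ (h.coeff k) = h.coeff k}
  zero_mem' := ⟨fun k _ => W.coeff_zero k, fun k => by simp [W.coeff_zero]⟩
  add_mem' := by
    rintro f g ⟨hf, hf'⟩ ⟨hg, hg'⟩
    exact ⟨fun k hk => by rw [W.coeff_add, hf k hk, hg k hk, add_zero],
      fun k => by rw [W.coeff_add, map_add, hf', hg']⟩
  smul_mem' := by
    rintro c f ⟨hf, hf'⟩
    have h : ∀ k, (c • f).coeff k = (c : ℂ) * f.coeff k := fun _ => rfl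
    exact ⟨fun k hk => by rw [h, hf k hk, mul_zero],
      fun k => by rw [h, map_mul, hf', Complex.conj_ofReal]⟩

variable (ρ) in
/-- Parameter vectors `(ã, b̃, c̃, r, θ)`. -/
def Param : Type := WRplus ρ × WRplus ρ × WRplus ρ × ℝ × ℝ

instance : NormedAddCommGroup (Param ρ) :=
  inferInstanceAs (NormedAddCommGroup (WRplus ρ × WRplus ρ × WRplus ρ × ℝ × ℝ))
instance : NormedSpace ℝ (Param ρ) :=
  inferInstanceAs (NormedSpace ℝ (WRplus ρ × WRplus ρ × WRplus ρ × ℝ × ℝ))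

/-- The loop `a = (λ⁻¹ - λ)/2 + ã`. -/
def Param.a (x : Param ρ) : W ρ := W.mono (-1) (1 / 2) - W.mono 1 (1 / 2) + (x.1 : W ρ)

/-- The loop `b = -(sin φ)(λ⁻¹ + λ)/2 + b̃`. -/
def Param.b (φ : ℝ) (x : Param ρ) : W ρ :=
  W.mono (-1) (-(1 / 2) * Real.sin φ) + W.mono 1 (-(1 / 2) * Real.sin φ) + (x.2.1 : W ρ)

/-- The loop `c = -(cos φ)(λ⁻¹ + λ)/2 + c̃`. -/
def Param.c (φ : ℝ) (x : Param ρ) : W ρ :=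
  W.mono (-1) (-(1 / 2) * Real.cos φ) + W.mono 1 (-(1 / 2) * Real.cos φ) + (x.2.2.1 : W ρ)

def Param.r (x : Param ρ) : ℝ := x.2.2.2.1

def Param.θ (x : Param ρ) : ℝ := x.2.2.2.2

variable (ρ) in
/-- The central value `(0, 0, 0, 1, π/2)`. -/
def Param.center : Param ρ := (0, 0, 0, 1, Real.pi / 2)

end Wiener

/-! ## The Fuchsian potential and its principal solutions -/

/-- The punctures `e^{iφ}, -e^{-iφ}, -e^{iφ}, e^{-iφ}`. -/
def puncture (φ : ℝ) : Fin 4 → ℂ :=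
  ![Complex.exp (Complex.I * φ), -Complex.exp (-(Complex.I * φ)),
    -Complex.exp (Complex.I * φ), Complex.exp (-(Complex.I * φ))]

open Complex in
/-- The residue matrices `A_1, …, A_4` at a point `λ`, in terms of the values there of the
loops `a, b, c`. -/
def residueMatrix (a b c : ℂ) : Fin 4 → Matrix (Fin 2) (Fin 2) ℂ :=
  ![!![I * a, b + I * c; b - I * c, -(I * a)],
    !![-(I * a), -b + I * c; -b - I * c, I * a],
    !![I * a, -b - I * c; -b + I * c, -(I * a)],
    !![-(I * a), b - I * c; b + I * c, I * a]]

/-- `Y` is the solution of `dΦ = Φ η`, `Φ(0) = Id`, along the segment `s ↦ s w`, `0 ≤ s ≤ 1`, where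
`η = E(z) dz`. -/
def IsFrameAlong (E : ℂ → Matrix (Fin 2) (Fin 2) ℂ) (w : ℂ)
    (Y : ℝ → Matrix (Fin 2) (Fin 2) ℂ) : Prop :=
  Y 0 = 1 ∧ ∀ s ∈ Set.Icc (0 : ℝ) 1, ∀ i j,
    HasDerivWithinAt (fun u => Y u i j) ((Y s * (w • E (s * w))) i j) (Set.Icc 0 1) s

open Classical in
/-- The principal solution along the segment from `0` to `w`: the value at `w` of the solution of
`dΦ = Φ η`, `Φ(0) = Id`. If `E` is continuous on the segment, the linear equation has exactly one
solution there; the value `1` in the other case is a dummy. -/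
def principal (E : ℂ → Matrix (Fin 2) (Fin 2) ℂ) (w : ℂ) : Matrix (Fin 2) (Fin 2) ℂ :=
  if h : ∃ Y, IsFrameAlong E w Y then h.choose 1 else 1

section Monodromy

variable {ρ : ℝ} [Fact (1 < ρ)]

/-- The residue `A_{k+1}(λ)` for the parameter vector `x`. -/
def A (φ : ℝ) (x : Param ρ) (l : ℂ) (k : Fin 4) : Matrix (Fin 2) (Fin 2) ℂ :=
  residueMatrix (x.a.eval l) ((x.b φ).eval l) ((x.c φ).eval l) k

/-- The coefficient of `dz` in the potential `η = r t ∑ A_k(λ) dz / (z - p_k)`. -/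
def potential (φ t : ℝ) (x : Param ρ) (l z : ℂ) : Matrix (Fin 2) (Fin 2) ℂ :=
  ((x.r : ℂ) * t) • ∑ k, (z - puncture φ k)⁻¹ • A φ x l k

/-- `𝒫 = Φ(1)`. -/
def P (φ t : ℝ) (x : Param ρ) (l : ℂ) : Matrix (Fin 2) (Fin 2) ℂ :=
  principal (potential φ t x l) 1

/-- `𝒬 = Φ(i)`. -/
def Q (φ t : ℝ) (x : Param ρ) (l : ℂ) : Matrix (Fin 2) (Fin 2) ℂ :=
  principal (potential φ t x l) Complex.I

/-- `𝔭 = 𝒫₁₁ 𝒫₂₁ - 𝒫₁₂ 𝒫₂₂`. -/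
def frakP (φ t : ℝ) (x : Param ρ) (l : ℂ) : ℂ :=
  P φ t x l 0 0 * P φ t x l 1 0 - P φ t x l 0 1 * P φ t x l 1 1

/-- `𝔮 = i (𝒬₁₁ 𝒬₂₁ + 𝒬₁₂ 𝒬₂₂)`. -/
def frakQ (φ t : ℝ) (x : Param ρ) (l : ℂ) : ℂ :=
  Complex.I * (Q φ t x l 0 0 * Q φ t x l 1 0 + Q φ t x l 0 1 * Q φ t x l 1 1)

/-- `𝔭̂`: the difference quotient `(𝔭(t) - 𝔭(0)) / t` if `t ≠ 0`, and the derivative `𝔭'(0)` if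
`t = 0`, at a fixed parameter vector. -/
def hatP (φ t : ℝ) (x : Param ρ) (l : ℂ) : ℂ := dslope (fun s : ℝ => frakP φ s x l) 0 t

/-- `𝔮̂`, likewise. -/
def hatQ (φ t : ℝ) (x : Param ρ) (l : ℂ) : ℂ := dslope (fun s : ℝ => frakQ φ s x l) 0 t

/-- `f*(λ) = conj (f (1 / conj λ))`. -/
def starInv (f : ℂ → ℂ) (l : ℂ) : ℂ := starRingEnd ℂ (f (1 / starRingEnd ℂ l))

/-- The Monodromy Problem: `𝓕 = 𝔭̂ - 𝔭̂* = 0`, `𝓖 = 𝔮̂ - 𝔮̂* = 0` and `𝓚 = det (r A₁) = -1` as loops,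
and `𝓗₁ = 𝔭̂(e^{iθ}) = 0`, `𝓗₂ = 𝔮̂(e^{iθ}) = 0` with `θ ∈ (0, π)`. -/
structure SolvesMonodromyProblem (φ t : ℝ) (x : Param ρ) : Prop where
  F_eq : ∀ l : ℂ, ‖l‖ = 1 → hatP φ t x l - starInv (hatP φ t x) l = 0
  G_eq : ∀ l : ℂ, ‖l‖ = 1 → hatQ φ t x l - starInv (hatQ φ t x) l = 0
  K_eq : ∀ l : ℂ, ‖l‖ = 1 → ((x.r : ℂ) • A φ x l 0).det = -1
  θ_mem : x.θ ∈ Set.Ioo 0 Real.pi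
  H₁_eq : hatP φ t x (Complex.exp (Complex.I * x.θ)) = 0
  H₂_eq : hatQ φ t x (Complex.exp (Complex.I * x.θ)) = 0

end Monodromy

end DPW

end

/-!
The loops `𝔭̂` and `𝔮̂` have real Fourier coefficients, and by Picard iteration they depend smoothly
on `(t, x)`: `𝔭̂ = 2π r c + t R(t, x)`, and `𝔮̂ = 2π r b + t R'(t, x)` since the rotation `z ↦ i z`
exchanges `b` and `c` and replaces `φ` by `π/2 - φ`. For a loop `f` with real coefficients,
`f = f*` and `f(e^{iθ}) = 0` amount to one equation in the loops without negative powers of `λ`,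
namely that the nonnegative part of `f - f*`, with its constant term replaced by the real part of
`f(e^{iθ})`, vanishes. Together with the determinant condition the Monodromy Problem is thus a `C¹`
equation between Banach spaces. Its derivative in `x` at the central value is invertible: the first
two equations determine `b̃'` and `c̃'` up to the effect of `θ'`, and the determinant equation
divides by `1 - λ²`, the remainder of degree at most one giving `θ'` and `r'`. The implicit function
theorem yields the family.

Its derivative requires `R(0, x)`, a second-order iterated integral of the potential along `[0, 1]`,
proportional to the product of the loops `a` and `b`. Its scalar factor is found by differentiating
the integral with respect to the angle `φ`.
-/

noncomputable section

namespace DPW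

section Fourier

variable {T : ℝ} [Fact (0 < T)]

theorem eq_zero_of_tsum_fourier_eq_zero {c : ℤ → ℂ} (hc : Summable fun k => ‖c k‖)
    (h : ∀ x : AddCircle T, ∑' k, c k * fourier k x = 0) : c = 0 := by
  have hF : Summable fun k => c k • (fourier k : C(AddCircle T, ℂ)) :=
    .of_norm (by simpa only [norm_smul, fourier_norm, mul_one] using hc)
  have hF0 : HasSum (fun k => c k • (fourier k : C(AddCircle T, ℂ))) 0 := by
    convert hF.hasSum
    ext x
    rw [ContinuousMap.zero_apply, ← ContinuousMap.tsum_apply hF, ← h x]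
    simp only [ContinuousMap.smul_apply, smul_eq_mul]
  have hL2 : HasSum (fun k => c k • fourierLp (T := T) 2 k) 0 := by
    simpa only [map_smul, map_zero] using
      (ContinuousMap.toLp 2 AddCircle.haarAddCircle ℂ).hasSum hF0
  funext n
  have hn : HasSum (fun k => if k = n then c n else 0) 0 := by
    have hinner := (innerSL ℂ (fourierLp (T := T) 2 n)).hasSum hL2
    rw [map_zero] at hinner
    refine hinner.congr_fun fun k => ?_
    rw [map_smul, innerSL_apply_apply, orthonormal_iff_ite.1 orthonormal_fourier, smul_eq_mul]
    rcases eq_or_ne k n with rfl | hk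
    · rw [if_pos rfl, if_pos rfl, mul_one]
    · rw [if_neg hk, if_neg hk.symm, mul_zero]
  exact (hasSum_ite_eq n (c n)).unique hn

end Fourier

/-- The bijection `(n, k) ↦ (k, n - k)`, which arranges the terms of a product of two series into
those of their convolution. -/
def convolutionEquiv (G : Type*) [AddCommGroup G] : G × G ≃ G × G :=
  (Equiv.prodComm G G).trans ((Equiv.refl G).prodShear Equiv.subRight)

section WienerAlgebra

variable {ρ : ℝ} [Fact (1 < ρ)]

namespace W

theorem weight_pos (k : ℤ) : 0 < ρ ^ k.natAbs := pow_pos (one_pos.trans Fact.out) _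

theorem one_le_weight (k : ℤ) : 1 ≤ ρ ^ k.natAbs := one_le_pow₀ (Fact.out : 1 < ρ).le

theorem weight_le_mul (n k : ℤ) : ρ ^ n.natAbs ≤ ρ ^ k.natAbs * ρ ^ (n - k).natAbs := by
  rw [← pow_add]
  exact pow_le_pow_right₀ (Fact.out : 1 < ρ).le (by lia)

theorem norm_coeff_mul_weight_le (f : W ρ) (k : ℤ) : ‖f.coeff k‖ * ρ ^ k.natAbs ≤ ‖f‖ :=
  f.summable.le_tsum k fun j _ => f.term_nonneg j

theorem norm_coeff_le (f : W ρ) (k : ℤ) : ‖f.coeff k‖ ≤ ‖f‖ :=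
  (le_mul_of_one_le_right (norm_nonneg _) (one_le_weight k)).trans (f.norm_coeff_mul_weight_le k)

theorem summable_norm_coeff (f : W ρ) : Summable fun k => ‖f.coeff k‖ :=
  f.summable.of_nonneg_of_le (fun _ => norm_nonneg _)
    fun k => le_mul_of_one_le_right (norm_nonneg _) (one_le_weight k)

theorem coeff_sub (f g : W ρ) (k : ℤ) : (f - g).coeff k = f.coeff k - g.coeff k := rfl

theorem coeff_real_smul (c : ℝ) (f : W ρ) (k : ℤ) : (c • f).coeff k = c * f.coeff k := rfl

theorem coeff_mono (n : ℤ) (c : ℂ) (k : ℤ) :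
    (mono n c : W ρ).coeff k = if k = n then c else 0 :=
  Pi.single_apply n c k

/-- The loop with given Fourier coefficients. -/
def ofCoeff (c : ℤ → ℂ) (h : Summable fun k : ℤ => ‖c k‖ * ρ ^ k.natAbs) : W ρ := ⟨c, h⟩

theorem coeff_ofCoeff (c : ℤ → ℂ) (h : Summable fun k : ℤ => ‖c k‖ * ρ ^ k.natAbs) (k : ℤ) :
    (ofCoeff c h).coeff k = c k := rfl

/-- The identification `h ↦ (h_k ρ^|k|)` of `𝒲_ρ` with `ℓ¹(ℤ)`, from which `𝒲_ρ` inherits its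
completeness. -/
def equivLp : W ρ ≃ lp (fun _ : ℤ => ℂ) 1 where
  toFun h := ⟨fun k => h.coeff k * (ρ ^ k.natAbs : ℝ), memℓp_gen <| by
    simpa only [ENNReal.toReal_one, Real.rpow_one, norm_mul, Complex.norm_real,
      Real.norm_of_nonneg (weight_pos (ρ := ρ) _).le] using h.summable⟩
  invFun u := ofCoeff (fun k => u k / (ρ ^ k.natAbs : ℝ)) <| by
    refine ((memℓp_gen_iff (p := 1) (by simp)).1 u.2).congr fun k => ?_
    rw [norm_div, Complex.norm_real, Real.norm_of_nonneg (weight_pos k).le,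
      div_mul_cancel₀ _ (weight_pos k).ne', ENNReal.toReal_one, Real.rpow_one]
  left_inv h := ext_coeff fun k =>
    mul_div_cancel_right₀ _ (Complex.ofReal_ne_zero.2 (weight_pos k).ne')
  right_inv u := lp.ext <| funext fun k =>
    div_mul_cancel₀ _ (Complex.ofReal_ne_zero.2 (weight_pos k).ne')

theorem equivLp_apply (f : W ρ) (k : ℤ) : equivLp f k = f.coeff k * (ρ ^ k.natAbs : ℝ) := rfl

theorem isometry_equivLp : Isometry (equivLp (ρ := ρ)) := by
  refine Isometry.of_dist_eq fun f g => ?_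
  rw [dist_eq_norm, dist_eq_norm, lp.norm_eq_tsum_rpow (by simp), norm_def]
  simp only [ENNReal.toReal_one, Real.rpow_one, div_one]
  refine tsum_congr fun k => ?_
  rw [lp.coeFn_sub, Pi.sub_apply, equivLp_apply, equivLp_apply, ← sub_mul, norm_mul,
    Complex.norm_real, Real.norm_of_nonneg (weight_pos k).le, coeff_sub]

instance : CompleteSpace (W ρ) :=
  (IsometryEquiv.mk equivLp isometry_equivLp).completeSpace

theorem norm_coeff_mul_zpow (f : W ρ) {l : ℂ} (hl : ‖l‖ = 1) (k : ℤ) :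
    ‖f.coeff k * l ^ k‖ = ‖f.coeff k‖ := by
  rw [norm_mul, norm_zpow, hl, one_zpow, mul_one]

theorem summable_norm_eval (f : W ρ) {l : ℂ} (hl : ‖l‖ = 1) :
    Summable fun k : ℤ => ‖f.coeff k * l ^ k‖ := by
  simpa only [f.norm_coeff_mul_zpow hl] using f.summable_norm_coeff

theorem summable_eval (f : W ρ) {l : ℂ} (hl : ‖l‖ = 1) : Summable fun k : ℤ => f.coeff k * l ^ k :=
  (f.summable_norm_eval hl).of_norm

theorem norm_eval_le (f : W ρ) {l : ℂ} (hl : ‖l‖ = 1) : ‖f.eval l‖ ≤ ‖f‖ := by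
  refine (norm_tsum_le_tsum_norm (f.summable_norm_eval hl)).trans ?_
  refine (f.summable_norm_eval hl).tsum_le_tsum (fun k => ?_) f.summable
  rw [f.norm_coeff_mul_zpow hl]
  exact le_mul_of_one_le_right (norm_nonneg _) (one_le_weight k)

theorem eval_add (f g : W ρ) {l : ℂ} (hl : ‖l‖ = 1) : (f + g).eval l = f.eval l + g.eval l := by
  simp only [eval, coeff_add, add_mul, (f.summable_eval hl).tsum_add (g.summable_eval hl)]

theorem eval_sub (f g : W ρ) {l : ℂ} (hl : ‖l‖ = 1) : (f - g).eval l = f.eval l - g.eval l := by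
  simp only [eval, coeff_sub, sub_mul, (f.summable_eval hl).tsum_sub (g.summable_eval hl)]

theorem eval_smul (c : ℂ) (f : W ρ) (l : ℂ) : (c • f).eval l = c * f.eval l := by
  simp only [eval, coeff_smul, mul_assoc, tsum_mul_left]

theorem eval_mono (n : ℤ) (c l : ℂ) : (mono n c : W ρ).eval l = c * l ^ n := by
  rw [eval, tsum_eq_single n fun k hk => by rw [coeff_mono, if_neg hk, zero_mul], coeff_mono,
    if_pos rfl]

theorem eval_zero (l : ℂ) : (0 : W ρ).eval l = 0 := by
  simp only [eval, coeff_zero, zero_mul, tsum_zero]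

theorem eq_zero_of_eval_eq_zero {f : W ρ} (h : ∀ l : ℂ, ‖l‖ = 1 → f.eval l = 0) : f = 0 :=
  ext_coeff <| congrFun <| eq_zero_of_tsum_fourier_eq_zero (T := 1) f.summable_norm_coeff
    fun x => by
      simpa only [eval, fourier_apply, AddCircle.toCircle_zsmul, Circle.coe_zpow] using
        h _ (Circle.norm_coe x.toCircle)

theorem ext_eval {f g : W ρ} (h : ∀ l : ℂ, ‖l‖ = 1 → f.eval l = g.eval l) : f = g :=
  sub_eq_zero.1 <| eq_zero_of_eval_eq_zero fun l hl => by
    rw [eval_sub f g hl, h l hl, sub_self]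

/-- The evaluation of loops at a point of the unit circle. -/
def evalL (l : ℂ) (hl : ‖l‖ = 1) : W ρ →L[ℂ] ℂ :=
  LinearMap.mkContinuous ⟨⟨fun f => f.eval l, fun f g => eval_add f g hl⟩,
    fun c f => eval_smul c f l⟩ 1 fun f => (f.norm_eval_le hl).trans_eq (one_mul _).symm

/-- The `k`-th Fourier coefficient as a continuous linear functional. -/
def coeffL (k : ℤ) : W ρ →L[ℂ] ℂ :=
  LinearMap.mkContinuous ⟨⟨fun f => f.coeff k, fun f g => coeff_add f g k⟩,
    fun c f => coeff_smul c f k⟩ 1 fun f => (f.norm_coeff_le k).trans_eq (one_mul _).symm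

theorem coeffL_apply (k : ℤ) (f : W ρ) : coeffL k f = f.coeff k := rfl

/-! ### The convolution product -/

theorem summable_mul_terms (f g : W ρ) : Summable fun p : ℤ × ℤ =>
    (‖f.coeff p.2‖ * ρ ^ p.2.natAbs) * (‖g.coeff (p.1 - p.2)‖ * ρ ^ (p.1 - p.2).natAbs) :=
  (convolutionEquiv ℤ).summable_iff.2
    (f.summable.mul_of_nonneg g.summable f.term_nonneg g.term_nonneg)

theorem norm_mul_term_le (f g : W ρ) (n k : ℤ) :
    ‖f.coeff k * g.coeff (n - k)‖ * ρ ^ n.natAbs ≤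
      (‖f.coeff k‖ * ρ ^ k.natAbs) * (‖g.coeff (n - k)‖ * ρ ^ (n - k).natAbs) := by
  rw [norm_mul, mul_mul_mul_comm]
  gcongr
  exact weight_le_mul n k

theorem summable_norm_mul_coeff (f g : W ρ) (n : ℤ) :
    Summable fun k => ‖f.coeff k * g.coeff (n - k)‖ :=
  ((summable_mul_terms f g).prod_factor n).of_nonneg_of_le (fun _ => norm_nonneg _) fun k =>
    (le_mul_of_one_le_right (norm_nonneg _) (one_le_weight n)).trans (norm_mul_term_le f g n k)

theorem norm_tsum_mul_coeff_le (f g : W ρ) (n : ℤ) :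
    ‖∑' k, f.coeff k * g.coeff (n - k)‖ * ρ ^ n.natAbs ≤
      ∑' k, (‖f.coeff k‖ * ρ ^ k.natAbs) * (‖g.coeff (n - k)‖ * ρ ^ (n - k).natAbs) := by
  calc _ ≤ (∑' k, ‖f.coeff k * g.coeff (n - k)‖) * ρ ^ n.natAbs :=
        mul_le_mul_of_nonneg_right (norm_tsum_le_tsum_norm (summable_norm_mul_coeff f g n))
          (weight_pos n).le
    _ = ∑' k, ‖f.coeff k * g.coeff (n - k)‖ * ρ ^ n.natAbs := tsum_mul_right.symm
    _ ≤ _ := ((summable_norm_mul_coeff f g n).mul_right _).tsum_le_tsum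
        (norm_mul_term_le f g n) ((summable_mul_terms f g).prod_factor n)

theorem summable_convolution (f g : W ρ) :
    Summable fun n : ℤ => ‖∑' k, f.coeff k * g.coeff (n - k)‖ * ρ ^ n.natAbs :=
  (summable_mul_terms f g).prod.of_nonneg_of_le
    (fun n => mul_nonneg (norm_nonneg _) (weight_pos n).le) (norm_tsum_mul_coeff_le f g)

instance : Mul (W ρ) := ⟨fun f g => ofCoeff _ (summable_convolution f g)⟩

theorem coeff_mul (f g : W ρ) (n : ℤ) :
    (f * g).coeff n = ∑' k, f.coeff k * g.coeff (n - k) := rfl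

theorem norm_mul_le (f g : W ρ) : ‖f * g‖ ≤ ‖f‖ * ‖g‖ := by
  calc ‖f * g‖ ≤ ∑' n : ℤ, ∑' k, (‖f.coeff k‖ * ρ ^ k.natAbs) *
        (‖g.coeff (n - k)‖ * ρ ^ (n - k).natAbs) :=
        (summable_convolution f g).tsum_le_tsum (norm_tsum_mul_coeff_le f g)
          (summable_mul_terms f g).prod
    _ = ∑' p : ℤ × ℤ, (‖f.coeff p.2‖ * ρ ^ p.2.natAbs) *
        (‖g.coeff (p.1 - p.2)‖ * ρ ^ (p.1 - p.2).natAbs) :=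
        (summable_mul_terms f g).tsum_prod.symm
    _ = ∑' p : ℤ × ℤ, (‖f.coeff p.1‖ * ρ ^ p.1.natAbs) * (‖g.coeff p.2‖ * ρ ^ p.2.natAbs) :=
        (convolutionEquiv ℤ).tsum_eq fun p =>
          (‖f.coeff p.1‖ * ρ ^ p.1.natAbs) * (‖g.coeff p.2‖ * ρ ^ p.2.natAbs)
    _ = ‖f‖ * ‖g‖ := (f.summable.tsum_mul_tsum g.summable
        (f.summable.mul_of_nonneg g.summable f.term_nonneg g.term_nonneg)).symm

theorem eval_mul (f g : W ρ) {l : ℂ} (hl : ‖l‖ = 1) : (f * g).eval l = f.eval l * g.eval l := by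
  have hl0 : l ≠ 0 := norm_ne_zero_iff.1 (hl ▸ one_ne_zero)
  have hfg := summable_mul_of_summable_norm (f.summable_norm_eval hl) (g.summable_norm_eval hl)
  symm
  calc f.eval l * g.eval l
      = ∑' p : ℤ × ℤ, (f.coeff p.1 * l ^ p.1) * (g.coeff p.2 * l ^ p.2) :=
        tsum_mul_tsum_of_summable_norm (f.summable_norm_eval hl) (g.summable_norm_eval hl)
    _ = ∑' p : ℤ × ℤ, (f.coeff p.2 * l ^ p.2) * (g.coeff (p.1 - p.2) * l ^ (p.1 - p.2)) :=
        ((convolutionEquiv ℤ).tsum_eq fun p =>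
          (f.coeff p.1 * l ^ p.1) * (g.coeff p.2 * l ^ p.2)).symm
    _ = ∑' n : ℤ, ∑' k : ℤ, (f.coeff k * l ^ k) * (g.coeff (n - k) * l ^ (n - k)) :=
        ((convolutionEquiv ℤ).summable_iff.2 hfg).tsum_prod
    _ = (f * g).eval l := tsum_congr fun n => by
        rw [coeff_mul, ← tsum_mul_right]
        refine tsum_congr fun k => ?_
        rw [mul_mul_mul_comm, ← zpow_add₀ hl0, add_sub_cancel]

instance : One (W ρ) := ⟨mono 0 1⟩

theorem one_def : (1 : W ρ) = mono 0 1 := rfl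

theorem eval_one (l : ℂ) : (1 : W ρ).eval l = 1 := by
  rw [one_def, eval_mono, zpow_zero, mul_one]

scoped instance : NormedCommRing (W ρ) where
  __ := (inferInstance : NormedAddCommGroup (W ρ))
  mul_assoc f g h := ext_eval fun l hl => by simp only [eval_mul, hl, mul_assoc]
  one_mul f := ext_eval fun l hl => by rw [eval_mul _ _ hl, eval_one, one_mul]
  mul_one f := ext_eval fun l hl => by rw [eval_mul _ _ hl, eval_one, mul_one]
  left_distrib f g h := ext_eval fun l hl => by simp only [eval_mul, eval_add, hl, mul_add]
  right_distrib f g h := ext_eval fun l hl => by simp only [eval_mul, eval_add, hl, add_mul]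
  zero_mul f := ext_eval fun l hl => by rw [eval_mul _ _ hl, eval_zero, zero_mul]
  mul_zero f := ext_eval fun l hl => by rw [eval_mul _ _ hl, eval_zero, mul_zero]
  mul_comm f g := ext_eval fun l hl => by rw [eval_mul _ _ hl, eval_mul _ _ hl, mul_comm]
  norm_mul_le := norm_mul_le

scoped instance : Algebra ℂ (W ρ) := Algebra.ofModule
  (fun c f g => ext_eval fun l hl => by simp only [eval_mul, eval_smul, hl, mul_assoc])
  (fun c f g => ext_eval fun l hl => by simp only [eval_mul, eval_smul, hl, mul_left_comm])

scoped instance : NormedAlgebra ℂ (W ρ) where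
  norm_smul_le := norm_smul_le

theorem coeff_mono_mul (n : ℤ) (c : ℂ) (f : W ρ) (k : ℤ) :
    (mono n c * f).coeff k = c * f.coeff (k - n) := by
  rw [coeff_mul, tsum_eq_single n fun j hj => by rw [coeff_mono, if_neg hj, zero_mul],
    coeff_mono, if_pos rfl]

theorem mono_mul_mono (m n : ℤ) (c d : ℂ) :
    (mono m c * mono n d : W ρ) = mono (m + n) (c * d) := by
  refine ext_coeff fun k => ?_
  rw [coeff_mono_mul, coeff_mono, coeff_mono, mul_ite, mul_zero]
  exact if_congr sub_eq_iff_eq_add' rfl rfl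

end W

open scoped W

/-! ### Loops with real coefficients -/

variable (ρ) in
/-- The closed subalgebra of the loops with real Fourier coefficients. Over the unit circle these
are the loops with `conj (h λ) = h λ⁻¹`. -/
def realLoops : Subalgebra ℝ (W ρ) where
  carrier := {h | ∀ k, starRingEnd ℂ (h.coeff k) = h.coeff k}
  mul_mem' {f g} hf hg k := by
    rw [W.coeff_mul, Complex.conj_tsum]
    exact tsum_congr fun j => by rw [map_mul, hf j, hg]
  add_mem' {f g} hf hg k := by rw [W.coeff_add, map_add, hf, hg]
  algebraMap_mem' r k := by
    rw [Algebra.algebraMap_eq_smul_one, W.coeff_real_smul, W.one_def, W.coeff_mono]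
    split_ifs <;> simp

theorem mem_realLoops {h : W ρ} :
    h ∈ realLoops ρ ↔ ∀ k, starRingEnd ℂ (h.coeff k) = h.coeff k := Iff.rfl

theorem mono_mem_realLoops (n : ℤ) (c : ℝ) : (W.mono n c : W ρ) ∈ realLoops ρ := fun k => by
  rw [W.coeff_mono, apply_ite (starRingEnd ℂ), Complex.conj_ofReal, map_zero]

theorem isClosed_realLoops : IsClosed (realLoops ρ : Set (W ρ)) := by
  have h : (realLoops ρ : Set (W ρ)) =
      ⋂ k : ℤ, {h | starRingEnd ℂ (W.coeffL k h) = W.coeffL k h} := by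
    ext h
    simp [mem_realLoops, W.coeffL_apply]
  rw [h]
  exact isClosed_iInter fun k => isClosed_eq
    (Complex.continuous_conj.comp (W.coeffL k).continuous) (W.coeffL k).continuous

instance : CompleteSpace (realLoops ρ) := isClosed_realLoops.completeSpace_coe

theorem WRplus_le_realLoops : WRplus ρ ≤ (realLoops ρ).toSubmodule := fun _ h => h.2

theorem isClosed_WRplus : IsClosed (WRplus ρ : Set (W ρ)) := by
  have h : (WRplus ρ : Set (W ρ)) =
      (⋂ k : Set.Iio (0 : ℤ), W.coeffL (ρ := ρ) k ⁻¹' {0}) ∩ realLoops ρ := by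
    ext h
    simp [WRplus, mem_realLoops, W.coeffL_apply]
  rw [h]
  refine IsClosed.inter (isClosed_iInter fun k => ?_) isClosed_realLoops
  exact (isClosed_singleton (x := (0 : ℂ))).preimage (W.coeffL (ρ := ρ) k).continuous

instance : CompleteSpace (WRplus ρ) := isClosed_WRplus.completeSpace_coe

instance : CompleteSpace (Param ρ) :=
  inferInstanceAs (CompleteSpace (WRplus ρ × WRplus ρ × WRplus ρ × ℝ × ℝ))

/-- The evaluation of loops with real coefficients at a point of the unit circle. -/
def realEval (l : ℂ) (hl : ‖l‖ = 1) : realLoops ρ →A[ℝ] ℂ where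
  toFun f := (f : W ρ).eval l
  map_one' := W.eval_one l
  map_mul' f g := W.eval_mul (f : W ρ) g hl
  map_zero' := W.eval_zero l
  map_add' f g := W.eval_add (f : W ρ) g hl
  commutes' r := by
    rw [Algebra.algebraMap_eq_smul_one, Algebra.algebraMap_eq_smul_one, Complex.real_smul]
    exact (W.eval_smul (r : ℂ) 1 l).trans (congrArg _ (W.eval_one l))
  cont := (W.evalL l hl).continuous.comp continuous_subtype_val

theorem realEval_apply (l : ℂ) (hl : ‖l‖ = 1) (f : realLoops ρ) :
    realEval l hl f = (f : W ρ).eval l := rfl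

/-- The monomial loop `c λ^n` with a real coefficient. -/
def realMono (n : ℤ) (c : ℝ) : realLoops ρ := ⟨W.mono n c, mono_mem_realLoops n c⟩

/-- The inclusion of `𝒲_{ℝ,ρ}^{≥0}` in the algebra of loops with real coefficients. -/
def plusIncl : WRplus ρ →L[ℝ] realLoops ρ :=
  (WRplus ρ).subtypeL.codRestrict (realLoops ρ).toSubmodule fun h => WRplus_le_realLoops h.2

theorem coe_plusIncl (h : WRplus ρ) : (plusIncl h : W ρ) = h := rfl

end WienerAlgebra

section LinearODE

section Picard

variable {X : Type*} [NormedRing X] [NormedAlgebra ℝ X]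

/-- The Picard operator `T_E : Y ↦ V (Y E)`, as a linear function of `E`. -/
def picardOp (V : X →L[ℝ] X) : X →L[ℝ] (X →L[ℝ] X) :=
  (ContinuousLinearMap.compL ℝ X X X V).comp (ContinuousLinearMap.mul ℝ X).flip

theorem picardOp_apply (V : X →L[ℝ] X) (E Y : X) : picardOp V E Y = V (Y * E) := rfl

/-- The solution of `Y = 1 + t V (Y E)`; a dummy value unless `1 - t T_E` is invertible. -/
def frame (V : X →L[ℝ] X) (t : ℝ) (E : X) : X := Ring.inverse (1 - t • picardOp V E) 1

theorem frame_zero (V : X →L[ℝ] X) (E : X) : frame V 0 E = 1 := by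
  rw [frame, zero_smul ℝ (picardOp V E), sub_zero, Ring.inverse_one, one_apply_eq_self]

theorem frame_eq {V : X →L[ℝ] X} {t : ℝ} {E : X} (h : IsUnit (1 - t • picardOp V E)) :
    frame V t E = 1 + t • V (frame V t E * E) := by
  have hinv : (1 - t • picardOp V E) (frame V t E) = 1 :=
    congrArg (fun L => L (1 : X)) (Ring.mul_inverse_cancel _ h)
  rwa [sub_apply, one_apply_eq_self, smul_apply, picardOp_apply, sub_eq_iff_eq_add] at hinv

theorem frame_eq_second_order {V : X →L[ℝ] X} {t : ℝ} {E : X}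
    (h : IsUnit (1 - t • picardOp V E)) :
    frame V t E = 1 + t • (V E + t • V (V (frame V t E * E) * E)) := by
  conv_lhs => rw [frame_eq h, frame_eq h, add_mul, one_mul, map_add, smul_mul_assoc, map_smul]

variable [CompleteSpace X]

theorem eventually_isUnit_one_sub_smul_picardOp (V : X →L[ℝ] X) (E : X) :
    ∀ᶠ p : ℝ × X in 𝓝 (0, E), IsUnit (1 - p.1 • picardOp V p.2) := by
  have hcont : Continuous fun p : ℝ × X => 1 - p.1 • picardOp V p.2 := by fun_prop
  refine (Units.isOpen.preimage hcont).mem_nhds ?_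
  rw [Set.mem_preimage, zero_smul ℝ (picardOp V E), sub_zero]
  exact isUnit_one

theorem contDiffAt_frame (V : X →L[ℝ] X) (E : X) :
    ContDiffAt ℝ 1 (fun p : ℝ × X => frame V p.1 p.2) (0, E) := by
  have hsub : ContDiffAt ℝ 1 (fun p : ℝ × X => 1 - p.1 • picardOp V p.2) (0, E) :=
    contDiffAt_const.sub
      (contDiffAt_fst.smul ((picardOp V).contDiff.contDiffAt.comp _ contDiffAt_snd))
  have hinv : ContDiffAt ℝ 1 (fun p : ℝ × X => Ring.inverse (1 - p.1 • picardOp V p.2))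
      (0, E) := by
    refine ContDiffAt.comp (g := Ring.inverse) (0, E) ?_ hsub
    rw [zero_smul ℝ (picardOp V E), sub_zero]
    exact contDiffAt_ringInverse ℝ 1
  exact hinv.clm_apply contDiffAt_const

theorem contDiffAt_frame_second_order (V : X →L[ℝ] X) (E : X) :
    ContDiffAt ℝ 1 (fun p : ℝ × X => V (V (frame V p.1 p.2 * p.2) * p.2)) (0, E) := by
  have hV := V.contDiff (n := 1)
  exact hV.contDiffAt.comp _ ((hV.contDiffAt.comp _
    ((contDiffAt_frame V E).mul contDiffAt_snd)).mul contDiffAt_snd)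

end Picard

open unitInterval

section Volterra

variable {F : Type*} [NormedAddCommGroup F] [NormedSpace ℝ F]

variable (F) in
/-- The Volterra operator `f ↦ (s ↦ ∫₀ˢ f)` on `C([0, 1], F)`. -/
def volterra : C(I, F) →L[ℝ] C(I, F) :=
  LinearMap.mkContinuous
    { toFun := fun f => ⟨fun s => ∫ u in (0 : ℝ)..s, Set.IccExtend (zero_le_one' ℝ) f u,
        (intervalIntegral.continuous_primitive
          (fun a b => f.continuous.Icc_extend'.intervalIntegrable a b) 0).comp
          continuous_subtype_val⟩
      map_add' := fun f g => by
        ext s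
        exact intervalIntegral.integral_add (f.continuous.Icc_extend'.intervalIntegrable _ _)
          (g.continuous.Icc_extend'.intervalIntegrable _ _)
      map_smul' := fun c f => by
        ext s
        exact intervalIntegral.integral_smul c _ }
    1 fun f => by
      refine (ContinuousMap.norm_le _ (by positivity)).2 fun s => ?_
      refine (intervalIntegral.norm_integral_le_of_norm_le_const
        fun u _ => f.norm_coe_le_norm (Set.projIcc 0 1 zero_le_one u)).trans ?_
      rw [sub_zero, abs_of_nonneg s.2.1, one_mul]
      exact mul_le_of_le_one_right (norm_nonneg _) s.2.2

theorem volterra_apply (f : C(I, F)) (s : I) :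
    volterra F f s = ∫ u in (0 : ℝ)..s, Set.IccExtend (zero_le_one' ℝ) f u := rfl

theorem volterra_eq_integral {f : ℝ → F} {g : C(I, F)} (h : ∀ u : I, g u = f u) (s : I) :
    volterra F g s = ∫ u in (0 : ℝ)..s, f u := by
  refine intervalIntegral.integral_congr fun u hu => ?_
  rw [Set.uIcc_of_le s.2.1] at hu
  rw [Set.IccExtend_of_mem _ _ ⟨hu.1, hu.2.trans s.2.2⟩, h]

theorem volterra_apply_zero (f : C(I, F)) : volterra F f 0 = 0 :=
  intervalIntegral.integral_same

theorem map_volterra [CompleteSpace F] {G : Type*} [NormedAddCommGroup G] [NormedSpace ℝ G]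
    [CompleteSpace G] (L : F →L[ℝ] G) (f : C(I, F)) (s : I) :
    L (volterra F f s) = volterra G ((L : C(F, G)).comp f) s :=
  (L.intervalIntegral_comp_comm (f.continuous.Icc_extend'.intervalIntegrable _ _)).symm

theorem hasDerivWithinAt_volterra [CompleteSpace F] (f : C(I, F)) (s : I) :
    HasDerivWithinAt (Set.IccExtend (zero_le_one' ℝ) ⇑(volterra F f)) (f s) (Set.Icc 0 1) s := by
  have hcont : Continuous (Set.IccExtend (zero_le_one' ℝ) f) := f.continuous.Icc_extend'
  have hderiv := (hcont.integral_hasStrictDerivAt 0 (s : ℝ)).hasDerivAt.hasDerivWithinAt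
    (s := Set.Icc 0 1)
  rw [Set.IccExtend_val] at hderiv
  refine hderiv.congr_of_mem (fun u hu => ?_) s.2
  rw [Set.IccExtend_of_mem _ _ hu, volterra_apply]

theorem volterra_mul_by_parts {A : Type*} [NormedRing A] [NormedAlgebra ℝ A] [CompleteSpace A]
    (f g : C(I, A)) :
    volterra A (f * volterra A g) 1 = volterra A f 1 * volterra A g 1 -
      volterra A (volterra A f * g) 1 := by
  have hcont (k : C(I, A)) : Continuous (Set.IccExtend (zero_le_one' ℝ) k) :=
    k.continuous.Icc_extend'
  have hderiv (k : C(I, A)) : ∀ s ∈ Set.Ioo (min 0 1) (max (0 : ℝ) 1),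
      HasDerivAt (Set.IccExtend (zero_le_one' ℝ) ⇑(volterra A k))
        (Set.IccExtend (zero_le_one' ℝ) k s) s := by
    rw [min_eq_left zero_le_one, max_eq_right zero_le_one]
    intro s hs
    rw [Set.IccExtend_of_mem _ _ (Set.Ioo_subset_Icc_self hs)]
    exact (hasDerivWithinAt_volterra k ⟨s, Set.Ioo_subset_Icc_self hs⟩).hasDerivAt
      (Icc_mem_nhds hs.1 hs.2)
  have hparts : volterra A (volterra A f * g) 1 =
      volterra A f 1 * volterra A g 1 - volterra A f 0 * volterra A g 0 -
        volterra A (f * volterra A g) 1 := by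
    have h := intervalIntegral.integral_mul_deriv_eq_deriv_mul_of_hasDerivAt
      (hcont (volterra A f)).continuousOn (hcont (volterra A g)).continuousOn (hderiv f)
      (hderiv g) ((hcont f).intervalIntegrable 0 1) ((hcont g).intervalIntegrable 0 1)
    rwa [Set.IccExtend_right, Set.IccExtend_right, Set.IccExtend_left, Set.IccExtend_left] at h
  rw [hparts, volterra_apply_zero, zero_mul, sub_zero, sub_sub_cancel]

end Volterra

variable {B : Type*} [NormedRing B] [NormedAlgebra ℝ B]

/-- The linear equation `Y' = t Y E` can be solved by inverting `1 - t T_E`. -/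
def IsRegular (t : ℝ) (E : C(I, B)) : Prop := IsUnit (1 - t • picardOp (volterra B) E)

/-- The solution of `Y' = t Y E`, `Y(0) = 1`. -/
def solution (t : ℝ) (E : C(I, B)) : C(I, B) := frame (volterra B) t E

theorem eventually_isRegular [CompleteSpace B] (E : C(I, B)) :
    ∀ᶠ p : ℝ × C(I, B) in 𝓝 (0, E), IsRegular p.1 p.2 :=
  eventually_isUnit_one_sub_smul_picardOp (volterra B) E

theorem solution_eq {t : ℝ} {E : C(I, B)} (h : IsRegular t E) (s : I) :
    solution t E s = 1 + t • volterra B (solution t E * E) s :=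
  congrArg (fun Y : C(I, B) => Y s) (frame_eq h)

theorem solution_apply_zero {t : ℝ} {E : C(I, B)} (h : IsRegular t E) :
    solution t E 0 = 1 := by
  rw [solution_eq h, volterra_apply_zero, smul_zero, add_zero]

theorem hasDerivWithinAt_solution [CompleteSpace B] {t : ℝ} {E : C(I, B)}
    (h : IsRegular t E) (s : I) :
    HasDerivWithinAt (Set.IccExtend (zero_le_one' ℝ) ⇑(solution t E))
      (t • (solution t E s * E s)) (Set.Icc 0 1) s := by
  refine (((hasDerivWithinAt_volterra (solution t E * E) s).const_smul t).const_add
    1).congr_of_mem (fun u hu => ?_) s.2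
  rw [Set.IccExtend_of_mem _ _ hu, solution_eq h, Pi.smul_apply, Set.IccExtend_of_mem _ _ hu]

/-- The remainder `R` in `Φ(1) = 1 + t (∫₀¹ E + t R)`. -/
def frameRem (t : ℝ) (E : C(I, B)) : B :=
  volterra B (volterra B (solution t E * E) * E) 1

theorem solution_apply_one {t : ℝ} {E : C(I, B)} (h : IsRegular t E) :
    solution t E 1 = 1 + t • (volterra B E 1 + t • frameRem t E) :=
  congrArg (fun Y : C(I, B) => Y 1) (frame_eq_second_order h)

theorem frameRem_zero (E : C(I, B)) : frameRem 0 E = volterra B (volterra B E * E) 1 := by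
  rw [frameRem, solution, frame_zero, one_mul]

theorem contDiffAt_frameRem [CompleteSpace B] (E : C(I, B)) :
    ContDiffAt ℝ 1 (fun p : ℝ × C(I, B) => frameRem p.1 p.2) (0, E) :=
  (ContinuousMap.evalCLM ℝ (1 : I) : C(I, B) →L[ℝ] B).contDiff.contDiffAt.comp (0, E)
    (contDiffAt_frame_second_order (volterra B) E)

end LinearODE

section LoopPotential

open unitInterval

/-- The `2 × 2` matrices over `R`, as a Banach algebra for the operator norm belonging to the sup
norm. (A separate type, because `Matrix` carries the product topology.) -/
def Mat2 (R : Type*) : Type _ := Matrix (Fin 2) (Fin 2) R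

variable {R : Type*} [NormedCommRing R] [NormedAlgebra ℝ R]

namespace Mat2

instance : NormedRing (Mat2 R) :=
  fast_instance% Matrix.linftyOpNormedRing (n := Fin 2) (α := R)

instance : NormedAlgebra ℝ (Mat2 R) := Matrix.linftyOpNormedAlgebra (n := Fin 2) (α := R)

instance [CompleteSpace R] : CompleteSpace (Mat2 R) :=
  inferInstanceAs (CompleteSpace (Fin 2 → Fin 2 → R))

/-- The entries of a matrix, as continuous linear functions. -/
def entry (i j : Fin 2) : Mat2 R →L[ℝ] R :=
  ⟨Matrix.entryLinearMap ℝ R i j, (continuous_id (X := Matrix (Fin 2) (Fin 2) R)).matrix_elem i j⟩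

theorem ext {M N : Mat2 R} (h : ∀ i j, M.entry i j = N.entry i j) : M = N := Matrix.ext h

theorem entry_mul (M N : Mat2 R) (i j : Fin 2) :
    (M * N).entry i j = M.entry i 0 * N.entry 0 j + M.entry i 1 * N.entry 1 j :=
  (Matrix.mul_apply (M := M) (N := N)).trans (Fin.sum_univ_two _)

theorem entry_one (i j : Fin 2) : (1 : Mat2 R).entry i j = if i = j then 1 else 0 :=
  Matrix.one_apply

/-- The matrix with given entries. -/
def of (a b c d : R) : Mat2 R := (!![a, b; c, d] : Matrix (Fin 2) (Fin 2) R)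

theorem entry_of (a b c d : R) :
    (of a b c d).entry 0 0 = a ∧ (of a b c d).entry 0 1 = b ∧
      (of a b c d).entry 1 0 = c ∧ (of a b c d).entry 1 1 = d := ⟨rfl, rfl, rfl, rfl⟩

theorem of_add_of (a b c d a' b' c' d' : R) :
    of a b c d + of a' b' c' d' = of (a + a') (b + b') (c + c') (d + d') :=
  Mat2.ext fun i j => by fin_cases i <;> fin_cases j <;> rfl

theorem smul_of (r : ℝ) (a b c d : R) : r • of a b c d = of (r • a) (r • b) (r • c) (r • d) :=
  Mat2.ext fun i j => by fin_cases i <;> fin_cases j <;> rfl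

theorem of_mul_of (a b c d a' b' c' d' : R) :
    of a b c d * of a' b' c' d' =
      of (a * a' + b * c') (a * b' + b * d') (c * a' + d * c') (c * b' + d * d') :=
  Mat2.ext fun i j => by rw [entry_mul]; fin_cases i <;> fin_cases j <;> rfl

theorem one_eq_of : (1 : Mat2 R) = of 1 0 0 1 :=
  Mat2.ext fun i j => by rw [entry_one]; fin_cases i <;> fin_cases j <;> rfl

theorem continuous_of_entry {X : Type*} [TopologicalSpace X] {f : X → Mat2 R}
    (h : ∀ i j, Continuous fun x => (f x).entry i j) : Continuous f :=
  continuous_matrix h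

/-- The functional `M ↦ M₂₁ - M₁₂`. -/
def skewPart : Mat2 R →L[ℝ] R := entry (R := R) 1 0 - entry (R := R) 0 1

theorem skewPart_apply (M : Mat2 R) : skewPart M = M.entry 1 0 - M.entry 0 1 := rfl

/-- The quadratic form `Y ↦ Y₁₁ Y₂₁ - Y₁₂ Y₂₂` defining `𝔭`. -/
def rowForm (Y : Mat2 R) : R := Y.entry 0 0 * Y.entry 1 0 - Y.entry 0 1 * Y.entry 1 1

theorem rowForm_one_add_smul (t : ℝ) (N : Mat2 R) :
    rowForm (1 + t • N) = t • (skewPart N + t • rowForm N) := by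
  simp only [rowForm, skewPart_apply, map_add, map_smul, entry_one, if_pos, if_neg zero_ne_one,
    if_neg one_ne_zero]
  simp only [Algebra.smul_def]
  ring

theorem contDiff_rowForm : ContDiff ℝ 1 (rowForm (R := R)) :=
  (((entry (R := R) 0 0).contDiff.mul (entry (R := R) 1 0).contDiff).sub
    ((entry (R := R) 0 1).contDiff.mul (entry (R := R) 1 1).contDiff) :)

end Mat2

open Mat2

/-- The matrix of the potential with real coefficients `κ = (α, β, γ)` and loops
`p = (a, b, c)`. -/
def potentialMatrix (κ : ℝ × ℝ × ℝ) (p : R × R × R) : Mat2 R :=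
  of (κ.1 • p.1) (κ.2.1 • p.2.1 + κ.2.2 • p.2.2) (κ.2.1 • p.2.1 - κ.2.2 • p.2.2) (-(κ.1 • p.1))

theorem continuous_potentialMatrix :
    Continuous fun x : (ℝ × ℝ × ℝ) × R × R × R => potentialMatrix x.1 x.2 := by
  refine continuous_of_entry fun i j => ?_
  fin_cases i <;> fin_cases j <;>
    simp only [Fin.zero_eta, Fin.mk_one, potentialMatrix, entry_of] <;> fun_prop

theorem potentialMatrix_add_left (κ κ' : ℝ × ℝ × ℝ) (p : R × R × R) :
    potentialMatrix (κ + κ') p = potentialMatrix κ p + potentialMatrix κ' p := by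
  simp only [potentialMatrix, of_add_of, Prod.fst_add, Prod.snd_add]
  congr 1 <;> module

theorem potentialMatrix_smul_left (c : ℝ) (κ : ℝ × ℝ × ℝ) (p : R × R × R) :
    potentialMatrix (c • κ) p = c • potentialMatrix κ p := by
  simp only [potentialMatrix, smul_of, Prod.smul_fst, Prod.smul_snd]
  congr 1 <;> module

theorem potentialMatrix_add_right (κ : ℝ × ℝ × ℝ) (p q : R × R × R) :
    potentialMatrix κ (p + q) = potentialMatrix κ p + potentialMatrix κ q := by
  simp only [potentialMatrix, of_add_of, Prod.fst_add, Prod.snd_add]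
  congr 1 <;> module

theorem potentialMatrix_smul_right (c : ℝ) (κ : ℝ × ℝ × ℝ) (p : R × R × R) :
    potentialMatrix κ (c • p) = c • potentialMatrix κ p := by
  simp only [potentialMatrix, smul_of, Prod.smul_fst, Prod.smul_snd]
  congr 1 <;> module

theorem skewPart_potentialMatrix (κ : ℝ × ℝ × ℝ) (p : R × R × R) :
    skewPart (potentialMatrix κ p) = (-2 * κ.2.2) • p.2.2 := by
  simp only [skewPart_apply, potentialMatrix, entry_of]
  module

theorem rowForm_potentialMatrix (κ : ℝ × ℝ × ℝ) (p : R × R × R) :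
    rowForm (potentialMatrix κ p) = (2 * (κ.1 * κ.2.1)) • (p.1 * p.2.1) := by
  simp only [rowForm, potentialMatrix, entry_of, Algebra.smul_def, map_mul, map_ofNat]
  ring

theorem skewPart_potentialMatrix_mul (κ κ' : ℝ × ℝ × ℝ) (p : R × R × R) :
    skewPart (potentialMatrix κ p * potentialMatrix κ' p) =
      (2 * (κ.2.1 * κ'.1 - κ.1 * κ'.2.1)) • (p.1 * p.2.1) := by
  simp only [skewPart_apply, potentialMatrix, of_mul_of, entry_of, Algebra.smul_def, map_mul,
    map_sub, map_ofNat]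
  ring

/-- The matrix of the potential as a linear function of its real coefficients. -/
def potentialMatrixL (p : R × R × R) : (ℝ × ℝ × ℝ) →L[ℝ] Mat2 R where
  toFun κ := potentialMatrix κ p
  map_add' κ κ' := potentialMatrix_add_left κ κ' p
  map_smul' c κ := potentialMatrix_smul_left c κ p
  cont := continuous_potentialMatrix.comp (continuous_id.prodMk continuous_const)

/-- The potential along the segment `[0, 1]` with coefficient functions `κ = (α, β, γ)`, as a
linear function of the loops `(a, b, c)`. -/
def segmentPotential (κ : C(I, ℝ × ℝ × ℝ)) : R × R × R →L[ℝ] C(I, Mat2 R) where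
  toFun p := (potentialMatrixL p : C(ℝ × ℝ × ℝ, Mat2 R)).comp κ
  map_add' p q := ContinuousMap.ext fun s => potentialMatrix_add_right (κ s) p q
  map_smul' c p := ContinuousMap.ext fun s => potentialMatrix_smul_right c (κ s) p
  cont := ContinuousMap.continuous_of_continuous_uncurry _ <|
    continuous_potentialMatrix.comp ((κ.continuous.comp continuous_snd).prodMk continuous_fst)

theorem segmentPotential_apply (κ : C(I, ℝ × ℝ × ℝ)) (p : R × R × R) (s : I) :
    segmentPotential κ p s = potentialMatrix (κ s) p := rfl

/-- The coefficient functions `(α, β, γ)` of a potential, as one curve. -/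
def coeffCurve (α β γ : C(I, ℝ)) : C(I, ℝ × ℝ × ℝ) := α.prodMk (β.prodMk γ)

theorem coeffCurve_apply (α β γ : C(I, ℝ)) (s : I) : coeffCurve α β γ s = (α s, β s, γ s) := rfl

theorem volterra_coeffCurve (α β γ : C(I, ℝ)) :
    volterra _ (coeffCurve α β γ) = coeffCurve (volterra _ α) (volterra _ β) (volterra _ γ) := by
  ext s
  · exact map_volterra (.fst ℝ ℝ (ℝ × ℝ)) _ s
  · exact map_volterra ((ContinuousLinearMap.fst ℝ ℝ ℝ).comp (.snd ℝ ℝ (ℝ × ℝ))) _ s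
  · exact map_volterra ((ContinuousLinearMap.snd ℝ ℝ ℝ).comp (.snd ℝ ℝ (ℝ × ℝ))) _ s

variable [CompleteSpace R]

theorem volterra_segmentPotential (κ : C(I, ℝ × ℝ × ℝ)) (p : R × R × R) (s : I) :
    volterra _ (segmentPotential κ p) s = potentialMatrix (volterra _ κ s) p :=
  (map_volterra (potentialMatrixL p) κ s).symm

/-- The quotient `(Φ(1) - 1) / t`, in the form which makes sense for `t = 0` as well. -/
def frameQuot (κ : C(I, ℝ × ℝ × ℝ)) (t : ℝ) (p : R × R × R) : Mat2 R :=
  volterra _ (segmentPotential κ p) 1 + t • frameRem t (segmentPotential κ p)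

/-- The remainder in the first order expansion of the loop `𝔭̂`. -/
def hatRem (κ : C(I, ℝ × ℝ × ℝ)) (t : ℝ) (p : R × R × R) : R :=
  skewPart (frameRem t (segmentPotential κ p)) + rowForm (frameQuot κ t p)

theorem rowForm_solution {κ : C(I, ℝ × ℝ × ℝ)} {t : ℝ} {p : R × R × R}
    (h : IsRegular t (segmentPotential κ p)) :
    rowForm (solution t (segmentPotential κ p) 1) =
      t • ((-2 * (volterra _ κ 1).2.2) • p.2.2 + t • hatRem κ t p) := by
  rw [solution_apply_one h, rowForm_one_add_smul, map_add, map_smul, volterra_segmentPotential,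
    skewPart_potentialMatrix, hatRem, frameQuot, volterra_segmentPotential,
    smul_add t (skewPart _), add_assoc]

theorem contDiffAt_frameRem_segmentPotential (κ : C(I, ℝ × ℝ × ℝ)) (p : R × R × R) :
    ContDiffAt ℝ 1 (fun q : ℝ × R × R × R => frameRem q.1 (segmentPotential κ q.2)) (0, p) := by
  have hE : ContDiff ℝ 1 fun q : ℝ × R × R × R => (q.1, segmentPotential κ q.2) := by fun_prop
  exact (contDiffAt_frameRem (segmentPotential κ p)).comp (0, p) hE.contDiffAt

theorem contDiffAt_frameQuot (κ : C(I, ℝ × ℝ × ℝ)) (p : R × R × R) :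
    ContDiffAt ℝ 1 (fun q : ℝ × R × R × R => frameQuot κ q.1 q.2) (0, p) := by
  have hE : ContDiff ℝ 1 fun q : ℝ × R × R × R => segmentPotential κ q.2 := by fun_prop
  exact (((ContinuousMap.evalCLM ℝ (1 : I)).comp (volterra (Mat2 R))).contDiff.comp
    hE).contDiffAt.add (contDiffAt_fst.smul (contDiffAt_frameRem_segmentPotential κ p))

theorem contDiffAt_hatRem (κ : C(I, ℝ × ℝ × ℝ)) (p : R × R × R) :
    ContDiffAt ℝ 1 (fun q : ℝ × R × R × R => hatRem κ q.1 q.2) (0, p) := by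
  have hSkew := (skewPart (R := R)).contDiff.contDiffAt.comp (0, p)
    (contDiffAt_frameRem_segmentPotential κ p)
  have hForm := (contDiff_rowForm (R := R)).contDiffAt.comp (0, p) (contDiffAt_frameQuot κ p)
  exact hSkew.add hForm

theorem skewPart_frameRem_zero (α β γ : C(I, ℝ)) (p : R × R × R) :
    skewPart (frameRem 0 (segmentPotential (coeffCurve α β γ) p)) =
      (2 * (volterra ℝ (volterra ℝ β * α) 1 - volterra ℝ (volterra ℝ α * β) 1)) •
        (p.1 * p.2.1) := by
  have hpointwise : ((skewPart (R := R) : C(Mat2 R, R))).comp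
      (volterra _ (segmentPotential (coeffCurve α β γ) p) *
        segmentPotential (coeffCurve α β γ) p) =
      (((1 : ℝ →L[ℝ] ℝ).smulRight (p.1 * p.2.1) : ℝ →L[ℝ] R) : C(ℝ, R)).comp
        ((2 : ℝ) • (volterra ℝ β * α - volterra ℝ α * β)) := by
    ext s
    rw [ContinuousMap.comp_apply, ContinuousMap.mul_apply, volterra_segmentPotential,
      volterra_coeffCurve, segmentPotential_apply]
    exact skewPart_potentialMatrix_mul _ _ p
  rw [frameRem_zero, map_volterra, hpointwise, ← map_volterra, map_smul, map_sub]
  rfl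

/-- The quadratic boundary terms cancel in the integration by parts. -/
theorem hatRem_zero (α β γ : C(I, ℝ)) (p : R × R × R) :
    hatRem (coeffCurve α β γ) 0 p =
      (4 * volterra ℝ (volterra ℝ β * α) 1) • (p.1 * p.2.1) := by
  have hparts := volterra_mul_by_parts β α
  rw [mul_comm β] at hparts
  rw [hatRem, skewPart_frameRem_zero, frameQuot, zero_smul, add_zero, volterra_segmentPotential,
    rowForm_potentialMatrix, volterra_coeffCurve, coeffCurve_apply, ← add_smul, hparts]
  ring_nf

end LoopPotential

section RealIntegrals

open Real

/-- The squared distance `|z - e^{iφ}|²` for real `z`. -/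
def den (φ z : ℝ) : ℝ := z ^ 2 - 2 * z * cos φ + 1

theorem sq_sin_le_den (φ z : ℝ) : sin φ ^ 2 ≤ den φ z := by
  rw [den, sin_sq]
  linarith [sq_nonneg (z - cos φ)]

theorem den_pos {φ : ℝ} (h : sin φ ≠ 0) (z : ℝ) : 0 < den φ z :=
  (by positivity : 0 < sin φ ^ 2).trans_le (sq_sin_le_den φ z)

theorem den_add_den_neg (φ z : ℝ) : den φ z + den φ (-z) = 2 * (z ^ 2 + 1) := by
  rw [den, den]
  ring

theorem den_mul_den_neg (φ z : ℝ) :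
    den φ z * den φ (-z) = (1 - z ^ 2) ^ 2 + 4 * z ^ 2 * sin φ ^ 2 := by
  rw [den, den, sin_sq]
  ring

theorem den_pi_sub (φ z : ℝ) : den (π - φ) z = den φ (-z) := by
  rw [den, den, cos_pi_sub]
  ring

@[fun_prop]
theorem continuous_den (φ : ℝ) : Continuous (den φ) := by
  unfold den
  fun_prop

theorem hasDerivAt_den (φ z : ℝ) : HasDerivAt (den φ) (2 * (z - cos φ)) z := by
  refine ((((hasDerivAt_id z).pow 2).sub (((hasDerivAt_id z).const_mul 2).mul_const
    (cos φ))).add_const 1).congr_deriv ?_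
  simp only [id, Nat.cast_ofNat]
  ring

theorem hasDerivAt_den_angle (φ z : ℝ) : HasDerivAt (fun a => den a z) (2 * z * sin φ) φ := by
  refine ((((hasDerivAt_cos φ).const_mul (2 * z)).const_sub (z ^ 2)).add_const 1).congr_deriv ?_
  ring

/-- The coefficient of `a` in the potential on the real axis. -/
def coefA (φ z : ℝ) : ℝ := -(4 * z * sin (2 * φ)) / (den φ z * den φ (-z))

/-- The coefficient of `b` in the potential on the real axis. -/
def coefB (φ z : ℝ) : ℝ := 2 * (z - cos φ) / den φ z - 2 * (z + cos φ) / den φ (-z)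

/-- The coefficient of `c` in the potential on the real axis. -/
def coefC (φ z : ℝ) : ℝ := -2 * (sin φ / den φ z + sin φ / den φ (-z))

theorem continuous_coefA {φ : ℝ} (h : sin φ ≠ 0) : Continuous (coefA φ) :=
  Continuous.div (by fun_prop) (by fun_prop) fun _ => (mul_pos (den_pos h _) (den_pos h _)).ne'

theorem continuous_coefB {φ : ℝ} (h : sin φ ≠ 0) : Continuous (coefB φ) :=
  (Continuous.div (by fun_prop) (by fun_prop) fun _ => (den_pos h _).ne').sub
    (Continuous.div (by fun_prop) (by fun_prop) fun _ => (den_pos h _).ne')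

theorem continuous_sin_div_den {φ : ℝ} (h : sin φ ≠ 0) : Continuous fun z => sin φ / den φ z :=
  continuous_const.div (continuous_den φ) fun _ => (den_pos h _).ne'

theorem continuous_coefC {φ : ℝ} (h : sin φ ≠ 0) : Continuous (coefC φ) :=
  continuous_const.mul ((continuous_sin_div_den h).add
    ((continuous_sin_div_den h).comp continuous_neg))

theorem coefC_eq_div {φ : ℝ} (h : sin φ ≠ 0) (z : ℝ) :
    coefC φ z = -(4 * sin φ * (z ^ 2 + 1)) / (den φ z * den φ (-z)) := by
  have hz := (den_pos h z).ne'
  have hz' := (den_pos h (-z)).ne'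
  rw [coefC, div_add_div _ _ hz hz', ← mul_comm (sin φ), ← mul_add, add_comm,
    den_add_den_neg]
  ring

theorem hasDerivAt_arctan_sub_cos_div_sin {φ : ℝ} (h : sin φ ≠ 0) (z : ℝ) :
    HasDerivAt (fun z => arctan ((z - cos φ) / sin φ)) (sin φ / den φ z) z := by
  refine (((hasDerivAt_id z).sub_const (cos φ)).div_const (sin φ)).arctan.congr_deriv ?_
  have hsq : 1 + ((z - cos φ) / sin φ) ^ 2 = den φ z / sin φ ^ 2 := by
    rw [den]
    field_simp
    linear_combination sin_sq_add_cos_sq φ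
  have := den_pos h z
  simp only [id, hsq]
  field_simp

theorem integral_sin_div_den {φ : ℝ} (h : φ ∈ Set.Ioo 0 π) :
    ∫ z in (0 : ℝ)..1, sin φ / den φ z = (π - φ) / 2 := by
  have hs : sin φ ≠ 0 := (sin_pos_of_mem_Ioo h).ne'
  have hone : arctan ((1 - cos φ) / sin φ) = φ / 2 := by
    have hhalf : (1 - cos φ) / sin φ = tan (φ / 2) := by
      have hs' : sin (φ / 2) ≠ 0 :=
        (sin_pos_of_pos_of_lt_pi (by linarith [h.1]) (by linarith [h.1, h.2])).ne'
      have hcos : 1 - cos φ = 2 * sin (φ / 2) ^ 2 := by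
        rw [sin_sq_eq_half_sub, mul_div_cancel₀ φ two_ne_zero]
        ring
      have hsin : sin φ = 2 * sin (φ / 2) * cos (φ / 2) := by
        rw [← sin_two_mul, mul_div_cancel₀ φ two_ne_zero]
      rw [hcos, hsin, tan_eq_sin_div_cos]
      field_simp
    rw [hhalf, arctan_tan (by linarith [h.1, pi_pos]) (by linarith [h.2])]
  have hzero : arctan ((0 - cos φ) / sin φ) = -(π / 2 - φ) := by
    rw [zero_sub, neg_div, arctan_neg, ← inv_div, ← tan_eq_sin_div_cos, ← tan_pi_div_two_sub,
      arctan_tan (by linarith [h.2]) (by linarith [h.1])]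
  rw [intervalIntegral.integral_eq_sub_of_hasDerivAt
    (fun z _ => hasDerivAt_arctan_sub_cos_div_sin hs z)
    ((continuous_sin_div_den hs).intervalIntegrable _ _), hone, hzero]
  ring

theorem integral_coefC {φ : ℝ} (h : φ ∈ Set.Ioo 0 π) : ∫ z in (0 : ℝ)..1, coefC φ z = -π := by
  have hs : sin φ ≠ 0 := (sin_pos_of_mem_Ioo h).ne'
  have h' : π - φ ∈ Set.Ioo 0 π := ⟨by linarith [h.2], by linarith [h.1]⟩
  have hrefl := integral_sin_div_den h'
  simp only [den_pi_sub, sin_pi_sub] at hrefl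
  have hcont : Continuous fun z => sin φ / den φ (-z) :=
    (continuous_sin_div_den hs).comp continuous_neg
  simp only [coefC]
  rw [intervalIntegral.integral_const_mul, intervalIntegral.integral_add
    ((continuous_sin_div_den hs).intervalIntegrable _ _) (hcont.intervalIntegrable _ _),
    integral_sin_div_den h, hrefl]
  ring

/-- The antiderivative `log (|z - e^{iφ}|² / |z + e^{iφ}|²)` of `coefB`. -/
def logRatio (φ z : ℝ) : ℝ := log (den φ z) - log (den φ (-z))

theorem hasDerivAt_logRatio {φ : ℝ} (h : sin φ ≠ 0) (z : ℝ) :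
    HasDerivAt (logRatio φ) (coefB φ z) z := by
  refine (((hasDerivAt_den φ z).log (den_pos h z).ne').sub
    (((hasDerivAt_den φ (-z)).scomp z (hasDerivAt_neg z)).log (den_pos h (-z)).ne')).congr_deriv ?_
  rw [coefB, smul_eq_mul, Function.comp_apply]
  ring

theorem continuous_logRatio {φ : ℝ} (h : sin φ ≠ 0) : Continuous (logRatio φ) :=
  continuous_iff_continuousAt.2 fun z => (hasDerivAt_logRatio h z).continuousAt

theorem integral_coefB {φ : ℝ} (h : sin φ ≠ 0) (s : ℝ) :
    ∫ z in (0 : ℝ)..s, coefB φ z = logRatio φ s := by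
  rw [intervalIntegral.integral_eq_sub_of_hasDerivAt (fun z _ => hasDerivAt_logRatio h z)
    ((continuous_coefB h).intervalIntegrable _ _), sub_eq_self, logRatio, neg_zero, sub_self]

theorem hasDerivAt_logRatio_angle {a : ℝ} (h : sin a ≠ 0) (z : ℝ) :
    HasDerivAt (fun a => logRatio a z) (-z * coefC a z) a := by
  refine (((hasDerivAt_den_angle a z).log (den_pos h z).ne').sub
    ((hasDerivAt_den_angle a (-z)).log (den_pos h (-z)).ne')).congr_deriv ?_
  rw [coefC]
  ring

theorem abs_coefC_le {a m : ℝ} (hm : 0 < m) (h : m < sin a) (z : ℝ) :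
    |coefC a z| ≤ 4 / m ^ 2 := by
  have hle (w : ℝ) : |sin a / den a w| ≤ 1 / m ^ 2 := by
    rw [abs_div, abs_of_pos (den_pos (hm.trans h).ne' w)]
    exact div_le_div₀ zero_le_one (abs_sin_le_one a) (by positivity)
      ((pow_le_pow_left₀ hm.le h.le 2).trans (sq_sin_le_den a w))
  calc |coefC a z| = 2 * |sin a / den a z + sin a / den a (-z)| := by
        rw [coefC, abs_mul, abs_neg, abs_two]
    _ ≤ 2 * (1 / m ^ 2 + 1 / m ^ 2) := by
        gcongr
        exact (abs_add_le _ _).trans (add_le_add (hle z) (hle (-z)))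
    _ = 4 / m ^ 2 := by ring

/-- The integral whose value at `a = φ` is the second order term of the monodromy. The angle `a` of
the logarithm is freed in order to differentiate with respect to it. -/
def logIntegral (φ a : ℝ) : ℝ := ∫ z in (0 : ℝ)..1, logRatio a z * coefA φ z

theorem hasDerivAt_logIntegral {φ a : ℝ} (hφ : sin φ ≠ 0) (ha : 0 < sin a) :
    HasDerivAt (logIntegral φ) (∫ z in (0 : ℝ)..1, -z * coefC a z * coefA φ z) a := by
  have hA := continuous_coefA hφ
  have hmem : {b : ℝ | sin a / 2 < sin b} ∈ 𝓝 a :=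
    (isOpen_lt continuous_const continuous_sin).mem_nhds (half_lt_self ha)
  have hne : ∀ b ∈ {b : ℝ | sin a / 2 < sin b}, sin b ≠ 0 := fun b hb =>
    ((half_pos ha).trans hb).ne'
  refine (intervalIntegral.hasDerivAt_integral_of_dominated_loc_of_deriv_le
    (F := fun b z => logRatio b z * coefA φ z) (F' := fun b z => -z * coefC b z * coefA φ z)
    (bound := fun z => 4 / (sin a / 2) ^ 2 * |coefA φ z|) hmem ?_
    (((continuous_logRatio ha.ne').mul hA).intervalIntegrable _ _)
    ((continuous_neg.mul (continuous_coefC ha.ne')).mul hA).aestronglyMeasurable ?_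
    ((continuous_const.mul hA.abs).intervalIntegrable _ _) ?_).2
  · filter_upwards [hmem] with b hb
    exact ((continuous_logRatio (hne b hb)).mul hA).aestronglyMeasurable
  · refine Eventually.of_forall fun z hz b hb => ?_
    rw [Set.uIoc_of_le zero_le_one] at hz
    rw [norm_eq_abs, abs_mul, abs_mul, abs_neg, abs_of_pos hz.1]
    gcongr
    exact (mul_le_of_le_one_left (abs_nonneg _) hz.2).trans (abs_coefC_le (half_pos ha) hb z)
  · exact Eventually.of_forall fun z _ b hb =>
      (hasDerivAt_logRatio_angle (hne b hb) z).mul_const _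

theorem coefC_mul_coefA_eq {φ a : ℝ} (hφ : sin φ ≠ 0) (ha : sin a ≠ 0)
    (hne : sin a ^ 2 - sin φ ^ 2 ≠ 0) (z : ℝ) :
    -z * coefC a z * coefA φ z =
      (2 * sin φ * cos φ * sin a / (sin a ^ 2 - sin φ ^ 2)) *
        (coefC φ z / sin φ - coefC a z / sin a) := by
  have hX := (mul_pos (den_pos hφ z) (den_pos hφ (-z))).ne'
  have hY := (mul_pos (den_pos ha z) (den_pos ha (-z))).ne'
  have hsub : den a z * den a (-z) - den φ z * den φ (-z) =
      4 * z ^ 2 * (sin a ^ 2 - sin φ ^ 2) := by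
    rw [den_mul_den_neg, den_mul_den_neg]
    ring
  rw [coefC_eq_div hφ, coefC_eq_div ha, coefA, sin_two_mul]
  generalize den φ z * den φ (-z) = X at *
  generalize den a z * den a (-z) = Y at *
  generalize sin a ^ 2 - sin φ ^ 2 = Δ at *
  field_simp
  linear_combination cos φ * hsub

theorem integral_coefC_mul_coefA {φ a : ℝ} (hφ : φ ∈ Set.Ioo 0 π) (ha : a ∈ Set.Ioo 0 π)
    (hne : sin φ < sin a) :
    ∫ z in (0 : ℝ)..1, -z * coefC a z * coefA φ z = -(2 * π * cos φ / (sin a + sin φ)) := by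
  have hs : 0 < sin φ := sin_pos_of_mem_Ioo hφ
  have hs' : 0 < sin a := sin_pos_of_mem_Ioo ha
  have hint {b : ℝ} (hb : 0 < sin b) :
      IntervalIntegrable (fun z => coefC b z / sin b) MeasureTheory.volume 0 1 :=
    ((continuous_coefC hb.ne').div_const _).intervalIntegrable _ _
  have hsq : sin a ^ 2 - sin φ ^ 2 ≠ 0 := (sub_pos.2 (pow_lt_pow_left₀ hne hs.le two_ne_zero)).ne'
  simp only [coefC_mul_coefA_eq hs.ne' hs'.ne' hsq]
  rw [intervalIntegral.integral_const_mul, intervalIntegral.integral_sub (hint hs) (hint hs'),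
    intervalIntegral.integral_div, intervalIntegral.integral_div, integral_coefC hφ,
    integral_coefC ha, sq_sub_sq]
  have hsum : sin a + sin φ ≠ 0 := (add_pos hs' hs).ne'
  have hdiff : sin a - sin φ ≠ 0 := (sub_pos.2 hne).ne'
  field_simp
  ring

theorem hasDerivAt_log_sin_sub_log_cos {φ a : ℝ} (hsin : sin ((a + φ) / 2) ≠ 0)
    (hcos : cos ((a - φ) / 2) ≠ 0) :
    HasDerivAt (fun a => log (sin ((a + φ) / 2)) - log (cos ((a - φ) / 2)))
      (cos φ / (sin a + sin φ)) a := by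
  refine (((((hasDerivAt_id a).add_const φ).div_const 2).sin.log hsin).sub
    ((((hasDerivAt_id a).sub_const φ).div_const 2).cos.log hcos)).congr_deriv ?_
  have hadd : sin a + sin φ = 2 * sin ((a + φ) / 2) * cos ((a - φ) / 2) := by
    rw [two_mul_sin_mul_cos]
    ring_nf
  have hcosφ : cos φ =
      cos ((a + φ) / 2) * cos ((a - φ) / 2) + sin ((a + φ) / 2) * sin ((a - φ) / 2) := by
    rw [← cos_sub]
    ring_nf
  rw [hadd, hcosφ]
  simp only [id]
  field_simp
  ring

/-- The functions `logIntegral φ a` and `-2π (log (sin ((a + φ) / 2)) - log (cos ((a - φ) / 2)))` of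
`a` both vanish at `a = π / 2` and have the same derivative; take `a = φ`. -/
theorem logIntegral_eq {φ : ℝ} (h : φ ∈ Set.Ioo 0 (π / 2)) :
    logIntegral φ φ = -(2 * π * log (sin φ)) := by
  have hπ := pi_pos
  have hφ : φ ∈ Set.Ioo 0 π := ⟨h.1, by linarith [h.2]⟩
  have hs : 0 < sin φ := sin_pos_of_mem_Ioo hφ
  let G : ℝ → ℝ := fun a => log (sin ((a + φ) / 2)) - log (cos ((a - φ) / 2))
  have hG : ∀ a ∈ Set.Icc φ (π / 2), HasDerivAt G (cos φ / (sin a + sin φ)) a := fun a ha =>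
    hasDerivAt_log_sin_sub_log_cos
      (sin_pos_of_pos_of_lt_pi (by linarith [ha.1, h.1]) (by linarith [ha.2, h.2])).ne'
      (cos_pos_of_mem_Ioo ⟨by linarith [ha.1, h.1], by linarith [ha.2, h.1]⟩).ne'
  have hderiv : ∀ a ∈ Set.Icc φ (π / 2), HasDerivAt (fun a => logIntegral φ a + 2 * π * G a)
      ((∫ z in (0 : ℝ)..1, -z * coefC a z * coefA φ z) +
        2 * π * (cos φ / (sin a + sin φ))) a := fun a ha =>
    (hasDerivAt_logIntegral hs.ne' (sin_pos_of_pos_of_lt_pi (h.1.trans_le ha.1)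
      (by linarith [ha.2]))).add ((hG a ha).const_mul (2 * π))
  obtain ⟨a, ha, hslope⟩ := exists_hasDerivAt_eq_slope _ _ h.2
    (fun a ha => (hderiv a ha).continuousAt.continuousWithinAt)
    (fun a ha => hderiv a (Set.Ioo_subset_Icc_self ha))
  have hlt : sin φ < sin a := sin_lt_sin_of_lt_of_le_pi_div_two (by linarith [h.1]) ha.2.le ha.1
  rw [integral_coefC_mul_coefA hφ ⟨h.1.trans ha.1, by linarith [ha.2]⟩ hlt,
    ← mul_div_assoc, neg_add_cancel, eq_comm, div_eq_zero_iff, sub_eq_zero] at hslope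
  have hends := hslope.resolve_right (by linarith [h.2])
  have hright : logIntegral φ (π / 2) = 0 := by
    simp [logIntegral, logRatio, den]
  have hG_right : G (π / 2) = 0 := by
    have hrefl : cos ((π / 2 - φ) / 2) = sin ((π / 2 + φ) / 2) := by
      rw [← cos_pi_div_two_sub]
      ring_nf
    simp only [G, hrefl, sub_self]
  have hG_left : G φ = log (sin φ) := by
    simp only [G, add_self_div_two, sub_self, zero_div, cos_zero, log_one, sub_zero]
  rw [hright, hG_right, hG_left] at hends
  linarith

end RealIntegrals

section PrincipalSolutions

open unitInterval

theorem Mat2.hasDerivWithinAt_iff_entry {R : Type*} [NormedCommRing R] [NormedAlgebra ℝ R]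
    {f : ℝ → Mat2 R} {f' : Mat2 R} {S : Set ℝ} {s : ℝ} :
    HasDerivWithinAt f f' S s ↔
      ∀ i j, HasDerivWithinAt (fun u => (f u).entry i j) (f'.entry i j) S s := by
  refine ⟨fun h i j => (Mat2.entry (R := R) i j).hasFDerivAt.comp_hasDerivWithinAt s h, fun h => ?_⟩
  let ofEntries : (Fin 2 → Fin 2 → R) →L[ℝ] Mat2 R :=
    { toFun := fun M => M
      map_add' := fun _ _ => rfl
      map_smul' := fun _ _ => rfl
      cont := continuous_id (X := Matrix (Fin 2) (Fin 2) R) }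
  exact (ofEntries.hasFDerivAt (x := fun i j => (f s).entry i j)).comp_hasDerivWithinAt s
    (hasDerivWithinAt_pi.2 fun i => hasDerivWithinAt_pi.2 fun j => h i j)

theorem isFrameAlong_iff {E : ℂ → Matrix (Fin 2) (Fin 2) ℂ} {w : ℂ} {M : I → Mat2 ℂ}
    (hM : ∀ s : I, w • E ((s : ℝ) * w) = M s) {Y : ℝ → Mat2 ℂ} :
    IsFrameAlong E w Y ↔
      Y 0 = 1 ∧ ∀ s : I, HasDerivWithinAt Y (Y s * M s) (Set.Icc 0 1) s := by
  refine and_congr_right fun _ => ⟨fun h s => Mat2.hasDerivWithinAt_iff_entry.2 fun i j => ?_,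
    fun h s hs i j => ?_⟩
  · rw [← hM s]
    exact h s s.2 i j
  · have hE : w • E (s * w) = M ⟨s, hs⟩ := hM ⟨s, hs⟩
    rw [hE]
    exact Mat2.hasDerivWithinAt_iff_entry.1 (h ⟨s, hs⟩) i j

theorem principal_eq {E : ℂ → Matrix (Fin 2) (Fin 2) ℂ} {w : ℂ} {M : C(I, Mat2 ℂ)}
    (hM : ∀ s : I, w • E ((s : ℝ) * w) = M s) {Y : ℝ → Mat2 ℂ} (hY : IsFrameAlong E w Y) :
    principal E w = Y 1 := by
  have hex : ∃ Y, IsFrameAlong E w Y := ⟨Y, hY⟩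
  rw [principal, dif_pos hex]
  have hframe (Z : ℝ → Mat2 ℂ) (hZ : IsFrameAlong E w Z) :
      ∀ s ∈ Set.Icc (0 : ℝ) 1,
        HasDerivWithinAt Z (Z s * Set.IccExtend (zero_le_one' ℝ) M s) (Set.Icc 0 1) s :=
    fun s hs => by
      rw [Set.IccExtend_of_mem _ _ hs]
      exact ((isFrameAlong_iff hM).1 hZ).2 ⟨s, hs⟩
  have hright (Z : ℝ → Mat2 ℂ) (hZ : IsFrameAlong E w Z) : ∀ s ∈ Set.Ico (0 : ℝ) 1,
      HasDerivWithinAt Z (Z s * Set.IccExtend (zero_le_one' ℝ) M s) (Set.Ici s) s := fun s hs =>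
    (hframe Z hZ s (Set.Ico_subset_Icc_self hs)).mono_of_mem_nhdsWithin (Icc_mem_nhdsGE_of_mem hs)
  have hlipschitz : ∀ s ∈ Set.Ico (0 : ℝ) 1, LipschitzOnWith ‖M‖₊
      (fun X : Mat2 ℂ => X * Set.IccExtend (zero_le_one' ℝ) M s) Set.univ := fun s _ =>
    LipschitzOnWith.of_dist_le_mul fun X _ X' _ => by
      rw [dist_eq_norm, dist_eq_norm, ← sub_mul, mul_comm]
      exact (norm_mul_le _ _).trans (mul_le_mul_of_nonneg_left (M.norm_coe_le_norm _)
        (norm_nonneg _))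
  have hchoose := hex.choose_spec
  exact ODE_solution_unique_of_mem_Icc_right (s := fun _ => Set.univ) hlipschitz
    (fun s hs => (hframe _ hchoose s hs).continuousWithinAt) (hright _ hchoose)
    (fun _ _ => trivial) (fun s hs => (hframe _ hY s hs).continuousWithinAt) (hright _ hY)
    (fun _ _ => trivial) (hchoose.1.trans hY.1.symm) (Set.right_mem_Icc.2 zero_le_one)

theorem principal_eq_map_solution {B : Type*} [NormedRing B] [NormedAlgebra ℝ B] [CompleteSpace B]
    (L : B →A[ℝ] Mat2 ℂ) {t : ℝ} {X : C(I, B)} (h : IsRegular t X)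
    {E : ℂ → Matrix (Fin 2) (Fin 2) ℂ} {w : ℂ}
    (hE : ∀ s : I, w • E ((s : ℝ) * w) = t • L (X s)) :
    principal E w = L (solution t X 1) := by
  let M : C(I, Mat2 ℂ) := ⟨fun s => t • L (X s), by fun_prop⟩
  have hframe : IsFrameAlong E w
      fun s => L (Set.IccExtend (zero_le_one' ℝ) ⇑(solution t X) s) := by
    refine (isFrameAlong_iff (M := M) hE).2 ⟨?_, fun s => ?_⟩
    · rw [Set.IccExtend_left, ← map_one L]
      exact congrArg L (solution_apply_zero h)
    · refine ((L.toContinuousLinearMap.hasFDerivAt.comp_hasDerivWithinAt (s : ℝ)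
        (hasDerivWithinAt_solution h s)).congr_deriv ?_)
      rw [Set.IccExtend_val]
      change L (t • (solution t X s * X s)) = L (solution t X s) * t • L (X s)
      rw [map_smul, map_mul, mul_smul_comm]
  rw [principal_eq (M := M) hE hframe, Set.IccExtend_right]
  rfl

variable {R : Type*} [NormedCommRing R] [NormedAlgebra ℝ R]

/-- The values of a matrix over `R` at a character `ev`, conjugated by `diag (1, u)`. -/
def twistedValue (ev : R →A[ℝ] ℂ) (u : ℂˣ) : Mat2 R →A[ℝ] Mat2 ℂ where
  toAlgHom := AlgHom.ofLinearMap
    { toFun := fun M => Mat2.of (ev (M.entry 0 0)) (u * ev (M.entry 0 1))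
        ((u⁻¹ : ℂˣ) * ev (M.entry 1 0)) (ev (M.entry 1 1))
      map_add' := fun M N => by simp only [map_add, mul_add, Mat2.of_add_of]
      map_smul' := fun c M => by
        simp only [map_smul, mul_smul_comm, RingHom.id_apply, Mat2.smul_of] }
    (by simp [Mat2.one_eq_of, Mat2.entry_of])
    (fun M N => by
      have hu := u.mul_inv
      simp only [LinearMap.coe_mk, AddHom.coe_mk, Mat2.entry_mul, map_add, map_mul, Mat2.of_mul_of]
      congr 1
      · linear_combination (-ev (M.entry 0 1) * ev (N.entry 1 0)) * hu
      · ring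
      · ring
      · linear_combination (-ev (M.entry 1 0) * ev (N.entry 0 1)) * hu)
  cont := Mat2.continuous_of_entry fun i j => by
    fin_cases i <;> fin_cases j
    · exact (by fun_prop : Continuous fun M : Mat2 R => ev (M.entry 0 0))
    · exact (by fun_prop : Continuous fun M : Mat2 R => u * ev (M.entry 0 1))
    · exact (by fun_prop : Continuous fun M : Mat2 R => (u⁻¹ : ℂˣ) * ev (M.entry 1 0))
    · exact (by fun_prop : Continuous fun M : Mat2 R => ev (M.entry 1 1))

theorem twistedValue_apply (ev : R →A[ℝ] ℂ) (u : ℂˣ) (M : Mat2 R) :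
    twistedValue ev u M = Mat2.of (ev (M.entry 0 0)) (u * ev (M.entry 0 1))
      ((u⁻¹ : ℂˣ) * ev (M.entry 1 0)) (ev (M.entry 1 1)) := rfl

theorem rowForm_twistedValue_one (ev : R →A[ℝ] ℂ) (M : Mat2 R) :
    Mat2.rowForm (twistedValue ev 1 M) = ev M.rowForm := by
  simp only [twistedValue_apply, Mat2.rowForm, Mat2.entry_of, Units.val_one, inv_one, one_mul,
    map_sub, map_mul]

theorem I_mul_entry_twistedValue_I (ev : R →A[ℝ] ℂ) (M : Mat2 R) {N : Mat2 ℂ}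
    (hN : N = twistedValue ev (.mk0 Complex.I Complex.I_ne_zero) M) :
    Complex.I * (N.entry 0 0 * N.entry 1 0 + N.entry 0 1 * N.entry 1 1) = ev M.rowForm := by
  rw [hN]
  simp only [twistedValue_apply, Mat2.entry_of, Mat2.rowForm, map_sub, map_mul, Units.val_mk0,
    Units.val_inv_eq_inv_val]
  linear_combination ev (M.entry 0 1) * ev (M.entry 1 1) * Complex.I_mul_I +
    ev (M.entry 0 0) * ev (M.entry 1 0) * mul_inv_cancel₀ Complex.I_ne_zero

theorem twistedValue_potentialMatrix (ev : R →A[ℝ] ℂ) (u : ℂˣ) (κ : ℝ × ℝ × ℝ) (p : R × R × R) :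
    twistedValue ev u (potentialMatrix κ p) =
      Mat2.of (κ.1 • ev p.1) (u * (κ.2.1 • ev p.2.1 + κ.2.2 • ev p.2.2))
        ((u⁻¹ : ℂˣ) * (κ.2.1 • ev p.2.1 - κ.2.2 • ev p.2.2)) (-(κ.1 • ev p.1)) := by
  simp only [twistedValue_apply, potentialMatrix, Mat2.entry_of, map_add, map_sub, map_neg,
    map_smul]

end PrincipalSolutions

section Punctures

open Complex (I exp)
open Real (cos sin)
open scoped Real

theorem exp_I_mul (α : ℝ) : exp (I * α) = cos α + sin α * I := by
  rw [mul_comm, Complex.exp_mul_I, Complex.ofReal_cos, Complex.ofReal_sin]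

theorem puncture_eq (φ : ℝ) :
    puncture φ = ![exp (I * φ), exp (I * (π - φ : ℝ)), exp (I * (φ - π : ℝ)),
      exp (I * (-φ : ℝ))] := by
  have hshift : exp (I * (φ - π : ℝ)) = -exp (I * φ) := by
    rw [Complex.ofReal_sub, mul_sub, mul_comm I (π : ℂ), Complex.exp_sub_pi_mul_I]
  have hreflect : exp (I * (π - φ : ℝ)) = -exp (-(I * φ)) := by
    rw [Complex.ofReal_sub, mul_sub, mul_comm I (π : ℂ), sub_eq_neg_add, Complex.exp_add_pi_mul_I]
  rw [puncture, hshift, hreflect, Complex.ofReal_neg, mul_neg]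

theorem inv_sub_exp (α z : ℝ) :
    ((z : ℂ) - exp (I * α))⁻¹ = (z - cos α + sin α * I) * (den α z : ℂ)⁻¹ := by
  have hnormSq : Complex.normSq (z - exp (I * α)) = den α z := by
    rw [exp_I_mul, Complex.normSq_apply]
    simp only [Complex.sub_re, Complex.sub_im, Complex.add_re, Complex.add_im, Complex.ofReal_re,
      Complex.ofReal_im, Complex.re_ofReal_mul, Complex.im_ofReal_mul, Complex.I_re, Complex.I_im,
      den]
    linear_combination Real.sin_sq_add_cos_sq α
  rw [Complex.inv_def, hnormSq, Complex.ofReal_inv, exp_I_mul]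
  congr 1
  simp only [map_sub, map_add, map_mul, Complex.conj_ofReal, Complex.conj_I]
  ring

theorem inv_sub_puncture (φ z : ℝ) :
    (fun k => ((z : ℂ) - puncture φ k)⁻¹) =
      ![(z - cos φ + sin φ * I) * (den φ z : ℂ)⁻¹, (z + cos φ + sin φ * I) * (den φ (-z) : ℂ)⁻¹,
        (z + cos φ - sin φ * I) * (den φ (-z) : ℂ)⁻¹,
        (z - cos φ - sin φ * I) * (den φ z : ℂ)⁻¹] := by
  have hneg : den (φ - π) z = den φ (-z) := by
    rw [← den_pi_sub, den, den, ← Real.cos_neg (φ - π), neg_sub]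
  have hden : den (-φ) z = den φ z := by rw [den, den, Real.cos_neg]
  ext k
  rw [puncture_eq]
  fin_cases k <;>
    simp only [Fin.zero_eta, Fin.mk_one, Fin.reduceFinMk, Matrix.cons_val, inv_sub_exp]
  · rw [den_pi_sub, Real.cos_pi_sub, Real.sin_pi_sub]
    push_cast
    ring
  · rw [hneg, Real.cos_sub_pi, Real.sin_sub_pi]
    push_cast
    ring
  · rw [hden, Real.cos_neg, Real.sin_neg]
    push_cast
    ring

theorem coefA_eq {φ : ℝ} (h : sin φ ≠ 0) (z : ℝ) :
    coefA φ z = -2 * sin φ * ((den φ z)⁻¹ - (den φ (-z))⁻¹) := by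
  have hsub : den φ (-z) - den φ z = 4 * z * cos φ := by unfold den; ring
  rw [coefA, Real.sin_two_mul, inv_sub_inv (den_pos h z).ne' (den_pos h (-z)).ne', hsub]
  ring

/-- The coefficients `(α, β, γ)` of the potential on the real axis. -/
def axisCoeff (φ z : ℝ) : ℝ × ℝ × ℝ := (coefA φ z, coefB φ z, coefC φ z)

theorem sum_smul_residueMatrix {φ : ℝ} (h : sin φ ≠ 0) (z : ℝ) (a b c : ℂ) :
    ∑ k, ((z : ℂ) - puncture φ k)⁻¹ • residueMatrix a b c k =
      potentialMatrix (axisCoeff φ z) (a, b, c) := by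
  have hinv := congrFun (inv_sub_puncture φ z)
  rw [Fin.sum_univ_four, hinv, hinv, hinv, hinv, axisCoeff, coefA_eq h, coefB, coefC]
  ext i j
  fin_cases i <;> fin_cases j <;> simp [residueMatrix, potentialMatrix, Mat2.of] <;> ring_nf <;>
    simp only [Complex.I_sq] <;> ring

theorem puncture_add_one (φ : ℝ) (k : Fin 4) :
    puncture φ (k + 1) = I * puncture (π / 2 - φ) k := by
  have hexp : exp (I * (π / 2 - φ : ℝ)) = I * exp (-(I * φ)) := by
    rw [Complex.ofReal_sub, mul_sub, sub_eq_add_neg, Complex.exp_add, mul_comm I]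
    push_cast
    rw [Complex.exp_pi_div_two_mul_I]
  have hexp_neg : exp (-(I * (π / 2 - φ : ℝ))) = -I * exp (I * φ) := by
    rw [Complex.exp_neg, hexp, mul_inv, Complex.inv_I, ← Complex.exp_neg, neg_neg]
  generalize π / 2 - φ = ψ at hexp hexp_neg
  fin_cases k <;> simp [puncture, hexp, hexp_neg, ← mul_assoc]

theorem I_smul_sum_smul_residueMatrix {φ : ℝ} (h : sin (π / 2 - φ) ≠ 0) (z : ℝ) (a b c : ℂ) :
    I • ∑ k, ((z : ℂ) * I - puncture φ k)⁻¹ • residueMatrix a b c k =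
      Mat2.of (coefA (π / 2 - φ) z • -a)
        (I * (coefB (π / 2 - φ) z • c + coefC (π / 2 - φ) z • b))
        (I⁻¹ * (coefB (π / 2 - φ) z • c - coefC (π / 2 - φ) z • b))
        (-(coefA (π / 2 - φ) z • -a)) := by
  have hrotate (k : Fin 4) : I * ((z : ℂ) * I - puncture φ (k + 1))⁻¹ =
      ((z : ℂ) - puncture (π / 2 - φ) k)⁻¹ := by
    rw [puncture_add_one, mul_comm (z : ℂ), ← mul_sub, mul_inv,
      mul_inv_cancel_left₀ Complex.I_ne_zero]
  have hinv := congrFun (inv_sub_puncture (π / 2 - φ) z)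
  rw [Finset.smul_sum, ← Equiv.sum_comp (Equiv.addRight (1 : Fin 4)) fun k =>
    I • ((z : ℂ) * I - puncture φ k)⁻¹ • residueMatrix a b c k]
  simp only [smul_smul, Equiv.coe_addRight, hrotate]
  rw [Fin.sum_univ_four, hinv, hinv, hinv, hinv, coefA_eq h, coefB, coefC, Complex.inv_I]
  ext i j
  fin_cases i <;> fin_cases j <;> simp [residueMatrix, Mat2.of] <;> ring_nf <;>
    simp only [Complex.I_sq] <;> ring

end Punctures

section HatLoop

open unitInterval
open Real (sin)
open scoped Real

/-- The coefficient functions of the potential along the segment from `0` to `1`. -/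
def axisCurve {φ : ℝ} (h : φ ∈ Set.Ioo 0 π) : C(I, ℝ × ℝ × ℝ) :=
  have hsin := (Real.sin_pos_of_mem_Ioo h).ne'
  coeffCurve ⟨fun s => coefA φ s, (continuous_coefA hsin).comp continuous_subtype_val⟩
    ⟨fun s => coefB φ s, (continuous_coefB hsin).comp continuous_subtype_val⟩
    ⟨fun s => coefC φ s, (continuous_coefC hsin).comp continuous_subtype_val⟩

variable {R : Type*} [NormedCommRing R] [NormedAlgebra ℝ R] [CompleteSpace R] {φ : ℝ}

/-- The loop `𝔭̂` belonging to the loops `p = (a, b, c)`; it is jointly smooth in `(t, p)`. -/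
def hatLoop (h : φ ∈ Set.Ioo 0 π) (t : ℝ) (p : R × R × R) : R :=
  (2 * π) • p.2.2 + t • hatRem (axisCurve h) t p

theorem rowForm_solution_axisCurve (h : φ ∈ Set.Ioo 0 π) {t : ℝ} {p : R × R × R}
    (hreg : IsRegular t (segmentPotential (axisCurve h) p)) :
    Mat2.rowForm (solution t (segmentPotential (axisCurve h) p) 1) = t • hatLoop h t p := by
  have hcoefC : (volterra _ (axisCurve h) 1).2.2 = -π := by
    rw [axisCurve, volterra_coeffCurve, coeffCurve_apply, ← integral_coefC h]
    exact volterra_eq_integral (fun _ => rfl) 1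
  rw [rowForm_solution hreg, hcoefC, hatLoop, neg_mul_neg]

theorem hatRem_axisCurve_zero (h : φ ∈ Set.Ioo 0 (π / 2)) (h' : φ ∈ Set.Ioo 0 π) (p : R × R × R) :
    hatRem (axisCurve h') 0 p = (-8 * π * Real.log (sin φ)) • (p.1 * p.2.1) := by
  have hcoefB (s : I) := (volterra_eq_integral (f := coefB φ)
    (g := ⟨fun s => coefB φ s, (continuous_coefB (Real.sin_pos_of_mem_Ioo h').ne').comp
      continuous_subtype_val⟩) (fun _ => rfl) s).trans
    (integral_coefB (Real.sin_pos_of_mem_Ioo h').ne' s)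
  rw [axisCurve, hatRem_zero, volterra_eq_integral (f := fun z => logRatio φ z * coefA φ z)
    (fun s => congrArg (· * coefA φ s) (hcoefB s)), Set.Icc.coe_one, ← logIntegral,
    logIntegral_eq h]
  ring_nf

variable {ev : R →A[ℝ] ℂ} {t : ℝ} {p : R × R × R} {E : ℂ → Matrix (Fin 2) (Fin 2) ℂ}

theorem rowForm_principal_one (h : φ ∈ Set.Ioo 0 π)
    (hreg : IsRegular t (segmentPotential (axisCurve h) p))
    (hE : ∀ z, E z = (t : ℂ) • ∑ k, (z - puncture φ k)⁻¹ •
      residueMatrix (ev p.1) (ev p.2.1) (ev p.2.2) k) :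
    Mat2.rowForm (R := ℂ) (principal E 1) = t * ev (hatLoop h t p) := by
  rw [principal_eq_map_solution (twistedValue ev 1) hreg fun s => ?_, rowForm_twistedValue_one,
    rowForm_solution_axisCurve h hreg, map_smul, Complex.real_smul]
  rw [one_smul, mul_one, hE, sum_smul_residueMatrix (Real.sin_pos_of_mem_Ioo h).ne',
    segmentPotential_apply, twistedValue_potentialMatrix, inv_one, Units.val_one, one_mul, one_mul]
  exact Complex.coe_smul t _

theorem quadratic_principal_I (h : π / 2 - φ ∈ Set.Ioo 0 π)
    (hreg : IsRegular t (segmentPotential (axisCurve h) p))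
    (hE : ∀ z, E z = (t : ℂ) • ∑ k, (z - puncture φ k)⁻¹ •
      residueMatrix (-ev p.1) (ev p.2.2) (ev p.2.1) k) :
    Complex.I * (principal E Complex.I 0 0 * principal E Complex.I 1 0 +
      principal E Complex.I 0 1 * principal E Complex.I 1 1) = t * ev (hatLoop h t p) := by
  refine (I_mul_entry_twistedValue_I ev (solution t (segmentPotential (axisCurve h) p) 1)
    (principal_eq_map_solution _ hreg fun s => ?_)).trans ?_
  · rw [hE, smul_comm, I_smul_sum_smul_residueMatrix (Real.sin_pos_of_mem_Ioo h).ne',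
      segmentPotential_apply, twistedValue_potentialMatrix, neg_neg]
    exact Complex.coe_smul t _
  · rw [rowForm_solution_axisCurve h hreg, map_smul, Complex.real_smul]

end HatLoop

section HatLoops

open Real (sin cos)
open scoped W Real

variable {ρ : ℝ} [Fact (1 < ρ)]

/-- The component `ã` of a parameter vector. -/
def Param.aL : Param ρ →L[ℝ] WRplus ρ :=
  .fst ℝ (WRplus ρ) (WRplus ρ × WRplus ρ × ℝ × ℝ)

/-- The component `b̃` of a parameter vector. -/
def Param.bL : Param ρ →L[ℝ] WRplus ρ :=
  (ContinuousLinearMap.fst ℝ (WRplus ρ) (WRplus ρ × ℝ × ℝ)).comp (.snd ℝ (WRplus ρ) _)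

/-- The component `c̃` of a parameter vector. -/
def Param.cL : Param ρ →L[ℝ] WRplus ρ :=
  (ContinuousLinearMap.fst ℝ (WRplus ρ) (ℝ × ℝ)).comp
    ((ContinuousLinearMap.snd ℝ (WRplus ρ) _).comp (.snd ℝ (WRplus ρ) _))

/-- The component `r` of a parameter vector. -/
def Param.rL : Param ρ →L[ℝ] ℝ :=
  (ContinuousLinearMap.fst ℝ ℝ ℝ).comp ((ContinuousLinearMap.snd ℝ (WRplus ρ) _).comp
    ((ContinuousLinearMap.snd ℝ (WRplus ρ) _).comp (.snd ℝ (WRplus ρ) _)))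

/-- The component `θ` of a parameter vector. -/
def Param.θL : Param ρ →L[ℝ] ℝ :=
  (ContinuousLinearMap.snd ℝ ℝ ℝ).comp ((ContinuousLinearMap.snd ℝ (WRplus ρ) _).comp
    ((ContinuousLinearMap.snd ℝ (WRplus ρ) _).comp (.snd ℝ (WRplus ρ) _)))

/-- The loop `a` in the algebra of loops with real coefficients. -/
def loopA (x : Param ρ) : realLoops ρ :=
  realMono (-1) (1 / 2) - realMono 1 (1 / 2) + plusIncl (Param.aL x)

/-- The loop `b` in the algebra of loops with real coefficients. -/
def loopB (φ : ℝ) (x : Param ρ) : realLoops ρ :=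
  realMono (-1) (-(1 / 2) * sin φ) + realMono 1 (-(1 / 2) * sin φ) + plusIncl (Param.bL x)

/-- The loop `c` in the algebra of loops with real coefficients. -/
def loopC (φ : ℝ) (x : Param ρ) : realLoops ρ :=
  realMono (-1) (-(1 / 2) * cos φ) + realMono 1 (-(1 / 2) * cos φ) + plusIncl (Param.cL x)

theorem coe_loopA (x : Param ρ) : (loopA x : W ρ) = x.a := by
  simp only [loopA, realMono, Subalgebra.coe_add, Subalgebra.coe_sub, coe_plusIncl, Param.a]
  push_cast
  rfl

theorem coe_loopB (φ : ℝ) (x : Param ρ) : (loopB φ x : W ρ) = x.b φ := by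
  simp only [loopB, realMono, Subalgebra.coe_add, coe_plusIncl, Param.b]
  push_cast
  rfl

theorem coe_loopC (φ : ℝ) (x : Param ρ) : (loopC φ x : W ρ) = x.c φ := by
  simp only [loopC, realMono, Subalgebra.coe_add, coe_plusIncl, Param.c]
  push_cast
  rfl

/-- The loops `r (a, b, c)`, from which `𝔭̂` is obtained. -/
def tripleP (φ : ℝ) (x : Param ρ) : realLoops ρ × realLoops ρ × realLoops ρ :=
  (x.r • loopA x, x.r • loopB φ x, x.r • loopC φ x)

/-- The loops `r (-a, c, b)`, from which `𝔮̂` is obtained: the rotation by `i` turns `φ` into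
`π / 2 - φ` and exchanges `b` and `c`. -/
def tripleQ (φ : ℝ) (x : Param ρ) : realLoops ρ × realLoops ρ × realLoops ρ :=
  (-(x.r • loopA x), x.r • loopC φ x, x.r • loopB φ x)

theorem residueMatrix_smul (r : ℝ) (a b c : ℂ) (k : Fin 4) :
    residueMatrix (r • a) (r • b) (r • c) k = (r : ℂ) • residueMatrix a b c k := by
  ext i j
  fin_cases k <;> fin_cases i <;> fin_cases j <;> simp [residueMatrix] <;> ring

theorem potential_eq (φ t : ℝ) (x : Param ρ) {l : ℂ} (hl : ‖l‖ = 1) (z : ℂ) :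
    potential φ t x l z = (t : ℂ) • ∑ k, (z - puncture φ k)⁻¹ •
      residueMatrix (realEval l hl (x.r • loopA x)) (realEval l hl (x.r • loopB φ x))
        (realEval l hl (x.r • loopC φ x)) k := by
  simp only [map_smul, realEval_apply, coe_loopA, coe_loopB, coe_loopC, residueMatrix_smul,
    smul_comm _ (x.r : ℂ)]
  rw [← Finset.smul_sum, smul_smul, mul_comm (t : ℂ)]
  rfl

theorem frakP_eq {φ t : ℝ} {x : Param ρ} (h : φ ∈ Set.Ioo 0 π)
    (hreg : IsRegular t (segmentPotential (axisCurve h) (tripleP φ x))) {l : ℂ} (hl : ‖l‖ = 1) :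
    frakP φ t x l = t * realEval l hl (hatLoop h t (tripleP φ x)) :=
  rowForm_principal_one h hreg fun z => potential_eq φ t x hl z

theorem frakQ_eq {φ t : ℝ} {x : Param ρ} (h : π / 2 - φ ∈ Set.Ioo 0 π)
    (hreg : IsRegular t (segmentPotential (axisCurve h) (tripleQ φ x))) {l : ℂ} (hl : ‖l‖ = 1) :
    frakQ φ t x l = t * realEval l hl (hatLoop h t (tripleQ φ x)) :=
  quadratic_principal_I h hreg fun z => by
    simp only [tripleQ, map_neg, neg_neg]
    exact potential_eq φ t x hl z

theorem dslope_eq_of_eq_mul {f g : ℝ → ℂ} {t : ℝ} (hf : ∀ᶠ s in 𝓝 0, f s = s * g s)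
    (hg : DifferentiableAt ℝ g 0) (ht : f t = t * g t) : dslope f 0 t = g t := by
  obtain rfl | ht_ne := eq_or_ne t 0
  · have hderiv : HasDerivAt (fun s : ℝ => (s : ℂ) * g s) (g 0) 0 :=
      ((Complex.ofRealCLM.hasDerivAt (x := 0)).mul hg.hasDerivAt).congr_deriv (by simp)
    rw [dslope_same, (hderiv.congr_of_eventuallyEq hf).deriv]
  · have hf_zero : f 0 = 0 := by rw [hf.self_of_nhds, Complex.ofReal_zero, zero_mul]
    rw [dslope_of_ne _ ht_ne, slope_def_module, sub_zero, hf_zero, sub_zero, ht,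
      Complex.real_smul, Complex.ofReal_inv, inv_mul_cancel_left₀ (Complex.ofReal_ne_zero.2 ht_ne)]

theorem differentiableAt_realEval_hatLoop {φ : ℝ} (h : φ ∈ Set.Ioo 0 π) {l : ℂ} (hl : ‖l‖ = 1)
    (p : realLoops ρ × realLoops ρ × realLoops ρ) :
    DifferentiableAt ℝ (fun t => realEval l hl (hatLoop h t p)) 0 := by
  have hRem : ContDiffAt ℝ 1 (fun t : ℝ => hatRem (axisCurve h) t p) 0 :=
    (contDiffAt_hatRem (axisCurve h) p).comp (0 : ℝ) (contDiffAt_id.prodMk contDiffAt_const)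
  exact (realEval l hl).toContinuousLinearMap.differentiableAt.comp (0 : ℝ)
    ((differentiableAt_id.smul (hRem.differentiableAt one_ne_zero)).const_add _)

theorem eventually_isRegular_axisCurve {X : Type*} [TopologicalSpace X] {φ : ℝ}
    (h : φ ∈ Set.Ioo 0 π) {T : X → realLoops ρ × realLoops ρ × realLoops ρ} {x₀ : X}
    (hT : ContinuousAt T x₀) :
    ∀ᶠ q : ℝ × X in 𝓝 (0, x₀), IsRegular q.1 (segmentPotential (axisCurve h) (T q.2)) := by
  have hcont : ContinuousAt
      (fun q : ℝ × X => (q.1, segmentPotential (axisCurve h) (T q.2))) (0, x₀) :=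
    continuousAt_fst.prodMk ((segmentPotential (axisCurve h)).continuous.continuousAt.comp
      (hT.comp continuousAt_snd))
  exact hcont.eventually (eventually_isRegular _)

theorem eventually_isRegular_axisCurve_const {φ : ℝ} (h : φ ∈ Set.Ioo 0 π)
    (p : realLoops ρ × realLoops ρ × realLoops ρ) :
    ∀ᶠ t in 𝓝 (0 : ℝ), IsRegular t (segmentPotential (axisCurve h) p) :=
  (continuousAt_id.prodMk continuousAt_const).eventually (eventually_isRegular _)

theorem hatP_eq {φ t : ℝ} {x : Param ρ} (h : φ ∈ Set.Ioo 0 π)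
    (hreg : IsRegular t (segmentPotential (axisCurve h) (tripleP φ x))) {l : ℂ} (hl : ‖l‖ = 1) :
    hatP φ t x l = realEval l hl (hatLoop h t (tripleP φ x)) :=
  dslope_eq_of_eq_mul ((eventually_isRegular_axisCurve_const h _).mono fun _ hs => frakP_eq h hs hl)
    (differentiableAt_realEval_hatLoop h hl _) (frakP_eq h hreg hl)

theorem hatQ_eq {φ t : ℝ} {x : Param ρ} (h : π / 2 - φ ∈ Set.Ioo 0 π)
    (hreg : IsRegular t (segmentPotential (axisCurve h) (tripleQ φ x))) {l : ℂ} (hl : ‖l‖ = 1) :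
    hatQ φ t x l = realEval l hl (hatLoop h t (tripleQ φ x)) :=
  dslope_eq_of_eq_mul ((eventually_isRegular_axisCurve_const h _).mono fun _ hs => frakQ_eq h hs hl)
    (differentiableAt_realEval_hatLoop h hl _) (frakQ_eq h hreg hl)

end HatLoops

section LoopOperators

open scoped W Real

variable {ρ : ℝ} [Fact (1 < ρ)]

theorem W.norm_le_of_norm_coeff_le {f g : W ρ} (h : ∀ k, ‖f.coeff k‖ ≤ ‖g.coeff k‖) : ‖f‖ ≤ ‖g‖ :=
  f.summable.tsum_le_tsum
    (fun k => mul_le_mul_of_nonneg_right (h k) (W.weight_pos k).le) g.summable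

/-! ### Real Fourier coefficients -/

/-- The `k`-th Fourier coefficient of a loop with real coefficients, as a real number. -/
def realCoeff (k : ℤ) : realLoops ρ →L[ℝ] ℝ :=
  Complex.reCLM.comp (((W.coeffL k).restrictScalars ℝ).comp (realLoops ρ).toSubmodule.subtypeL)

theorem coe_realCoeff (k : ℤ) (f : realLoops ρ) : (realCoeff k f : ℂ) = (f : W ρ).coeff k :=
  Complex.conj_eq_iff_re.1 (f.2 k)

theorem realCoeff_of_coeff_eq {k : ℤ} {f : realLoops ρ} {c : ℝ} (h : (f : W ρ).coeff k = c) :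
    realCoeff k f = c :=
  Complex.ofReal_injective ((coe_realCoeff k f).trans h)

theorem realLoops_ext {f g : realLoops ρ} (h : ∀ k, realCoeff k f = realCoeff k g) : f = g :=
  Subtype.ext <| W.ext_coeff fun k => by rw [← coe_realCoeff, h, coe_realCoeff]

theorem norm_realCoeff_le (k : ℤ) :
    ‖(realCoeff k : realLoops ρ →L[ℝ] ℝ)‖ ≤ (ρ ^ k.natAbs)⁻¹ := by
  refine ContinuousLinearMap.opNorm_le_bound _ (inv_nonneg.2 (W.weight_pos k).le) fun f => ?_
  rw [← Complex.norm_real, coe_realCoeff, inv_mul_eq_div, le_div_iff₀ (W.weight_pos k)]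
  exact (f : W ρ).norm_coeff_mul_weight_le k

theorem realCoeff_realMono (n : ℤ) (c : ℝ) (k : ℤ) :
    realCoeff k (realMono n c : realLoops ρ) = if k = n then c else 0 :=
  realCoeff_of_coeff_eq <| by
    rw [apply_ite (Complex.ofReal), Complex.ofReal_zero]
    exact W.coeff_mono n c k

theorem realCoeff_realMono_mul (n : ℤ) (c : ℝ) (f : realLoops ρ) (k : ℤ) :
    realCoeff k (realMono n c * f) = c * realCoeff (k - n) f :=
  realCoeff_of_coeff_eq <| by
    rw [Complex.ofReal_mul, coe_realCoeff]
    exact W.coeff_mono_mul n c (f : W ρ) k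

theorem realMono_zero_one : (realMono 0 1 : realLoops ρ) = 1 :=
  Subtype.ext <| congrArg (W.mono 0) Complex.ofReal_one

theorem realMono_mul_realMono (m n : ℤ) (c d : ℝ) :
    (realMono m c * realMono n d : realLoops ρ) = realMono (m + n) (c * d) :=
  Subtype.ext <| (W.mono_mul_mono m n c d).trans (by rw [← Complex.ofReal_mul]; rfl)

theorem smul_realMono (c : ℝ) (n : ℤ) (d : ℝ) :
    (c • realMono n d : realLoops ρ) = realMono n (c * d) :=
  realLoops_ext fun k => by
    rw [map_smul, realCoeff_realMono, realCoeff_realMono, smul_ite, smul_eq_mul, smul_zero]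

theorem realLoops_ext_realEval {f g : realLoops ρ}
    (h : ∀ (l : ℂ) (hl : ‖l‖ = 1), realEval l hl f = realEval l hl g) : f = g :=
  Subtype.ext (W.ext_eval h)

/-! ### Toeplitz operators on the loops with nonnegative frequencies -/

theorem realCoeff_plusIncl_of_neg (u : WRplus ρ) {k : ℤ} (hk : k < 0) :
    realCoeff k (plusIncl u) = 0 :=
  realCoeff_of_coeff_eq (u.2.1 k hk)

theorem WRplus_ext {u v : WRplus ρ}
    (h : ∀ k : ℕ, realCoeff k (plusIncl u) = realCoeff k (plusIncl v)) : u = v := by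
  suffices plusIncl u = plusIncl v from Subtype.ext
    (congrArg (Subtype.val : realLoops ρ → W ρ) this)
  refine realLoops_ext fun k => ?_
  obtain hk | hk := lt_or_ge k 0
  · rw [realCoeff_plusIncl_of_neg u hk, realCoeff_plusIncl_of_neg v hk]
  · lift k to ℕ using hk
    exact h k

theorem norm_truncation_le (f : W ρ) (k : ℤ) :
    ‖(Set.Ici (0 : ℤ)).indicator f.coeff k‖ ≤ ‖f.coeff k‖ :=
  norm_indicator_le_norm_self _ _

theorem summable_truncation (f : W ρ) :
    Summable fun k : ℤ => ‖(Set.Ici (0 : ℤ)).indicator f.coeff k‖ * ρ ^ k.natAbs :=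
  f.summable.of_nonneg_of_le (fun k => mul_nonneg (norm_nonneg _) (W.weight_pos k).le)
    fun k => mul_le_mul_of_nonneg_right (norm_truncation_le f k) (W.weight_pos k).le

/-- The truncation of a loop with real coefficients to its nonnegative frequencies. -/
def plusPart : realLoops ρ →L[ℝ] WRplus ρ :=
  LinearMap.mkContinuous
    { toFun f := ⟨W.ofCoeff _ (summable_truncation (f : W ρ)),
        fun _ hk => Set.indicator_of_notMem (by simpa using hk) _, fun k => by
          rw [W.coeff_ofCoeff, Set.indicator_apply]
          split_ifs
          · exact f.2 k
          · exact map_zero _⟩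
      map_add' _ _ := Subtype.ext <| W.ext_coeff <| congrFun <| Set.indicator_add _ _ _
      map_smul' c f := Subtype.ext <| W.ext_coeff <| congrFun <|
        Set.indicator_const_smul _ (c : ℂ) (f : W ρ).coeff }
    1 fun f => (W.norm_le_of_norm_coeff_le (f := W.ofCoeff _ (summable_truncation (f : W ρ)))
      (norm_truncation_le (f : W ρ))).trans_eq
      (one_mul _).symm

theorem realCoeff_plusPart (f : realLoops ρ) (k : ℕ) :
    realCoeff k (plusIncl (plusPart f)) = realCoeff k f :=
  realCoeff_of_coeff_eq <|
    (Set.indicator_of_mem (Set.mem_Ici.2 (Int.natCast_nonneg k)) _).trans (coe_realCoeff _ _).symm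

theorem plusPart_plusIncl (u : WRplus ρ) : plusPart (plusIncl u) = u :=
  WRplus_ext (realCoeff_plusPart (plusIncl u))

variable (ρ) in
/-- The subalgebra of the loops with real coefficients and nonnegative frequencies. It has the
same elements as `WRplus ρ`, which is not known to be closed under products by its definition as
a submodule. -/
def plusSubalgebra : Subalgebra ℝ (realLoops ρ) where
  carrier := {f | ∀ k < 0, (f : W ρ).coeff k = 0}
  mul_mem' {f g} hf hg n hn := by
    rw [Subalgebra.coe_mul, W.coeff_mul]
    refine (tsum_congr fun k => ?_).trans tsum_zero
    obtain hk | hk := lt_or_ge k 0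
    · rw [hf k hk, zero_mul]
    · rw [hg (n - k) (by lia), mul_zero]
  add_mem' {f g} hf hg k hk := by
    rw [Subalgebra.coe_add, W.coeff_add, hf k hk, hg k hk, add_zero]
  algebraMap_mem' r k hk := by
    rw [Algebra.algebraMap_eq_smul_one, ← realMono_zero_one, smul_realMono]
    exact (W.coeff_mono 0 _ k).trans (if_neg hk.ne)

theorem plusIncl_mem_plusSubalgebra (u : WRplus ρ) : plusIncl u ∈ plusSubalgebra ρ := u.2.1

theorem realMono_mem_plusSubalgebra (n : ℕ) (c : ℝ) : realMono n c ∈ plusSubalgebra ρ :=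
  fun k hk => (W.coeff_mono n c k).trans (if_neg (by lia))

theorem plusIncl_plusPart {f : realLoops ρ} (hf : f ∈ plusSubalgebra ρ) :
    plusIncl (plusPart f) = f :=
  realLoops_ext fun k => by
    obtain hk | hk := lt_or_ge k 0
    · rw [realCoeff_plusIncl_of_neg _ hk, realCoeff_of_coeff_eq (c := 0) (hf k hk)]
    · lift k to ℕ using hk
      exact realCoeff_plusPart f k

/-- The monomial `λ^n` as an element of `𝒲_{ℝ,ρ}^{≥0}`. -/
def plusMono (n : ℕ) : WRplus ρ := plusPart (realMono n 1)

theorem plusIncl_plusMono (n : ℕ) : plusIncl (plusMono n : WRplus ρ) = realMono n 1 :=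
  plusIncl_plusPart (realMono_mem_plusSubalgebra n 1)

theorem realCoeff_plusMono (n k : ℕ) :
    realCoeff k (plusIncl (plusMono n : WRplus ρ)) = if k = n then 1 else 0 := by
  rw [plusIncl_plusMono, realCoeff_realMono]
  exact if_congr Nat.cast_inj rfl rfl

/-- The Toeplitz operator `u ↦ (f u)_+` with symbol `f`. -/
def toeplitz (f : realLoops ρ) : WRplus ρ →L[ℝ] WRplus ρ :=
  plusPart.comp ((ContinuousLinearMap.mul ℝ (realLoops ρ) f).comp plusIncl)

theorem toeplitz_apply (f : realLoops ρ) (u : WRplus ρ) :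
    toeplitz f u = plusPart (f * plusIncl u) := rfl

theorem toeplitz_add (f g : realLoops ρ) : toeplitz (f + g) = toeplitz f + toeplitz g := by
  ext1 u
  rw [add_apply, toeplitz_apply, toeplitz_apply, toeplitz_apply, add_mul, map_add]

theorem toeplitz_sub (f g : realLoops ρ) : toeplitz (f - g) = toeplitz f - toeplitz g := by
  ext1 u
  rw [sub_apply, toeplitz_apply, toeplitz_apply, toeplitz_apply, sub_mul, map_sub]

theorem toeplitz_one (u : WRplus ρ) : toeplitz 1 u = u := by
  rw [toeplitz_apply, one_mul, plusPart_plusIncl]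

theorem realCoeff_toeplitz_realMono (n : ℤ) (c : ℝ) (u : WRplus ρ) (k : ℕ) :
    realCoeff k (plusIncl (toeplitz (realMono n c) u)) = c * realCoeff (k - n) (plusIncl u) := by
  rw [toeplitz_apply, realCoeff_plusPart, realCoeff_realMono_mul]

theorem toeplitz_realMono_neg_toeplitz_realMono (n : ℕ) (u : WRplus ρ) :
    toeplitz (realMono (-n) 1) (toeplitz (realMono n 1) u) = u :=
  WRplus_ext fun k => by
    have h := realCoeff_toeplitz_realMono n 1 u (k + n)
    rw [realCoeff_toeplitz_realMono, sub_neg_eq_add, one_mul]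
    rwa [one_mul, Nat.cast_add, add_sub_cancel_right] at h

theorem norm_toeplitz_realMono_neg_le (n : ℕ) :
    ‖toeplitz (realMono (-n) 1 : realLoops ρ)‖ ≤ (ρ ^ n)⁻¹ := by
  have hρ : 0 < ρ ^ n := W.weight_pos n
  refine ContinuousLinearMap.opNorm_le_bound _ (inv_nonneg.2 hρ.le) fun u => ?_
  set v := toeplitz (realMono (-n) 1) u
  have hterm (k : ℤ) : ‖(v : W ρ).coeff k‖ * ρ ^ k.natAbs * ρ ^ n ≤
      ‖(u : W ρ).coeff (k + n)‖ * ρ ^ (k + n).natAbs := by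
    obtain hk | hk := lt_or_ge k 0
    · rw [v.2.1 k hk, norm_zero, zero_mul, zero_mul]
      exact W.term_nonneg (u : W ρ) _
    · lift k to ℕ using hk
      have hcoeff : realCoeff k (plusIncl v) = realCoeff (k + n) (plusIncl u) := by
        rw [realCoeff_toeplitz_realMono, one_mul, sub_neg_eq_add]
      rw [← coe_plusIncl v, ← coe_plusIncl u, ← coe_realCoeff, ← coe_realCoeff, hcoeff, mul_assoc,
        ← pow_add]
      exact le_rfl
  rw [inv_mul_eq_div, le_div_iff₀ hρ]
  calc ‖v‖ * ρ ^ n = ∑' k : ℤ, ‖(v : W ρ).coeff k‖ * ρ ^ k.natAbs * ρ ^ n := tsum_mul_right.symm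
    _ ≤ ∑' k : ℤ, ‖(u : W ρ).coeff (k + n)‖ * ρ ^ (k + n).natAbs :=
        ((v : W ρ).summable.mul_right _).tsum_le_tsum hterm
          ((Equiv.addRight (n : ℤ)).summable_iff.2 (u : W ρ).summable)
    _ = ‖u‖ := (Equiv.addRight (n : ℤ)).tsum_eq fun k => ‖(u : W ρ).coeff k‖ * ρ ^ k.natAbs

theorem bijective_one_sub_toeplitz_realMono_neg_two :
    Function.Bijective (1 - toeplitz (realMono (-2) 1) : WRplus ρ →L[ℝ] WRplus ρ) := by
  refine ContinuousLinearMap.isUnit_iff_bijective.1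
    (isUnit_one_sub_of_norm_lt_one (R := WRplus ρ →L[ℝ] WRplus ρ) ?_)
  exact (norm_toeplitz_realMono_neg_le 2).trans_lt
    (inv_lt_one_of_one_lt₀ (one_lt_pow₀ Fact.out two_ne_zero))

theorem toeplitz_realMono_neg_plusMono {n k : ℕ} (h : k < n) :
    toeplitz (realMono (-n) 1 : realLoops ρ) (plusMono k) = 0 :=
  WRplus_ext fun j => by
    rw [realCoeff_toeplitz_realMono, plusIncl_plusMono, realCoeff_realMono, if_neg (by lia),
      mul_zero, map_zero, map_zero]

theorem eq_of_toeplitz_realMono_neg_two_eq_zero {u : WRplus ρ}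
    (h : toeplitz (realMono (-2) 1) u = 0) :
    u = realCoeff 0 (plusIncl u) • plusMono 0 + realCoeff 1 (plusIncl u) • plusMono 1 :=
  WRplus_ext fun k => by
    simp only [map_add, map_smul, smul_eq_mul, realCoeff_plusMono]
    obtain _ | _ | k := k
    · simp
    · simp
    · have hk := realCoeff_toeplitz_realMono (-2) 1 u k
      rw [h, map_zero, map_zero, one_mul, sub_neg_eq_add] at hk
      rw [if_neg (by lia), if_neg (by lia), mul_zero, mul_zero, add_zero]
      exact hk.symm

/-- The map `(v, α, β) ↦ (1 - λ²) v + α + β λ`, which is inverted by division with remainder. -/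
def unitCircleDivision (p : WRplus ρ × ℝ × ℝ) : WRplus ρ :=
  toeplitz (1 - realMono 2 1) p.1 + p.2.1 • plusMono 0 + p.2.2 • plusMono 1

theorem toeplitz_realMono_neg_two_unitCircleDivision (p : WRplus ρ × ℝ × ℝ) :
    toeplitz (realMono (-2) 1) (unitCircleDivision p) =
      -(1 - toeplitz (realMono (-2) 1)) p.1 := by
  have h0 := toeplitz_realMono_neg_plusMono (ρ := ρ) (zero_lt_two' ℕ)
  have h1 := toeplitz_realMono_neg_plusMono (ρ := ρ) one_lt_two
  have h2 := toeplitz_realMono_neg_toeplitz_realMono 2 p.1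
  push_cast at h0 h1 h2
  rw [unitCircleDivision, map_add, map_add, map_smul, map_smul, h0, h1, smul_zero, smul_zero,
    add_zero, add_zero, toeplitz_sub, sub_apply, toeplitz_one, map_sub, h2, sub_apply,
    one_apply_eq_self, neg_sub]

theorem unitCircleDivision_injective : Function.Injective (unitCircleDivision (ρ := ρ)) := by
  rintro ⟨v, α, β⟩ ⟨v', α', β'⟩ h
  have hv := congrArg (toeplitz (realMono (-2) 1)) h
  rw [toeplitz_realMono_neg_two_unitCircleDivision,
    toeplitz_realMono_neg_two_unitCircleDivision, neg_inj] at hv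
  obtain rfl : v = v' := bijective_one_sub_toeplitz_realMono_neg_two.injective hv
  simp only [unitCircleDivision, add_assoc, add_right_inj] at h
  have hcoeff (k : ℕ) := congrArg (fun u => realCoeff k (plusIncl u)) h
  simp only [map_add, map_smul, smul_eq_mul, realCoeff_plusMono] at hcoeff
  obtain rfl : α = α' := by simpa using hcoeff 0
  obtain rfl : β = β' := by simpa using hcoeff 1
  rfl

theorem unitCircleDivision_surjective : Function.Surjective (unitCircleDivision (ρ := ρ)) := by
  intro w
  obtain ⟨v, hv⟩ := bijective_one_sub_toeplitz_realMono_neg_two.surjective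
    (-toeplitz (realMono (-2) 1) w)
  have hrem : toeplitz (realMono (-2) 1) (w - unitCircleDivision (v, 0, 0)) = 0 := by
    rw [map_sub, toeplitz_realMono_neg_two_unitCircleDivision, hv, neg_neg, sub_self]
  obtain ⟨α, β, hw⟩ : ∃ α β : ℝ,
      w - unitCircleDivision (v, 0, 0) = α • plusMono 0 + β • plusMono 1 :=
    ⟨_, _, eq_of_toeplitz_realMono_neg_two_eq_zero hrem⟩
  refine ⟨(v, α, β), ?_⟩
  rw [sub_eq_iff_eq_add.1 hw, unitCircleDivision, unitCircleDivision]
  module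

/-! ### Reflection and evaluation on the circle -/

theorem summable_reflection (f : W ρ) :
    Summable fun k : ℤ => ‖f.coeff (-k)‖ * ρ ^ k.natAbs :=
  ((Equiv.neg ℤ).summable_iff.2 f.summable).congr fun k => by
    rw [Function.comp_apply, Equiv.neg_apply, Int.natAbs_neg]

theorem norm_reflection (f : W ρ) : ‖W.ofCoeff _ (summable_reflection f)‖ = ‖f‖ := by
  rw [W.norm_def, W.norm_def, ← (Equiv.neg ℤ).tsum_eq]
  exact tsum_congr fun k => by rw [W.coeff_ofCoeff, Equiv.neg_apply, neg_neg, Int.natAbs_neg]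

/-- The involution `h(λ) ↦ h(λ⁻¹)`. -/
def rev : realLoops ρ →L[ℝ] realLoops ρ :=
  LinearMap.mkContinuous
    { toFun f := ⟨W.ofCoeff _ (summable_reflection (f : W ρ)), fun k => f.2 (-k)⟩
      map_add' _ _ := rfl
      map_smul' _ _ := rfl }
    1 fun f => ((norm_reflection (f : W ρ)).trans (one_mul _).symm).le

theorem realCoeff_rev (f : realLoops ρ) (k : ℤ) : realCoeff k (rev f) = realCoeff (-k) f := rfl

theorem conj_realEval (f : realLoops ρ) {l : ℂ} (hl : ‖l‖ = 1) :
    starRingEnd ℂ (realEval l hl f) = realEval l hl (rev f) := by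
  rw [realEval_apply, realEval_apply, W.eval, W.eval, Complex.conj_tsum, ← (Equiv.neg ℤ).tsum_eq]
  refine tsum_congr fun k => ?_
  rw [map_mul, f.2, map_zpow₀, ← Complex.inv_eq_conj hl, Equiv.neg_apply, inv_zpow', neg_neg]
  rfl

theorem rev_eq_self_iff {f : realLoops ρ} :
    rev f = f ↔ ∀ l (hl : ‖l‖ = 1), starRingEnd ℂ (realEval l hl f) = realEval l hl f := by
  simp only [conj_realEval]
  exact ⟨fun h l hl => by rw [h], realLoops_ext_realEval⟩

theorem summable_pow_mul_inv_weight (n : ℕ) :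
    Summable fun k : ℤ => (k.natAbs : ℝ) ^ n * (ρ ^ k.natAbs)⁻¹ := by
  have hρ : 1 < ρ := Fact.out
  have h : Summable fun k : ℕ => (k : ℝ) ^ n * ρ⁻¹ ^ k :=
    summable_pow_mul_geometric_of_norm_lt_one n <| by
      rw [norm_inv, Real.norm_of_nonneg (one_pos.trans hρ).le]
      exact inv_lt_one_of_one_lt₀ hρ
  refine .of_nat_of_neg ?_ ?_ <;>
    simpa only [Int.natAbs_neg, Int.natAbs_natCast, inv_pow] using h

theorem norm_iteratedFDeriv_cos_smul_le {F : Type*} [NormedAddCommGroup F] [NormedSpace ℝ F]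
    (k : ℤ) (v : F) (n : ℕ) (θ : ℝ) :
    ‖iteratedFDeriv ℝ n (fun θ : ℝ => Real.cos (k * θ) • v) θ‖ ≤ (k.natAbs : ℝ) ^ n * ‖v‖ := by
  have hcos : ContDiff ℝ n fun θ : ℝ => Real.cos (k * θ) := by fun_prop
  calc _ ≤ ‖ContinuousLinearMap.toSpanSingleton ℝ v‖ *
        ‖iteratedFDeriv ℝ n (fun θ : ℝ => Real.cos (k * θ)) θ‖ :=
        (ContinuousLinearMap.toSpanSingleton ℝ v).norm_iteratedFDeriv_comp_left
          hcos.contDiffAt le_rfl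
    _ ≤ ‖v‖ * (k.natAbs : ℝ) ^ n := by
        rw [ContinuousLinearMap.norm_toSpanSingleton, norm_iteratedFDeriv_eq_norm_iteratedDeriv,
          iteratedDeriv_comp_const_mul Real.contDiff_cos, norm_mul, norm_pow, Nat.cast_natAbs,
          Int.cast_abs, Real.norm_eq_abs]
        gcongr
        exact mul_le_of_le_one_right (by positivity) (Real.abs_iteratedDeriv_cos_le_one n _)
    _ = _ := mul_comm _ _

theorem summable_cos_smul {F : Type*} [NormedAddCommGroup F] [NormedSpace ℝ F] [CompleteSpace F]
    {v : ℤ → F} (hv : ∀ k, ‖v k‖ ≤ (ρ ^ k.natAbs)⁻¹) (θ : ℝ) :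
    Summable fun k : ℤ => Real.cos (k * θ) • v k := by
  refine .of_norm_bounded (summable_pow_mul_inv_weight (ρ := ρ) 0) fun k => ?_
  rw [norm_smul, pow_zero]
  exact mul_le_mul (Real.abs_cos_le_one _) (hv k) (norm_nonneg _) zero_le_one

theorem contDiff_tsum_cos_smul {F : Type*} [NormedAddCommGroup F] [NormedSpace ℝ F]
    [CompleteSpace F] {v : ℤ → F} (hv : ∀ k, ‖v k‖ ≤ (ρ ^ k.natAbs)⁻¹) {n : ℕ∞} :
    ContDiff ℝ n fun θ : ℝ => ∑' k : ℤ, Real.cos (k * θ) • v k :=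
  contDiff_tsum (fun k => by fun_prop) (fun n _ => summable_pow_mul_inv_weight (ρ := ρ) n)
    fun n k θ _ => (norm_iteratedFDeriv_cos_smul_le k (v k) n θ).trans
      (mul_le_mul_of_nonneg_left (hv k) (by positivity))

theorem norm_exp_I_mul (θ : ℝ) : ‖Complex.exp (Complex.I * θ)‖ = 1 := by
  rw [mul_comm, Complex.norm_exp_ofReal_mul_I]

/-- The functional `h ↦ Re h(e^{iθ})`. -/
def circleValue (θ : ℝ) : realLoops ρ →L[ℝ] ℝ :=
  Complex.reCLM.comp
    (realEval (Complex.exp (Complex.I * θ)) (norm_exp_I_mul θ)).toContinuousLinearMap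

theorem circleValue_apply (θ : ℝ) (f : realLoops ρ) :
    circleValue θ f = (realEval (Complex.exp (Complex.I * θ)) (norm_exp_I_mul θ) f).re := rfl

theorem circleValue_eq_zero_iff {θ : ℝ} {f : realLoops ρ} (h : rev f = f) :
    circleValue θ f = 0 ↔ realEval (Complex.exp (Complex.I * θ)) (norm_exp_I_mul θ) f = 0 := by
  have hreal := Complex.conj_eq_iff_re.1 (rev_eq_self_iff.1 h _ (norm_exp_I_mul θ))
  rw [circleValue_apply, ← Complex.ofReal_eq_zero, hreal]

theorem exp_I_mul_zpow_re (θ : ℝ) (n : ℤ) :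
    (Complex.exp (Complex.I * θ) ^ n).re = Real.cos (n * θ) := by
  rw [← Complex.exp_int_mul, ← Complex.exp_ofReal_mul_I_re]
  push_cast
  ring_nf

theorem circleValue_realMono (θ : ℝ) (n : ℤ) (c : ℝ) :
    circleValue θ (realMono n c : realLoops ρ) = c * Real.cos (n * θ) := by
  rw [circleValue_apply, realEval_apply, ← exp_I_mul_zpow_re, ← Complex.re_ofReal_mul]
  exact congrArg Complex.re (W.eval_mono n c _)

theorem circleValue_eq_tsum (θ : ℝ) :
    circleValue θ = ∑' k : ℤ, Real.cos (k * θ) • (realCoeff k : realLoops ρ →L[ℝ] ℝ) := by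
  have hs : Summable fun k : ℤ => Real.cos (k * θ) • (realCoeff k : realLoops ρ →L[ℝ] ℝ) :=
    summable_cos_smul (F := realLoops ρ →L[ℝ] ℝ) (v := realCoeff) norm_realCoeff_le θ
  ext f
  refine Eq.trans ?_ ((ContinuousLinearMap.apply ℝ ℝ f).map_tsum hs).symm
  rw [circleValue_apply, realEval_apply, W.eval,
    Complex.re_tsum ((f : W ρ).summable_eval (norm_exp_I_mul θ))]
  refine tsum_congr fun k => ?_
  rw [← coe_realCoeff, Complex.re_ofReal_mul, exp_I_mul_zpow_re, mul_comm]
  rfl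

theorem contDiff_circleValue {n : ℕ∞} :
    ContDiff ℝ n fun θ => (circleValue θ : realLoops ρ →L[ℝ] ℝ) := by
  simp only [circleValue_eq_tsum]
  exact contDiff_tsum_cos_smul (F := realLoops ρ →L[ℝ] ℝ) (v := realCoeff) norm_realCoeff_le

/-! ### The boundary operator -/

/-- The operator whose components of positive frequency measure the failure of `h = h*` on the
circle, and whose constant component is `Re h(e^{iθ})`. -/
def boundaryOp (θ : ℝ) : realLoops ρ →L[ℝ] WRplus ρ :=
  plusPart.comp (.id ℝ _ - rev) + (circleValue θ).smulRight (plusMono 0)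

theorem contDiff_boundaryOp {n : ℕ∞} :
    ContDiff ℝ n fun θ => (boundaryOp θ : realLoops ρ →L[ℝ] WRplus ρ) :=
  contDiff_const.add <| ((ContinuousLinearMap.smulRightL ℝ (realLoops ρ) (WRplus ρ)).flip
    (plusMono 0)).contDiff.comp contDiff_circleValue

theorem boundaryOp_apply (θ : ℝ) (f : realLoops ρ) :
    boundaryOp θ f = plusPart (f - rev f) + circleValue θ f • plusMono 0 := rfl

theorem realCoeff_boundaryOp_zero (θ : ℝ) (f : realLoops ρ) :
    realCoeff 0 (plusIncl (boundaryOp θ f)) = circleValue θ f := by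
  have h := realCoeff_plusPart (f - rev f) 0
  have h' := realCoeff_plusMono (ρ := ρ) 0 0
  push_cast at h h'
  rw [boundaryOp_apply, map_add, map_add, map_smul, map_smul, h, map_sub, realCoeff_rev, neg_zero,
    sub_self, zero_add, h', smul_eq_mul, mul_one]

theorem realCoeff_boundaryOp_of_ne_zero (θ : ℝ) (f : realLoops ρ) {k : ℕ} (hk : k ≠ 0) :
    realCoeff k (plusIncl (boundaryOp θ f)) = realCoeff k f - realCoeff (-k) f := by
  rw [boundaryOp_apply, map_add, map_add, map_smul, map_smul, realCoeff_plusPart, map_sub,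
    realCoeff_rev, realCoeff_plusMono, if_neg hk, smul_zero, add_zero]

theorem boundaryOp_eq_zero_iff_rev {θ : ℝ} {f : realLoops ρ} :
    boundaryOp θ f = 0 ↔ rev f = f ∧ circleValue θ f = 0 := by
  refine ⟨fun h => ⟨realLoops_ext fun k => ?_, ?_⟩, fun ⟨hrev, hval⟩ => ?_⟩
  · have hnat (k : ℕ) : realCoeff k f = realCoeff (-k) f := by
      obtain rfl | hk := eq_or_ne k 0
      · simp
      · have := realCoeff_boundaryOp_of_ne_zero θ f hk
        rw [h, map_zero, map_zero] at this
        exact sub_eq_zero.1 this.symm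
    obtain ⟨k, rfl | rfl⟩ := k.eq_nat_or_neg
    · exact (hnat k).symm
    · rw [realCoeff_rev, neg_neg, hnat]
  · rw [← realCoeff_boundaryOp_zero, h, map_zero, map_zero]
  · rw [boundaryOp_apply, hrev, hval, sub_self, map_zero, zero_smul, add_zero]

theorem boundaryOp_eq_zero_iff {θ : ℝ} {f : realLoops ρ} :
    boundaryOp θ f = 0 ↔
      (∀ l (hl : ‖l‖ = 1), starRingEnd ℂ (realEval l hl f) = realEval l hl f) ∧
        realEval (Complex.exp (Complex.I * θ)) (norm_exp_I_mul θ) f = 0 := by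
  rw [boundaryOp_eq_zero_iff_rev, ← rev_eq_self_iff]
  exact and_congr_right circleValue_eq_zero_iff

theorem boundaryOp_plusIncl (θ : ℝ) (u : WRplus ρ) :
    boundaryOp θ (plusIncl u) =
      u + (circleValue θ (plusIncl u) - realCoeff 0 (plusIncl u)) • plusMono 0 := by
  refine WRplus_ext fun k => ?_
  obtain rfl | hk := eq_or_ne k 0
  · have h := realCoeff_plusMono (ρ := ρ) 0 0
    rw [Nat.cast_zero] at h ⊢
    rw [realCoeff_boundaryOp_zero, map_add, map_add, map_smul, map_smul, h, if_pos rfl,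
      smul_eq_mul, mul_one, add_sub_cancel]
  · have hk' : -(k : ℤ) < 0 := by lia
    rw [realCoeff_boundaryOp_of_ne_zero θ _ hk, map_add, map_add, map_smul, map_smul,
      realCoeff_plusMono, if_neg hk, realCoeff_plusIncl_of_neg u hk',
      sub_zero, smul_zero, add_zero]

theorem circleValue_plusMono_zero (θ : ℝ) :
    circleValue θ (plusIncl (plusMono 0) : realLoops ρ) = 1 := by
  rw [plusIncl_plusMono, Nat.cast_zero, circleValue_realMono, Int.cast_zero, zero_mul,
    Real.cos_zero, mul_one]

theorem boundaryOp_plusMono_zero (θ : ℝ) :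
    boundaryOp θ (plusIncl (plusMono 0)) = (plusMono 0 : WRplus ρ) := by
  have h := realCoeff_plusMono (ρ := ρ) 0 0
  rw [Nat.cast_zero, if_pos rfl] at h
  rw [boundaryOp_plusIncl, circleValue_plusMono_zero, h, sub_self, zero_smul, add_zero]

theorem bijective_boundaryOp_plusIncl (θ : ℝ) :
    Function.Bijective fun u : WRplus ρ => boundaryOp θ (plusIncl u) := by
  refine Function.bijective_iff_has_inverse.2
    ⟨fun w => w + (realCoeff 0 (plusIncl w) - circleValue θ (plusIncl w)) • plusMono 0,
      fun u => ?_, fun w => ?_⟩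
  · have hval := realCoeff_boundaryOp_zero θ (plusIncl u)
    have hcirc := congrArg (fun f => circleValue θ (plusIncl f)) (boundaryOp_plusIncl θ u)
    simp only [map_add, map_smul, circleValue_plusMono_zero, smul_eq_mul] at hcirc
    simp only [hval, hcirc]
    rw [boundaryOp_plusIncl]
    module
  · simp only [map_add, map_smul, boundaryOp_plusMono_zero]
    rw [boundaryOp_plusIncl]
    module

theorem boundaryOp_realMono_neg_one_add_realMono_one (θ κ : ℝ) :
    boundaryOp θ (realMono (-1) κ + realMono 1 κ : realLoops ρ) =
      (2 * κ * Real.cos θ) • plusMono 0 := by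
  have hrev : rev (realMono (-1) κ + realMono 1 κ : realLoops ρ) =
      realMono (-1) κ + realMono 1 κ := realLoops_ext fun k => by
    simp only [realCoeff_rev, map_add, realCoeff_realMono, neg_eq_iff_eq_neg]
    exact add_comm _ _
  rw [boundaryOp_apply, hrev, sub_self, map_zero, zero_add, map_add, circleValue_realMono,
    circleValue_realMono, Int.cast_neg, Int.cast_one, neg_one_mul, Real.cos_neg, one_mul,
    ← two_mul, mul_assoc]

theorem boundaryOp_pi_div_two_realMono_neg_two_sub_realMono_two (κ : ℝ) :
    boundaryOp (π / 2) (realMono (-2) κ - realMono 2 κ : realLoops ρ) =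
      (-2 * κ) • plusMono 2 := by
  refine WRplus_ext fun k => ?_
  rw [map_smul, map_smul, realCoeff_plusMono]
  obtain rfl | hk := eq_or_ne k 0
  · rw [Nat.cast_zero, realCoeff_boundaryOp_zero, map_sub, circleValue_realMono,
      circleValue_realMono, Int.cast_neg, neg_mul, Real.cos_neg, sub_self, if_neg two_ne_zero.symm,
      smul_zero]
  · rw [realCoeff_boundaryOp_of_ne_zero _ _ hk]
    simp only [map_sub, realCoeff_realMono, smul_eq_mul]
    split_ifs <;> first | lia | ring

theorem boundaryOp_pi_div_two_plusMono_zero_add_plusMono_two :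
    boundaryOp (π / 2) (plusIncl (plusMono 0 + plusMono 2)) = (plusMono 2 : WRplus ρ) := by
  have hcoeff : realCoeff 0 (plusIncl (plusMono 0 + plusMono 2 : WRplus ρ)) = 1 := by
    have (k : ℕ) := realCoeff_plusMono (ρ := ρ) k 0
    rw [Nat.cast_zero] at this
    rw [map_add, map_add, this, this, if_pos rfl, if_neg two_ne_zero.symm, add_zero]
  have hval : circleValue (π / 2) (plusIncl (plusMono 0 + plusMono 2 : WRplus ρ)) = 0 := by
    rw [map_add, map_add, circleValue_plusMono_zero, plusIncl_plusMono, circleValue_realMono,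
      Nat.cast_ofNat, Int.cast_ofNat, mul_div_cancel₀ _ two_ne_zero, Real.cos_pi]
    norm_num
  rw [boundaryOp_plusIncl, hcoeff, hval]
  module

theorem toeplitz_realMono_plusMono (n k : ℕ) :
    toeplitz (realMono n 1 : realLoops ρ) (plusMono k) = plusMono (n + k) := by
  rw [toeplitz_apply, plusIncl_plusMono, realMono_mul_realMono, mul_one, ← Nat.cast_add]
  rfl

end LoopOperators

section Determinant

open Real (sin cos)
open scoped W Real

variable {ρ : ℝ} [Fact (1 < ρ)]

/-- The loop `λ (det (r A₁) + 1)`. -/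
def detLoop (φ : ℝ) (x : Param ρ) : realLoops ρ :=
  realMono 1 1 * (x.r ^ 2 • (loopA x ^ 2 - loopB φ x ^ 2 - loopC φ x ^ 2) + 1)

theorem realEval_detLoop (φ : ℝ) (x : Param ρ) {l : ℂ} (hl : ‖l‖ = 1) :
    realEval l hl (detLoop φ x) = l * (((x.r : ℂ) • A φ x l 0).det + 1) := by
  have hl' : realEval l hl (realMono 1 1 : realLoops ρ) = l := by
    rw [realEval_apply]
    exact (W.eval_mono 1 _ l).trans (by simp)
  simp only [detLoop, map_mul, map_add, map_sub, map_smul, map_pow, map_one, hl', realEval_apply,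
    coe_loopA, coe_loopB, coe_loopC, A, residueMatrix, Matrix.det_fin_two, Matrix.smul_apply,
    Matrix.of_apply, Matrix.cons_val', Matrix.cons_val_zero, Matrix.cons_val_one,
    Matrix.cons_val_fin_one, smul_eq_mul, Complex.real_smul, Complex.ofReal_pow]
  linear_combination (l * x.r ^ 2 * (((x.a).eval l) ^ 2 - ((x.c φ).eval l) ^ 2)) * Complex.I_sq

/-- The linear part `(1 - λ²) ã + (1 + λ²) (b̃ sin φ + c̃ cos φ)` of `detLoop` in `ã, b̃, c̃`. -/
def detLinear (φ : ℝ) : Param ρ →L[ℝ] realLoops ρ :=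
  (ContinuousLinearMap.mul ℝ (realLoops ρ) (1 - realMono 2 1)).comp (plusIncl.comp Param.aL) +
    (ContinuousLinearMap.mul ℝ (realLoops ρ) (1 + realMono 2 1)).comp
      (plusIncl.comp (sin φ • Param.bL + cos φ • Param.cL))

theorem realMono_half_add_self (n : ℤ) :
    (realMono n (1 / 2) + realMono n (1 / 2) : realLoops ρ) = realMono n 1 := by
  rw [← two_smul ℝ, smul_realMono, mul_one_div_cancel two_ne_zero]

theorem realMono_neg_one_add_realMono_one (s : ℝ) :
    (realMono (-1) (-(1 / 2) * s) + realMono 1 (-(1 / 2) * s) : realLoops ρ) =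
      -s • (realMono (-1) (1 / 2) + realMono 1 (1 / 2)) := by
  rw [smul_add, smul_realMono, smul_realMono, neg_mul_comm, mul_comm (1 / 2)]

theorem realMono_neg_one_mul_realMono_one :
    (realMono (-1) 1 * realMono 1 1 : realLoops ρ) = 1 := by
  rw [realMono_mul_realMono, mul_one, neg_add_cancel, realMono_zero_one]

theorem realMono_one_mul_self : (realMono 1 1 * realMono 1 1 : realLoops ρ) = realMono 2 1 := by
  rw [realMono_mul_realMono, mul_one, one_add_one_eq_two]

theorem detLoop_eq (φ : ℝ) (x : Param ρ) :
    detLoop φ x = x.r ^ 2 • (detLinear φ x + realMono 1 1 * (plusIncl (Param.aL x) ^ 2 -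
      plusIncl (Param.bL x) ^ 2 - plusIncl (Param.cL x) ^ 2)) + (1 - x.r ^ 2) • realMono 1 1 := by
  have hinv := realMono_neg_one_mul_realMono_one (ρ := ρ)
  have hsq := realMono_one_mul_self (ρ := ρ)
  have hsc : algebraMap ℝ (realLoops ρ) (sin φ) ^ 2 + algebraMap ℝ (realLoops ρ) (cos φ) ^ 2 =
      1 := by
    rw [← map_pow, ← map_pow, ← map_add, Real.sin_sq_add_cos_sq, map_one]
  have hm := realMono_half_add_self (ρ := ρ) (-1)
  have hl := realMono_half_add_self (ρ := ρ) 1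
  simp only [detLoop, loopA, loopB, loopC, realMono_neg_one_add_realMono_one, detLinear,
    add_apply, smul_apply, ContinuousLinearMap.comp_apply, ContinuousLinearMap.mul_apply']
  simp only [map_add, map_smul, Algebra.smul_def, map_neg, map_sub, map_one, map_pow, neg_mul]
  rw [← hm, ← hl] at hinv
  rw [← hsq, ← hl]
  generalize algebraMap ℝ (realLoops ρ) (sin φ) = s at *
  generalize algebraMap ℝ (realLoops ρ) (cos φ) = c at *
  generalize algebraMap ℝ (realLoops ρ) x.r = r
  generalize (realMono (-1) (1 / 2) : realLoops ρ) = m at *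
  generalize (realMono 1 (1 / 2) : realLoops ρ) = l at *
  linear_combination
    r ^ 2 * (plusIncl (Param.aL x) + s * plusIncl (Param.bL x) + c * plusIncl (Param.cL x) -
      (l + l)) * hinv - r ^ 2 * (l + l) * (m + l) ^ 2 * hsc

theorem detLoop_mem_plusSubalgebra (φ : ℝ) (x : Param ρ) : detLoop φ x ∈ plusSubalgebra ρ := by
  have hincl := plusIncl_mem_plusSubalgebra (ρ := ρ)
  have hmono := realMono_mem_plusSubalgebra (ρ := ρ)
  have h1 : realMono 1 1 ∈ plusSubalgebra ρ := hmono 1 1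
  have h2 : realMono 2 1 ∈ plusSubalgebra ρ := hmono 2 1
  rw [detLoop_eq]
  refine add_mem (Subalgebra.smul_mem _ (add_mem (add_mem (mul_mem (sub_mem (one_mem _) h2)
    (hincl _)) (mul_mem (add_mem (one_mem _) h2) (hincl _))) (mul_mem h1 ?_)) _)
    (Subalgebra.smul_mem _ h1 _)
  exact sub_mem (sub_mem (pow_mem (hincl _) 2) (pow_mem (hincl _) 2)) (pow_mem (hincl _) 2)

theorem plusPart_detLoop_eq_zero_iff {φ : ℝ} {x : Param ρ} :
    plusPart (detLoop φ x) = 0 ↔ ∀ l : ℂ, ‖l‖ = 1 → ((x.r : ℂ) • A φ x l 0).det = -1 := by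
  have hl0 {l : ℂ} (hl : ‖l‖ = 1) : l ≠ 0 := norm_ne_zero_iff.1 (hl ▸ one_ne_zero)
  constructor
  · intro h l hl
    have hloop : detLoop φ x = 0 := by
      rw [← plusIncl_plusPart (detLoop_mem_plusSubalgebra φ x), h, map_zero]
    have heval := realEval_detLoop φ x hl
    rw [hloop, map_zero, eq_comm, mul_eq_zero_iff_left (hl0 hl)] at heval
    exact eq_neg_of_add_eq_zero_left heval
  · intro h
    have hloop : detLoop φ x = 0 := realLoops_ext_realEval fun l hl => by
      rw [realEval_detLoop, h l hl, neg_add_cancel, mul_zero, map_zero]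
    rw [hloop, map_zero]

/-- The derivative of `plusPart (detLoop φ x)` at the central value of the parameters. -/
def detDeriv (φ : ℝ) : Param ρ →L[ℝ] WRplus ρ :=
  (toeplitz (1 - realMono 2 1)).comp Param.aL +
    (toeplitz (1 + realMono 2 1)).comp (sin φ • Param.bL + cos φ • Param.cL) -
    Param.rL.smulRight ((2 : ℝ) • plusMono 1)

section QuadraticPerturbation

variable {E R : Type*} [NormedAddCommGroup E] [NormedSpace ℝ E] [NormedCommRing R]
  [NormedAlgebra ℝ R] {x : E}

theorem hasStrictFDerivAt_sq_of_apply_eq_zero {L : E →L[ℝ] R} (h : L x = 0) :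
    HasStrictFDerivAt (fun y => L y ^ 2) (0 : E →L[ℝ] R) x := by
  refine (L.hasStrictFDerivAt.pow 2).congr_fderiv ?_
  ext v
  simp [h]

theorem hasStrictFDerivAt_smul_add_one_sub_smul {r : E →L[ℝ] ℝ} {D : E →L[ℝ] R} {q : E → R}
    (m : R) (hr : r x = 1) (hD : D x = 0) (hq : HasStrictFDerivAt q (0 : E →L[ℝ] R) x)
    (hq0 : q x = 0) :
    HasStrictFDerivAt (fun y => r y ^ 2 • (D y + m * q y) + (1 - r y ^ 2) • m)
      (D - r.smulRight ((2 : ℝ) • m)) x := by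
  have hr2 := r.hasStrictFDerivAt (x := x).pow 2
  refine ((hr2.smul (D.hasStrictFDerivAt.add (hq.const_mul m))).add
    ((hr2.const_sub 1).smul_const m)).congr_fderiv ?_
  ext v
  simp [hr, hD, hq0, smul_smul, mul_comm, sub_eq_add_neg]

end QuadraticPerturbation

theorem plusPart_detLinear (φ : ℝ) (v : Param ρ) :
    plusPart (detLinear φ v - Param.rL v • (2 : ℝ) • realMono 1 1) = detDeriv φ v := by
  rw [detLinear, add_apply, map_sub, map_add, map_smul, map_smul]
  rfl

theorem detLinear_center (φ : ℝ) : detLinear φ (Param.center ρ) = 0 := by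
  have ha : Param.aL (Param.center ρ) = 0 := rfl
  have hb : Param.bL (Param.center ρ) = 0 := rfl
  have hc : Param.cL (Param.center ρ) = 0 := rfl
  simp only [detLinear, add_apply, smul_apply, ContinuousLinearMap.comp_apply, ha, hb, hc,
    smul_zero, add_zero, map_zero]

theorem hasStrictFDerivAt_plusPart_detLoop (φ : ℝ) :
    HasStrictFDerivAt (fun x : Param ρ => plusPart (detLoop φ x)) (detDeriv φ)
      (Param.center ρ) := by
  have hzero {L : Param ρ →L[ℝ] WRplus ρ} (hL : L (Param.center ρ) = 0) :
      plusIncl.comp L (Param.center ρ) = 0 := by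
    rw [ContinuousLinearMap.comp_apply, hL, map_zero]
  have hq := ((hasStrictFDerivAt_sq_of_apply_eq_zero (hzero (L := Param.aL) rfl)).sub
    (hasStrictFDerivAt_sq_of_apply_eq_zero (hzero (L := Param.bL) rfl))).sub
    (hasStrictFDerivAt_sq_of_apply_eq_zero (hzero (L := Param.cL) rfl))
  rw [sub_zero, sub_zero] at hq
  have hloop := hasStrictFDerivAt_smul_add_one_sub_smul (r := Param.rL) (realMono 1 1) rfl
    (detLinear_center φ) hq (by
      simp only [Pi.sub_apply, hzero (L := Param.aL) rfl, hzero (L := Param.bL) rfl,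
        hzero (L := Param.cL) rfl, zero_pow two_ne_zero, sub_self])
  refine ((plusPart.hasStrictFDerivAt.comp _ hloop).congr_of_eventuallyEq
    (.of_forall fun x => ?_)).congr_fderiv ?_
  · exact congrArg plusPart (detLoop_eq φ x).symm
  · exact ContinuousLinearMap.ext fun v => plusPart_detLinear φ v

end Determinant

section MonodromySystem

open Real (sin cos)
open scoped W Real

variable {ρ : ℝ} [Fact (1 < ρ)]

/-- The boundary operator restricted to loops without negative powers of `λ`. -/
def boundaryPlus (θ : ℝ) : WRplus ρ →L[ℝ] WRplus ρ := (boundaryOp θ).comp plusIncl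

theorem contDiff_boundaryPlus :
    ContDiff ℝ 1 fun θ => (boundaryPlus θ : WRplus ρ →L[ℝ] WRplus ρ) :=
  contDiff_boundaryOp.clm_comp contDiff_const

theorem boundaryPlus_plusMono_zero (θ : ℝ) :
    boundaryPlus θ (plusMono 0) = (plusMono 0 : WRplus ρ) :=
  boundaryOp_plusMono_zero θ

theorem boundaryOp_smul_realMono_add_plusIncl (θ r s : ℝ) (u : WRplus ρ) :
    boundaryOp θ (r • (realMono (-1) (-(1 / 2) * s) + realMono 1 (-(1 / 2) * s) + plusIncl u)) =
      r • (-(s * cos θ) • plusMono 0 + boundaryPlus θ u) := by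
  have hcoef : 2 * (-(1 / 2) * s) * cos θ = -(s * cos θ) := by ring
  rw [map_smul, map_add, boundaryOp_realMono_neg_one_add_realMono_one, hcoef]
  rfl

theorem hasStrictFDerivAt_smul_cos_add_apply {E F V : Type*} [NormedAddCommGroup E]
    [NormedSpace ℝ E] [NormedAddCommGroup F] [NormedSpace ℝ F] [NormedAddCommGroup V]
    [NormedSpace ℝ V] {B : ℝ → V →L[ℝ] F} (hB : ContDiff ℝ 1 B) {r θ : E →L[ℝ] ℝ} {L : E →L[ℝ] V}
    (s : ℝ) (e : F) {x : E} (hr : r x = 1) (hθ : θ x = π / 2) (hL : L x = 0) :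
    HasStrictFDerivAt (fun y => r y • (-(s * cos (θ y)) • e + B (θ y) (L y)))
      ((B (π / 2)).comp L + s • θ.smulRight e) x := by
  have hB' : HasStrictFDerivAt (fun y => B (θ y)) _ x :=
    (hB.comp θ.contDiff).contDiffAt.hasStrictFDerivAt one_ne_zero
  have hcos := ((θ.hasStrictFDerivAt (x := x).cos.const_mul s).neg).smul_const e
  refine (r.hasStrictFDerivAt.smul
    (hcos.add (hB'.clm_apply L.hasStrictFDerivAt))).congr_fderiv ?_
  ext v
  simp [hr, hθ, hL, smul_smul, add_comm]

theorem hasStrictFDerivAt_boundaryOp_leading (s : ℝ) {L : Param ρ →L[ℝ] WRplus ρ}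
    (hL : L (Param.center ρ) = 0) :
    HasStrictFDerivAt (fun x : Param ρ => boundaryOp (Param.θL x)
      (x.r • (realMono (-1) (-(1 / 2) * s) + realMono 1 (-(1 / 2) * s) + plusIncl (L x))))
      ((boundaryPlus (π / 2)).comp (L + s • Param.θL.smulRight (plusMono 0)))
      (Param.center ρ) := by
  simp only [boundaryOp_smul_realMono_add_plusIncl]
  refine (hasStrictFDerivAt_smul_cos_add_apply contDiff_boundaryPlus (r := Param.rL) s
    (plusMono 0) rfl rfl hL).congr_fderiv (ContinuousLinearMap.ext fun v => ?_)
  simp only [add_apply, smul_apply, ContinuousLinearMap.comp_apply,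
    ContinuousLinearMap.smulRight_apply, map_add, map_smul, boundaryPlus_plusMono_zero]

/-- The boundary operator at `e^{iθ}` applied to `𝔭̂` or `𝔮̂`, for `T = tripleP φ` or
`T = tripleQ φ`. -/
def hatSystem {φ : ℝ} (h : φ ∈ Set.Ioo 0 π)
    (T : Param ρ → realLoops ρ × realLoops ρ × realLoops ρ) (q : ℝ × Param ρ) : WRplus ρ :=
  boundaryOp (Param.θL q.2) (hatLoop h q.1 (T q.2))

theorem hatSystem_eq {φ : ℝ} (h : φ ∈ Set.Ioo 0 π)
    (T : Param ρ → realLoops ρ × realLoops ρ × realLoops ρ) (q : ℝ × Param ρ) :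
    hatSystem h T q = (2 * π) • boundaryOp (Param.θL q.2) (T q.2).2.2 +
      q.1 • boundaryOp (Param.θL q.2) (hatRem (axisCurve h) q.1 (T q.2)) := by
  rw [hatSystem, hatLoop, map_add, map_smul, map_smul]

theorem hasStrictFDerivAt_smul_apply_add_smul_apply {E F V : Type*} [NormedAddCommGroup E]
    [NormedSpace ℝ E] [NormedAddCommGroup F] [NormedSpace ℝ F] [NormedAddCommGroup V]
    [NormedSpace ℝ V] {B : E → V →L[ℝ] F} {f : E → V} {g : ℝ × E → V} {f' : E →L[ℝ] F} {x : E}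
    (c : ℝ) (hf : HasStrictFDerivAt (fun y => B y (f y)) f' x) (hB : ContDiffAt ℝ 1 B x)
    (hg : ContDiffAt ℝ 1 g (0, x)) :
    HasStrictFDerivAt (fun q : ℝ × E => c • B q.2 (f q.2) + q.1 • B q.2 (g q))
      ((c • f').comp (.snd ℝ ℝ E) + (ContinuousLinearMap.fst ℝ ℝ E).smulRight (B x (g (0, x))))
      (0, x) := by
  have hf' : HasStrictFDerivAt (fun q : ℝ × E => B q.2 (f q.2)) (f'.comp (.snd ℝ ℝ E)) (0, x) :=
    HasStrictFDerivAt.comp (g := fun y => B y (f y)) (f := Prod.snd) ((0 : ℝ), x) hf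
      hasStrictFDerivAt_snd
  have hB' : ContDiffAt ℝ 1 (fun q : ℝ × E => B q.2) (0, x) :=
    ContDiffAt.comp (g := B) (f := Prod.snd) ((0 : ℝ), x) hB contDiffAt_snd
  refine ((hf'.const_smul c).add (hasStrictFDerivAt_fst.smul
    ((hB'.clm_apply hg).hasStrictFDerivAt one_ne_zero))).congr_fderiv ?_
  ext v <;> simp

theorem contDiffAt_hatRem_comp {φ : ℝ} (h : φ ∈ Set.Ioo 0 π)
    {T : Param ρ → realLoops ρ × realLoops ρ × realLoops ρ} (hT : ContDiff ℝ 1 T) (x : Param ρ) :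
    ContDiffAt ℝ 1 (fun q : ℝ × Param ρ => hatRem (axisCurve h) q.1 (T q.2)) (0, x) :=
  ContDiffAt.comp (0, x) (contDiffAt_hatRem (axisCurve h) (T x))
    ((contDiff_fst.prodMk (hT.comp contDiff_snd)).contDiffAt)

theorem hasStrictFDerivAt_hatSystem {φ : ℝ} (h : φ ∈ Set.Ioo 0 π)
    {T : Param ρ → realLoops ρ × realLoops ρ × realLoops ρ} (hT : ContDiff ℝ 1 T)
    {x : Param ρ} {D : Param ρ →L[ℝ] WRplus ρ}
    (hD : HasStrictFDerivAt (fun x => boundaryOp (Param.θL x) (T x).2.2) D x) :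
    HasStrictFDerivAt (hatSystem h T)
      (((2 * π) • D).comp (.snd ℝ ℝ (Param ρ)) +
        (ContinuousLinearMap.fst ℝ ℝ (Param ρ)).smulRight
          (boundaryOp (Param.θL x) (hatRem (axisCurve h) 0 (T x)))) (0, x) := by
  have hB : ContDiffAt ℝ 1
      (fun y : Param ρ => (boundaryOp (Param.θL y) : realLoops ρ →L[ℝ] WRplus ρ)) x :=
    ((contDiff_boundaryOp (ρ := ρ)).comp Param.θL.contDiff).contDiffAt
  exact (hasStrictFDerivAt_smul_apply_add_smul_apply
    (B := fun y : Param ρ => (boundaryOp (Param.θL y) : realLoops ρ →L[ℝ] WRplus ρ))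
    (f := fun y => (T y).2.2) (g := fun q => hatRem (axisCurve h) q.1 (T q.2)) (2 * π) hD hB
    (contDiffAt_hatRem_comp h hT x)).congr_of_eventuallyEq
    (.of_forall fun q => (hatSystem_eq h T q).symm)

theorem contDiff_loopA : ContDiff ℝ 1 (loopA : Param ρ → realLoops ρ) :=
  contDiff_const.add (plusIncl.comp (Param.aL (ρ := ρ))).contDiff

theorem contDiff_loopB (φ : ℝ) : ContDiff ℝ 1 (loopB φ : Param ρ → realLoops ρ) :=
  contDiff_const.add (plusIncl.comp (Param.bL (ρ := ρ))).contDiff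

theorem contDiff_loopC (φ : ℝ) : ContDiff ℝ 1 (loopC φ : Param ρ → realLoops ρ) :=
  contDiff_const.add (plusIncl.comp (Param.cL (ρ := ρ))).contDiff

theorem contDiff_r : ContDiff ℝ 1 (Param.r : Param ρ → ℝ) := Param.rL.contDiff

theorem contDiff_tripleP (φ : ℝ) : ContDiff ℝ 1 (tripleP (ρ := ρ) φ) := by
  have hr := contDiff_r (ρ := ρ)
  exact (hr.smul contDiff_loopA).prodMk
    ((hr.smul (contDiff_loopB φ)).prodMk (hr.smul (contDiff_loopC φ)))

theorem contDiff_tripleQ (φ : ℝ) : ContDiff ℝ 1 (tripleQ (ρ := ρ) φ) := by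
  have hr := contDiff_r (ρ := ρ)
  have ha := hr.smul (contDiff_loopA (ρ := ρ))
  exact ha.neg.prodMk ((hr.smul (contDiff_loopC φ)).prodMk (hr.smul (contDiff_loopB φ)))

theorem starInv_eq {f : ℂ → ℂ} {l : ℂ} (hl : ‖l‖ = 1) : starInv f l = starRingEnd ℂ (f l) := by
  rw [starInv, ← Complex.inv_eq_conj hl, one_div, inv_inv]

theorem boundaryOp_eq_zero_iff_starInv {θ : ℝ} {f : ℂ → ℂ} {g : realLoops ρ}
    (hfg : ∀ (l : ℂ) (hl : ‖l‖ = 1), f l = realEval l hl g) :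
    boundaryOp θ g = 0 ↔
      (∀ l : ℂ, ‖l‖ = 1 → f l - starInv f l = 0) ∧ f (Complex.exp (Complex.I * θ)) = 0 := by
  rw [boundaryOp_eq_zero_iff, ← hfg]
  refine and_congr_left fun _ => forall₂_congr fun l hl => ?_
  rw [starInv_eq hl, hfg l hl, sub_eq_zero, eq_comm]

/-- The equations of the Monodromy Problem with parameter angle `φ`. -/
def monodromySystem {φ : ℝ} (hP : φ ∈ Set.Ioo 0 π) (hQ : π / 2 - φ ∈ Set.Ioo 0 π)
    (q : ℝ × Param ρ) : WRplus ρ × WRplus ρ × WRplus ρ :=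
  (hatSystem hP (tripleP φ) q, hatSystem hQ (tripleQ φ) q, plusPart (detLoop φ q.2))

theorem eventually_solvesMonodromyProblem_iff {φ : ℝ} (hP : φ ∈ Set.Ioo 0 π)
    (hQ : π / 2 - φ ∈ Set.Ioo 0 π) :
    ∀ᶠ q : ℝ × Param ρ in 𝓝 (0, Param.center ρ),
      SolvesMonodromyProblem φ q.1 q.2 ↔ monodromySystem hP hQ q = 0 := by
  have hθ : ∀ᶠ q : ℝ × Param ρ in 𝓝 (0, Param.center ρ), q.2.θ ∈ Set.Ioo 0 π :=
    (Param.θL.continuous.comp continuous_snd).continuousAt.eventually_mem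
      (Ioo_mem_nhds Real.pi_div_two_pos (half_lt_self Real.pi_pos))
  filter_upwards [hθ,
    eventually_isRegular_axisCurve hP (contDiff_tripleP φ).continuous.continuousAt,
    eventually_isRegular_axisCurve hQ (contDiff_tripleQ φ).continuous.continuousAt]
    with q hθ hregP hregQ
  rw [monodromySystem, Prod.mk_eq_zero, Prod.mk_eq_zero, hatSystem, hatSystem,
    boundaryOp_eq_zero_iff_starInv fun _ => hatP_eq hP hregP,
    boundaryOp_eq_zero_iff_starInv fun _ => hatQ_eq hQ hregQ, plusPart_detLoop_eq_zero_iff]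
  exact ⟨fun h => ⟨⟨h.F_eq, h.H₁_eq⟩, ⟨h.G_eq, h.H₂_eq⟩, h.K_eq⟩,
    fun ⟨⟨hF, hH₁⟩, ⟨hG, hH₂⟩, hK⟩ => ⟨hF, hG, hK, hθ, hH₁, hH₂⟩⟩

end MonodromySystem

section Linearization

open Real (sin cos)
open scoped W Real

variable {ρ : ℝ} [Fact (1 < ρ)]

/-- The variation `b̃' + θ' sin φ` on which the linearization of `𝔮̂` depends. -/
def shiftedB (φ : ℝ) : Param ρ →L[ℝ] WRplus ρ :=
  Param.bL + sin φ • Param.θL.smulRight (plusMono 0)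

/-- The variation `c̃' + θ' cos φ` on which the linearization of `𝔭̂` depends. -/
def shiftedC (φ : ℝ) : Param ρ →L[ℝ] WRplus ρ :=
  Param.cL + cos φ • Param.θL.smulRight (plusMono 0)

theorem shiftedB_apply (φ : ℝ) (v : Param ρ) :
    shiftedB φ v = Param.bL v + (sin φ * Param.θL v) • plusMono 0 := by
  rw [mul_smul]
  rfl

theorem shiftedC_apply (φ : ℝ) (v : Param ρ) :
    shiftedC φ v = Param.cL v + (cos φ * Param.θL v) • plusMono 0 := by
  rw [mul_smul]
  rfl

theorem sin_smul_shiftedB_add_cos_smul_shiftedC (φ : ℝ) (v : Param ρ) :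
    sin φ • shiftedB φ v + cos φ • shiftedC φ v =
      (sin φ • Param.bL v + cos φ • Param.cL v) + Param.θL v • plusMono 0 := by
  have hθ : Param.θL v = sin φ * (sin φ * Param.θL v) + cos φ * (cos φ * Param.θL v) := by
    linear_combination -Param.θL v * Real.sin_sq_add_cos_sq φ
  rw [shiftedB_apply, shiftedC_apply]
  nth_rw 3 [hθ]
  module

theorem toeplitz_one_add_realMono_two_plusMono (k : ℕ) :
    toeplitz (1 + realMono 2 1 : realLoops ρ) (plusMono k) = plusMono k + plusMono (2 + k) := by
  rw [toeplitz_add, add_apply, toeplitz_one]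
  exact congrArg _ (toeplitz_realMono_plusMono 2 k)

theorem toeplitz_one_sub_realMono_two_plusMono (k : ℕ) :
    toeplitz (1 - realMono 2 1 : realLoops ρ) (plusMono k) = plusMono k - plusMono (2 + k) := by
  rw [toeplitz_sub, sub_apply, toeplitz_one]
  exact congrArg _ (toeplitz_realMono_plusMono 2 k)

theorem detDeriv_eq (φ : ℝ) (v : Param ρ) :
    detDeriv φ v = toeplitz (1 + realMono 2 1) (sin φ • shiftedB φ v + cos φ • shiftedC φ v) +
      unitCircleDivision
        (Param.aL v + Param.θL v • plusMono 0, -(2 * Param.θL v), -(2 * Param.rL v)) := by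
  have hdet : detDeriv φ v = toeplitz (1 - realMono 2 1) (Param.aL v) +
      toeplitz (1 + realMono 2 1) (sin φ • Param.bL v + cos φ • Param.cL v) -
        Param.rL v • (2 : ℝ) • plusMono 1 := rfl
  rw [hdet, sin_smul_shiftedB_add_cos_smul_shiftedC, unitCircleDivision, map_add _ (_ + _),
    map_smul, map_add _ (Param.aL v), map_smul, toeplitz_one_add_realMono_two_plusMono,
    toeplitz_one_sub_realMono_two_plusMono]
  module

/-- The derivative of `monodromySystem` with respect to the parameters at the central value. -/
def systemDeriv (φ : ℝ) : Param ρ →L[ℝ] WRplus ρ × WRplus ρ × WRplus ρ :=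
  ((2 * π) • (boundaryPlus (π / 2)).comp (shiftedC φ)).prod
    (((2 * π) • (boundaryPlus (π / 2)).comp (shiftedB φ)).prod (detDeriv φ))

theorem systemDeriv_apply (φ : ℝ) (v : Param ρ) :
    systemDeriv φ v = ((2 * π) • boundaryPlus (π / 2) (shiftedC φ v),
      (2 * π) • boundaryPlus (π / 2) (shiftedB φ v), detDeriv φ v) := rfl

theorem bijective_boundaryPlus (θ : ℝ) : Function.Bijective (boundaryPlus (ρ := ρ) θ) :=
  bijective_boundaryOp_plusIncl θ

theorem systemDeriv_injective (φ : ℝ) : Function.Injective (systemDeriv (ρ := ρ) φ) := by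
  refine (injective_iff_map_eq_zero _).2 fun v hv => ?_
  have hinj (u : WRplus ρ) (hu : (2 * π) • boundaryPlus (π / 2) u = 0) : u = 0 :=
    (map_eq_zero_iff _ (bijective_boundaryPlus _).injective).1
      ((smul_eq_zero_iff_right Real.two_pi_pos.ne').1 hu)
  rw [systemDeriv_apply, Prod.mk_eq_zero, Prod.mk_eq_zero] at hv
  obtain ⟨hc, hb, hdet⟩ := hv
  replace hc := hinj _ hc
  replace hb := hinj _ hb
  have hdiv : unitCircleDivision (0, 0, 0) = (0 : WRplus ρ) := by
    simp only [unitCircleDivision, map_zero, zero_smul, add_zero]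
  rw [detDeriv_eq, hb, hc, smul_zero, smul_zero, add_zero, map_zero, zero_add, ← hdiv,
    unitCircleDivision_injective.eq_iff, Prod.mk_inj, Prod.mk_inj, neg_eq_zero, neg_eq_zero,
    mul_eq_zero_iff_left two_ne_zero, mul_eq_zero_iff_left two_ne_zero] at hdet
  obtain ⟨ha, hθ, hr⟩ := hdet
  rw [hθ, zero_smul, add_zero] at ha
  rw [shiftedB_apply, hθ, mul_zero, zero_smul, add_zero] at hb
  rw [shiftedC_apply, hθ, mul_zero, zero_smul, add_zero] at hc
  exact Prod.ext ha (Prod.ext hb (Prod.ext hc (Prod.ext hr hθ)))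

theorem systemDeriv_surjective (φ : ℝ) : Function.Surjective (systemDeriv (ρ := ρ) φ) := by
  rintro ⟨y₁, y₂, y₃⟩
  have hsurj (y : WRplus ρ) : ∃ u, (2 * π) • boundaryPlus (π / 2) u = y := by
    obtain ⟨u, hu⟩ := (bijective_boundaryPlus (π / 2)).surjective ((2 * π)⁻¹ • y)
    exact ⟨u, hu ▸ smul_inv_smul₀ Real.two_pi_pos.ne' y⟩
  obtain ⟨c, hc⟩ := hsurj y₁
  obtain ⟨b, hb⟩ := hsurj y₂
  obtain ⟨⟨u, α, β⟩, hdiv⟩ := unitCircleDivision_surjective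
    (y₃ - toeplitz (1 + realMono 2 1) (sin φ • b + cos φ • c))
  let v : Param ρ := (u - (-α / 2) • plusMono 0, b - (sin φ * (-α / 2)) • plusMono 0,
    c - (cos φ * (-α / 2)) • plusMono 0, -β / 2, -α / 2)
  have hvb : shiftedB φ v = b := (shiftedB_apply φ v).trans (sub_add_cancel _ _)
  have hvc : shiftedC φ v = c := (shiftedC_apply φ v).trans (sub_add_cancel _ _)
  have hva : Param.aL v + Param.θL v • plusMono 0 = u := sub_add_cancel _ _
  have hvθ : -(2 * Param.θL v) = α := by
    change -(2 * (-α / 2)) = α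
    ring
  have hvr : -(2 * Param.rL v) = β := by
    change -(2 * (-β / 2)) = β
    ring
  refine ⟨v, ?_⟩
  rw [systemDeriv_apply, detDeriv_eq, hvb, hvc, hva, hvθ, hvr, hdiv, hc, hb, add_sub_cancel]

/-- The derivative of `monodromySystem` with respect to the parameters as an isomorphism. -/
def systemEquiv (φ : ℝ) : Param ρ ≃L[ℝ] WRplus ρ × WRplus ρ × WRplus ρ :=
  ContinuousLinearEquiv.ofBijective (systemDeriv φ)
    (LinearMap.ker_eq_bot.2 (systemDeriv_injective φ))
    (LinearMap.range_eq_top.2 (systemDeriv_surjective φ))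

end Linearization

section Family

open Real (sin cos)
open scoped W Real

variable {ρ : ℝ} [Fact (1 < ρ)] {φ : ℝ}

/-- The coefficient `a'₀ = a'₂` of the derivative of `a`. -/
def derivA (φ : ℝ) : ℝ := sin (2 * φ) * Real.log (Real.tan φ)

/-- The coefficient `b'₂` of the derivative of `b`. -/
def derivB₂ (φ : ℝ) : ℝ := -2 * cos φ * Real.log (cos φ)

/-- The coefficient `c'₂` of the derivative of `c`. -/
def derivC₂ (φ : ℝ) : ℝ := 2 * sin φ * Real.log (sin φ)

/-- The coefficient `b'₀` of the derivative of `b`. -/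
def derivB₀ (φ : ℝ) : ℝ := derivB₂ φ * cos (2 * φ) - derivC₂ φ * sin (2 * φ)

/-- The coefficient `c'₀` of the derivative of `c`. -/
def derivC₀ (φ : ℝ) : ℝ := -derivB₂ φ * sin (2 * φ) - derivC₂ φ * cos (2 * φ)

/-- The derivative `x'(0)` of the family of solutions. -/
def paramDeriv (φ : ℝ) : Param ρ :=
  (derivA φ • plusMono 0 + derivA φ • plusMono 2,
    derivB₀ φ • plusMono 0 + derivB₂ φ • plusMono 2,
    derivC₀ φ • plusMono 0 + derivC₂ φ • plusMono 2,
    0, 2 * sin (2 * φ) * Real.log (Real.tan φ))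

theorem sin_mul_derivB₂_add_cos_mul_derivC₂ (hφ : φ ∈ Set.Ioo 0 (π / 2)) :
    sin φ * derivB₂ φ + cos φ * derivC₂ φ = derivA φ := by
  have hs : sin φ ≠ 0 := (Real.sin_pos_of_pos_of_lt_pi hφ.1 (by linarith [hφ.2, Real.pi_pos])).ne'
  have hc : cos φ ≠ 0 := (Real.cos_pos_of_mem_Ioo ⟨by linarith [hφ.1, Real.pi_pos], hφ.2⟩).ne'
  rw [derivA, derivB₂, derivC₂, Real.tan_eq_sin_div_cos, Real.log_div hs hc, Real.sin_two_mul]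
  ring

theorem derivB₀_add_sin_mul_two_mul_derivA (hφ : φ ∈ Set.Ioo 0 (π / 2)) :
    derivB₀ φ + sin φ * (2 * derivA φ) = derivB₂ φ := by
  rw [derivB₀, ← sin_mul_derivB₂_add_cos_mul_derivC₂ hφ, Real.cos_two_mul', Real.sin_two_mul]
  linear_combination derivB₂ φ * Real.sin_sq_add_cos_sq φ

theorem derivC₀_add_cos_mul_two_mul_derivA (hφ : φ ∈ Set.Ioo 0 (π / 2)) :
    derivC₀ φ + cos φ * (2 * derivA φ) = derivC₂ φ := by
  rw [derivC₀, ← sin_mul_derivB₂_add_cos_mul_derivC₂ hφ, Real.cos_two_mul', Real.sin_two_mul]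
  linear_combination derivC₂ φ * Real.sin_sq_add_cos_sq φ

theorem θL_paramDeriv (φ : ℝ) : Param.θL (paramDeriv φ : Param ρ) = 2 * derivA φ :=
  mul_assoc _ _ _

theorem shiftedB_paramDeriv (hφ : φ ∈ Set.Ioo 0 (π / 2)) :
    shiftedB φ (paramDeriv φ : Param ρ) = derivB₂ φ • (plusMono 0 + plusMono 2) := by
  have hb : Param.bL (paramDeriv φ : Param ρ) =
    derivB₀ φ • plusMono 0 + derivB₂ φ • plusMono 2 := rfl
  rw [shiftedB_apply, θL_paramDeriv, hb, add_right_comm, ← add_smul,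
    derivB₀_add_sin_mul_two_mul_derivA hφ, smul_add]

theorem shiftedC_paramDeriv (hφ : φ ∈ Set.Ioo 0 (π / 2)) :
    shiftedC φ (paramDeriv φ : Param ρ) = derivC₂ φ • (plusMono 0 + plusMono 2) := by
  have hc : Param.cL (paramDeriv φ : Param ρ) =
    derivC₀ φ • plusMono 0 + derivC₂ φ • plusMono 2 := rfl
  rw [shiftedC_apply, θL_paramDeriv, hc, add_right_comm, ← add_smul,
    derivC₀_add_cos_mul_two_mul_derivA hφ, smul_add]

theorem detDeriv_paramDeriv (hφ : φ ∈ Set.Ioo 0 (π / 2)) :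
    detDeriv φ (paramDeriv φ : Param ρ) = 0 := by
  have ha : Param.aL (paramDeriv φ : Param ρ) =
    derivA φ • plusMono 0 + derivA φ • plusMono 2 := rfl
  have hr : Param.rL (paramDeriv φ : Param ρ) = 0 := rfl
  rw [detDeriv_eq, shiftedB_paramDeriv hφ, shiftedC_paramDeriv hφ, smul_smul, smul_smul, ← add_smul,
    sin_mul_derivB₂_add_cos_mul_derivC₂ hφ, unitCircleDivision, ha, hr, θL_paramDeriv]
  simp only [map_add, map_smul, toeplitz_one_add_realMono_two_plusMono,
    toeplitz_one_sub_realMono_two_plusMono]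
  module

/-- The derivative of `monodromySystem` with respect to `t` at the central value. -/
def timeDeriv (φ : ℝ) : WRplus ρ × WRplus ρ × WRplus ρ :=
  (-(2 * π * derivC₂ φ) • plusMono 2, -(2 * π * derivB₂ φ) • plusMono 2, 0)

theorem systemDeriv_paramDeriv (hφ : φ ∈ Set.Ioo 0 (π / 2)) :
    systemDeriv φ (paramDeriv φ : Param ρ) = -timeDeriv φ := by
  have hbd (κ : ℝ) : (2 * π) • boundaryPlus (π / 2) (κ • (plusMono 0 + plusMono 2) : WRplus ρ) =
      -(-(2 * π * κ) • plusMono 2) := by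
    have h : boundaryPlus (π / 2) (plusMono 0 + plusMono 2 : WRplus ρ) = plusMono 2 :=
      boundaryOp_pi_div_two_plusMono_zero_add_plusMono_two
    rw [map_smul, h, smul_smul, neg_smul, neg_neg]
  rw [systemDeriv_apply, shiftedB_paramDeriv hφ, shiftedC_paramDeriv hφ, detDeriv_paramDeriv hφ,
    hbd, hbd, timeDeriv, Prod.neg_mk, Prod.neg_mk, neg_zero]

theorem loopA_center :
    loopA (Param.center ρ) = realMono (-1) (1 / 2) - realMono 1 (1 / 2) := by
  have ha : Param.aL (Param.center ρ) = 0 := rfl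
  rw [loopA, ha, map_zero, add_zero]

theorem loopB_center (φ : ℝ) :
    loopB φ (Param.center ρ) =
      realMono (-1) (-(1 / 2) * sin φ) + realMono 1 (-(1 / 2) * sin φ) := by
  have hb : Param.bL (Param.center ρ) = 0 := rfl
  rw [loopB, hb, map_zero, add_zero]

theorem loopC_center (φ : ℝ) :
    loopC φ (Param.center ρ) =
      realMono (-1) (-(1 / 2) * cos φ) + realMono 1 (-(1 / 2) * cos φ) := by
  have hc : Param.cL (Param.center ρ) = 0 := rfl
  rw [loopC, hc, map_zero, add_zero]

theorem boundaryOp_pi_div_two_loopA_center_mul (κ : ℝ) :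
    boundaryOp (π / 2) (loopA (Param.center ρ) * (realMono (-1) κ + realMono 1 κ)) =
      -κ • plusMono 2 := by
  have hmul : loopA (Param.center ρ) * (realMono (-1) κ + realMono 1 κ) =
      realMono (-2) (1 / 2 * κ) - realMono 2 (1 / 2 * κ) := by
    rw [loopA_center, sub_mul, mul_add, mul_add, realMono_mul_realMono, realMono_mul_realMono,
      realMono_mul_realMono, realMono_mul_realMono]
    norm_num only
    abel
  rw [hmul, boundaryOp_pi_div_two_realMono_neg_two_sub_realMono_two]
  ring_nf

theorem tripleP_center (φ : ℝ) :
    tripleP φ (Param.center ρ) = (loopA (Param.center ρ), loopB φ (Param.center ρ),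
      loopC φ (Param.center ρ)) := by
  have hr : (Param.center ρ).r = 1 := rfl
  simp only [tripleP, hr, one_smul]

theorem tripleQ_center (φ : ℝ) :
    tripleQ φ (Param.center ρ) = (-loopA (Param.center ρ), loopC φ (Param.center ρ),
      loopB φ (Param.center ρ)) := by
  have hr : (Param.center ρ).r = 1 := rfl
  simp only [tripleQ, hr, one_smul]

theorem boundaryOp_hatRem_tripleP_center (hφ : φ ∈ Set.Ioo 0 (π / 2)) (hP : φ ∈ Set.Ioo 0 π) :
    boundaryOp (π / 2) (hatRem (axisCurve hP) 0 (tripleP φ (Param.center ρ))) =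
      -(2 * π * derivC₂ φ) • plusMono 2 := by
  rw [hatRem_axisCurve_zero hφ, tripleP_center, loopB_center, map_smul,
    boundaryOp_pi_div_two_loopA_center_mul, smul_smul, derivC₂]
  ring_nf

theorem boundaryOp_hatRem_tripleQ_center (hφ : φ ∈ Set.Ioo 0 (π / 2))
    (hQ : π / 2 - φ ∈ Set.Ioo 0 π) :
    boundaryOp (π / 2) (hatRem (axisCurve hQ) 0 (tripleQ φ (Param.center ρ))) =
      -(2 * π * derivB₂ φ) • plusMono 2 := by
  have hφ' : π / 2 - φ ∈ Set.Ioo 0 (π / 2) := ⟨sub_pos.2 hφ.2, sub_lt_self _ hφ.1⟩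
  rw [hatRem_axisCurve_zero hφ', tripleQ_center, loopC_center, map_smul]
  simp only [neg_mul, map_neg]
  rw [boundaryOp_pi_div_two_loopA_center_mul, ← neg_smul, smul_smul, derivB₂,
    Real.sin_pi_div_two_sub]
  ring_nf

theorem hasStrictFDerivAt_monodromySystem (hφ : φ ∈ Set.Ioo 0 (π / 2)) (hP : φ ∈ Set.Ioo 0 π)
    (hQ : π / 2 - φ ∈ Set.Ioo 0 π) :
    HasStrictFDerivAt (monodromySystem hP hQ)
      ((systemDeriv φ).comp (.snd ℝ ℝ (Param ρ)) +
        (ContinuousLinearMap.fst ℝ ℝ (Param ρ)).smulRight (timeDeriv φ))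
      (0, Param.center ρ) := by
  have hP' := hasStrictFDerivAt_hatSystem hP (contDiff_tripleP φ)
    (hasStrictFDerivAt_boundaryOp_leading (ρ := ρ) (cos φ) (L := Param.cL) rfl)
  have hQ' := hasStrictFDerivAt_hatSystem hQ (contDiff_tripleQ φ)
    (hasStrictFDerivAt_boundaryOp_leading (ρ := ρ) (sin φ) (L := Param.bL) rfl)
  have hdet : HasStrictFDerivAt (fun q : ℝ × Param ρ => plusPart (detLoop φ q.2))
      ((detDeriv φ).comp (.snd ℝ ℝ (Param ρ))) (0, Param.center ρ) :=
    HasStrictFDerivAt.comp (g := fun x => plusPart (detLoop φ x)) (f := Prod.snd)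
      ((0 : ℝ), Param.center ρ) (hasStrictFDerivAt_plusPart_detLoop φ) hasStrictFDerivAt_snd
  have hθ : Param.θL (Param.center ρ) = π / 2 := rfl
  rw [hθ, boundaryOp_hatRem_tripleP_center hφ] at hP'
  rw [hθ, boundaryOp_hatRem_tripleQ_center hφ] at hQ'
  refine (hP'.prodMk (hQ'.prodMk hdet)).congr_fderiv (ContinuousLinearMap.ext fun v => ?_)
  refine Prod.ext rfl (Prod.ext rfl ?_)
  change _ = detDeriv φ v.2 + v.1 • (0 : WRplus ρ)
  rw [smul_zero, add_zero]
  rfl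

theorem monodromySystem_center (hP : φ ∈ Set.Ioo 0 π) (hQ : π / 2 - φ ∈ Set.Ioo 0 π) :
    monodromySystem hP hQ (0, Param.center ρ) = 0 := by
  have hlead (κ : ℝ) :
      boundaryOp (π / 2) (realMono (-1) κ + realMono 1 κ : realLoops ρ) = 0 := by
    rw [boundaryOp_realMono_neg_one_add_realMono_one, Real.cos_pi_div_two, mul_zero, zero_smul]
  have hθ : Param.θL (Param.center ρ) = π / 2 := rfl
  have hr : (Param.center ρ).r = 1 := rfl
  have ha : Param.aL (Param.center ρ) = 0 := rfl
  have hb : Param.bL (Param.center ρ) = 0 := rfl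
  have hc : Param.cL (Param.center ρ) = 0 := rfl
  rw [monodromySystem, hatSystem_eq, hatSystem_eq, tripleP_center, tripleQ_center, loopB_center,
    loopC_center, hθ, hlead, hlead, detLoop_eq, detLinear_center, ha, hb, hc, hr]
  simp only [smul_zero, zero_smul, add_zero, map_zero, ne_eq, OfNat.ofNat_ne_zero,
    not_false_eq_true, zero_pow, sub_self, mul_zero, one_pow, Prod.mk_zero_zero]

theorem exists_implicit_curve {E F : Type*} [NormedAddCommGroup E] [NormedSpace ℝ E]
    [CompleteSpace E] [NormedAddCommGroup F] [NormedSpace ℝ F] [CompleteSpace F]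
    {f : ℝ × E → F} {L : E ≃L[ℝ] F} {g : F} {x₀ v : E}
    (hf : HasStrictFDerivAt f ((L : E →L[ℝ] F).comp (.snd ℝ ℝ E) +
      (ContinuousLinearMap.fst ℝ ℝ E).smulRight g) (0, x₀))
    (hf₀ : f (0, x₀) = 0) (hv : L v = -g) :
    ∃ x : ℝ → E, x 0 = x₀ ∧ HasDerivAt x v 0 ∧ (∀ᶠ t in 𝓝 0, f (t, x t) = 0) ∧
      ∀ᶠ q in 𝓝 (0, x₀), f q = 0 → q.2 = x q.1 := by
  set f' := (L : E →L[ℝ] F).comp (.snd ℝ ℝ E) +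
    (ContinuousLinearMap.fst ℝ ℝ E).smulRight g
  have hinr : f'.comp (.inr ℝ ℝ E) = (L : E →L[ℝ] F) := by
    ext u
    simp [f']
  have hinl : f'.comp (.inl ℝ ℝ E) 1 = g := by simp [f']
  have hinv : (f'.comp (.inr ℝ ℝ E)).IsInvertible := ⟨L, hinr.symm⟩
  have huniq := hf.eventually_apply_eq_iff_implicitFunctionOfProdDomain hinv
  have hsol := hf.eventually_apply_implicitFunctionOfProdDomain hinv
  have hderiv := (hf.hasStrictFDerivAt_implicitFunctionOfProdDomain hinv).hasFDerivAt.hasDerivAt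
  rw [hf₀] at huniq hsol
  refine ⟨hf.implicitFunctionOfProdDomain hinv, (huniq.self_of_nhds).1 hf₀,
    hderiv.congr_deriv ?_, hsol, huniq.mono fun q hq h => (hq.1 h).symm⟩
  change -((f'.comp (.inr ℝ ℝ E)).inverse (f'.comp (.inl ℝ ℝ E) 1)) = v
  rw [hinl, hinr, ContinuousLinearMap.inverse_equiv, ← map_neg, ← hv]
  exact L.symm_apply_apply v

theorem exists_family (hφ : φ ∈ Set.Ioo 0 (π / 2)) :
    ∃ x : ℝ → Param ρ, x 0 = Param.center ρ ∧ HasDerivAt x (paramDeriv φ) 0 ∧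
      (∀ᶠ t in 𝓝 (0 : ℝ), SolvesMonodromyProblem φ t (x t)) ∧
      ∀ᶠ q : ℝ × Param ρ in 𝓝 (0, Param.center ρ),
        SolvesMonodromyProblem φ q.1 q.2 → q.2 = x q.1 := by
  have hP : φ ∈ Set.Ioo 0 π := ⟨hφ.1, hφ.2.trans (half_lt_self Real.pi_pos)⟩
  have hQ : π / 2 - φ ∈ Set.Ioo 0 π := ⟨sub_pos.2 hφ.2, by linarith [hφ.1, Real.pi_pos]⟩
  obtain ⟨x, hx₀, hx, hsol, huniq⟩ := exists_implicit_curve (L := systemEquiv φ)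
    (hasStrictFDerivAt_monodromySystem (ρ := ρ) hφ hP hQ) (monodromySystem_center hP hQ)
    (systemDeriv_paramDeriv hφ)
  have hiff := eventually_solvesMonodromyProblem_iff (ρ := ρ) hP hQ
  have hlim : Tendsto (fun t => (t, x t)) (𝓝 0) (𝓝 (0, Param.center ρ)) :=
    hx₀ ▸ (continuousAt_id.prodMk hx.continuousAt).tendsto
  refine ⟨x, hx₀, hx, ?_, ?_⟩
  · filter_upwards [hsol, hlim.eventually hiff] with t ht hiff_t
    exact hiff_t.2 ht
  · filter_upwards [huniq, hiff] with q hq hiff_q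
    exact fun h => hq (hiff_q.1 h)

theorem coe_smul_plusMono_zero_add_smul_plusMono_two (p q : ℝ) :
    ((p • plusMono 0 + q • plusMono 2 : WRplus ρ) : W ρ) = W.mono 0 p + W.mono 2 q := by
  rw [← coe_plusIncl, map_add, map_smul, map_smul, plusIncl_plusMono, plusIncl_plusMono,
    smul_realMono, smul_realMono, mul_one, mul_one]
  rfl

theorem hasDerivAt_const_add_coe {x : ℝ → Param ρ} {v : Param ρ} (hx : HasDerivAt x v 0)
    (L : Param ρ →L[ℝ] WRplus ρ) (f : W ρ) :
    HasDerivAt (fun t => f + (L (x t) : W ρ)) (L v : W ρ) 0 :=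
  (((WRplus ρ).subtypeL.comp L).hasFDerivAt.comp_hasDerivAt (0 : ℝ) hx).const_add f

end Family

end DPW

end

theorem mainTheorem10 (φ : ℝ) (hφ : φ ∈ Set.Ioo 0 (Real.pi / 2)) (ρ : ℝ) [Fact (1 < ρ)] :
    ∃ x : ℝ → DPW.Param ρ,
      -- `x` is the family of solutions of the Monodromy Problem through the central value,
      -- and locally the only one
      x 0 = DPW.Param.center ρ ∧
      ContinuousAt x 0 ∧
      (∀ᶠ t in 𝓝 (0 : ℝ), DPW.SolvesMonodromyProblem φ t (x t)) ∧
      (∀ᶠ q : ℝ × DPW.Param ρ in 𝓝 (0, DPW.Param.center ρ),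
        DPW.SolvesMonodromyProblem φ q.1 q.2 → q.2 = x q.1) ∧
      -- its derivatives at `t = 0`
      ∃ a₀ a₂ b₀ b₂ c₀ c₂ : ℝ,
        HasDerivAt (fun t => (x t).a) (DPW.W.mono 0 a₀ + DPW.W.mono 2 a₂) 0 ∧
        HasDerivAt (fun t => (x t).b φ) (DPW.W.mono 0 b₀ + DPW.W.mono 2 b₂) 0 ∧
        HasDerivAt (fun t => (x t).c φ) (DPW.W.mono 0 c₀ + DPW.W.mono 2 c₂) 0 ∧
        a₀ = Real.sin (2 * φ) * Real.log (Real.tan φ) ∧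
        a₂ = Real.sin (2 * φ) * Real.log (Real.tan φ) ∧
        b₂ = -2 * Real.cos φ * Real.log (Real.cos φ) ∧
        c₂ = 2 * Real.sin φ * Real.log (Real.sin φ) ∧
        b₀ = b₂ * Real.cos (2 * φ) - c₂ * Real.sin (2 * φ) ∧
        c₀ = -b₂ * Real.sin (2 * φ) - c₂ * Real.cos (2 * φ) ∧
        HasDerivAt (fun t => (x t).r) 0 0 ∧
        HasDerivAt (fun t => (x t).θ) (2 * Real.sin (2 * φ) * Real.log (Real.tan φ)) 0 := by
  obtain ⟨x, hx₀, hx, hsol, huniq⟩ := DPW.exists_family (ρ := ρ) hφ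
  have hcoe := DPW.coe_smul_plusMono_zero_add_smul_plusMono_two (ρ := ρ)
  exact ⟨x, hx₀, hx.continuousAt, hsol, huniq, DPW.derivA φ, DPW.derivA φ, DPW.derivB₀ φ,
    DPW.derivB₂ φ, DPW.derivC₀ φ, DPW.derivC₂ φ,
    (DPW.hasDerivAt_const_add_coe hx DPW.Param.aL _).congr_deriv (hcoe _ _),
    (DPW.hasDerivAt_const_add_coe hx DPW.Param.bL _).congr_deriv (hcoe _ _),
    (DPW.hasDerivAt_const_add_coe hx DPW.Param.cL _).congr_deriv (hcoe _ _),
    rfl, rfl, rfl, rfl, rfl, rfl,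
    DPW.Param.rL.hasFDerivAt.comp_hasDerivAt (0 : ℝ) hx,
    DPW.Param.θL.hasFDerivAt.comp_hasDerivAt (0 : ℝ) hx⟩
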